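/- Let $K=\mathbb{C}(\lambda)$, with $\lambda$ an indeterminate, and for $a,b$ in a commutative ring let $f(z)=z^3+az+b$, $f'(z)=3z^2+a$, and let $\Phi_2(a,b,z)$ be the polynomial with $f(f(z))-z=(f(z)-z)\,\Phi_2(a,b,z)$. Let $Y_1(2)\subset\mathbb{A}^4_K$ be the closed subscheme with coordinates $(a,b,z_1,z_2)$ defined by $$f(z_1)=z_2,\qquad f(z_2)=z_1,\qquad \Phi_2(a,b,z_1)=0,\qquad f'(z_1)f'(z_2)=\lambda,$$ and let $Y_0(2)$ be the quotient of $Y_1(2)$ by the involution $(a,b,z_1,z_2)\mapsto(a,b,z_2,z_1)$ (the spectrum of the ring of invariants). Let $X_1(2)$ and $X_0(2)$ be smooth projective curves over $K$ birational over $K$ to $Y_1(2)$ and $Y_0(2)$, respectively (with chosen birational maps), and let $E_0,E_1$ be the projective plane cubic curves over $K$ with affine equations $$E_0: v^2=u(u^2+2u+1-\lambda),\qquad E_1: e^2=d(d^2-4d+4\lambda).$$ Then $E_0$ and $E_1$ are smooth projective curves birational over $K$ to $Y_0(2)$ and $Y_1(2)$, respectively (so that such $X_0(2)$, $X_1(2)$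 exist). There is an isogeny $\psi:E_1\to E_0$ over $K$ whose kernel is the group of order $2$ generated by $(0,0)$, given at points with $d\neq 0$ by $$u=\frac{e^2}{4d^2},\qquad v=\frac{e(4\lambda-d^2)}{8d^2}.$$ For every choice of $X_1(2)$, $X_0(2)$ and of the birational maps, there is a unique morphism $\pi:X_1(2)\to X_0(2)$ over $K$ induced by the quotient map $Y_1(2)\to Y_0(2)$, and for each choice of a square root $\sqrt{-2}\in\mathbb{C}$ there are isomorphisms $\varphi_1:X_1(2)\to E_1$ and $\varphi_0:X_0(2)\to E_0$ over $K$ with $\varphi_0\circ\pi=\psi\circ\varphi_1$ such that, wherever both the birational map to the affine model and the formula are defined, the coordinate functions of the affine models are $$a=\frac{4u^2-4u+1-\lambda}{6u},\qquad b=\frac{\sqrt{-2}\,(8u^2+16u+\lambda-1)\,v}{54u^2}$$ on $X_0(2)\cong E_0$ (for $u\ne0$), and on $X_1(2)\cong E_1$ (for $e\neq0$) they are these same $a,b$ composed with $\psi$, together with $$z_1=\frac{\sqrt{-2}\,(d^2-6d+8\lambda)}{6e}.$$ -/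

import Mathlib

open CategoryTheory AlgebraicGeometry WeierstrassCurve.Affine

noncomputable section

namespace TwoCycles

/-! ### Projective schemes over a field -/

section Proj

variable (F : Type) [Field F]

/-- The category of schemes over a field `F`. -/
abbrev SchOver : Type 1 := Over (Spec (.of F))

variable {F}

/-- `Proj` of a graded `F`-algebra, as an `F`-scheme. -/
def projOver {A : Type} [CommRing A] [Algebra F A] (𝒜 : ℕ → Submodule F A) [GradedAlgebra 𝒜] :
    SchOver F :=
  Over.mk (Proj.toSpecZero 𝒜 ≫ Spec.map (CommRingCat.ofHom (algebraMap F (𝒜 0))))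

variable (F) in
/-- Projective space `ℙⁿ` over `F`. -/
def projSpace (n : ℕ) : SchOver F :=
  letI : GradedAlgebra (MvPolynomial.homogeneousSubmodule (Fin (n + 1)) F) :=
    MvPolynomial.gradedAlgebra
  projOver (MvPolynomial.homogeneousSubmodule (Fin (n + 1)) F)

/-- A smooth projective curve over `F`: an integral `F`-scheme, smooth of relative dimension one,
that is a closed subscheme of some projective space over `F`. -/
structure IsSmoothProjectiveCurve (X : SchOver F) : Prop where
  isIntegral : IsIntegral X.left
  smooth : SmoothOfRelativeDimension 1 X.hom
  projective : ∃ (n : ℕ) (i : X ⟶ projSpace F n), IsClosedImmersion i.left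

end Proj

/-! ### Weierstrass curves as projective plane curves -/

section Weierstrass

variable {F : Type} [Field F] (W : WeierstrassCurve F)

/-- The homogeneous coordinate ring `F[X, Y, Z] / (Y²Z + ⋯ - X³ - ⋯)` of a Weierstrass curve. -/
abbrev HomogCoordRing : Type :=
  MvPolynomial (Fin 3) F ⧸ Ideal.span {W.toProjective.polynomial}

/-- The degree `n` part of the homogeneous coordinate ring. -/
def grading (n : ℕ) : Submodule F (HomogCoordRing W) :=
  (MvPolynomial.homogeneousSubmodule (Fin 3) F n).map
    (Ideal.Quotient.mkₐ F (Ideal.span {W.toProjective.polynomial})).toLinearMap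

lemma mk_mem_grading {n : ℕ} {p : MvPolynomial (Fin 3) F} (hp : p.IsHomogeneous n) :
    (Ideal.Quotient.mk (Ideal.span {W.toProjective.polynomial}) p) ∈ grading W n :=
  ⟨p, hp, rfl⟩

lemma polynomial_isHomogeneous : (W.toProjective.polynomial).IsHomogeneous 3 := by
  have hX (i : Fin 3) := MvPolynomial.isHomogeneous_X F i
  have hC (c : F) := MvPolynomial.isHomogeneous_C (Fin 3) c
  rw [WeierstrassCurve.Projective.polynomial]
  refine .sub (.add (.add ?_ ?_) ?_) (.add (.add (.add ?_ ?_) ?_) ?_)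
  · exact ((hX 1).pow 2).mul (hX 2)
  · exact (((hC _).mul (hX 0)).mul (hX 1)).mul (hX 2)
  · exact ((hC _).mul (hX 1)).mul ((hX 2).pow 2)
  · exact (hX 0).pow 3
  · exact ((hC _).mul ((hX 0).pow 2)).mul (hX 2)
  · exact ((hC _).mul (hX 0)).mul ((hX 2).pow 2)
  · exact (hC _).mul ((hX 2).pow 3)

instance : SetLike.GradedMonoid (grading W) where
  one_mem := mk_mem_grading W (MvPolynomial.isHomogeneous_one _ _)
  mul_mem := by
    rintro i j _ _ ⟨p, hp, rfl⟩ ⟨q, hq, rfl⟩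
    exact mk_mem_grading W (MvPolynomial.IsHomogeneous.mul hp hq)

open DirectSum in
/-- The map sending a family of homogeneous polynomials to the family of their classes. -/
def mkGraded : (⨁ n, MvPolynomial.homogeneousSubmodule (Fin 3) F n) →ₐ[F] ⨁ n, grading W n :=
  DirectSum.toAlgebra F (fun n => MvPolynomial.homogeneousSubmodule (Fin 3) F n)
    (fun n => DirectSum.lof F ℕ (fun n => grading W n) n ∘ₗ
      LinearMap.restrict (Ideal.Quotient.mkₐ F _).toLinearMap
        (fun _ hp => mk_mem_grading W hp))
    rfl
    (fun ai aj => by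
      simp only [LinearMap.comp_apply, DirectSum.lof_eq_of]
      rw [DirectSum.of_mul_of]
      rfl)

open DirectSum in
/-- Splitting a polynomial into the classes of its homogeneous components. -/
def splitPoly : MvPolynomial (Fin 3) F →ₐ[F] ⨁ n, grading W n :=
  letI : GradedAlgebra (MvPolynomial.homogeneousSubmodule (Fin 3) F) := MvPolynomial.gradedAlgebra
  (mkGraded W).comp
    (DirectSum.decomposeAlgEquiv (MvPolynomial.homogeneousSubmodule (Fin 3) F)).toAlgHom

lemma splitPoly_of_isHomogeneous {n : ℕ} {p : MvPolynomial (Fin 3) F} (hp : p.IsHomogeneous n) :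
    splitPoly W p = DirectSum.of (fun n => grading W n) n ⟨_, mk_mem_grading W hp⟩ := by
  let _ : GradedAlgebra (MvPolynomial.homogeneousSubmodule (Fin 3) F) := MvPolynomial.gradedAlgebra
  have h := DirectSum.decompose_of_mem (MvPolynomial.homogeneousSubmodule (Fin 3) F) hp
  refine (congrArg (mkGraded W) h).trans ?_
  exact DirectSum.toAddMonoid_of _ _ _

instance : GradedAlgebra (grading W) :=
  GradedAlgebra.ofAlgHom (grading W)
    (Ideal.Quotient.liftₐ _ (splitPoly W) (by
      intro p hp
      obtain ⟨q, rfl⟩ := Ideal.mem_span_singleton'.mp hp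
      rw [map_mul, splitPoly_of_isHomogeneous W (polynomial_isHomogeneous W)]
      convert mul_zero _
      rw [← map_zero (DirectSum.of (fun n => grading W n) 3)]
      congr 1
      exact Subtype.ext (Ideal.Quotient.eq_zero_iff_mem.mpr (Ideal.mem_span_singleton_self _))))
    (by
      apply Ideal.Quotient.algHom_ext
      ext i
      have h := splitPoly_of_isHomogeneous W (MvPolynomial.isHomogeneous_X F i)
      change DirectSum.coeAlgHom (grading W) (splitPoly W (MvPolynomial.X i)) = _
      rw [h]
      exact DirectSum.coeAlgHom_of _ _ _)
    (by
      rintro n ⟨_, p, hp, rfl⟩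
      exact splitPoly_of_isHomogeneous W hp)

/-- The projective plane curve of a Weierstrass curve `W` over `F`, as an `F`-scheme:
`Proj F[X, Y, Z] / (Y²Z + a₁XYZ + a₃YZ² - X³ - a₂X²Z - a₄XZ² - a₆Z³)`. -/
def weierstrassScheme : SchOver F := projOver (grading W)

variable {W}

/-- The evaluation of the homogeneous coordinate ring at a vector on the cone over the curve. -/
def evalCone {L : Type} [Field L] [Algebra F L] (v : Fin 3 → L)
    (hv : (W.baseChange L).toProjective.Equation v) : HomogCoordRing W →+* L :=
  Ideal.Quotient.lift _ (MvPolynomial.aeval v).toRingHom (by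
    intro p hp
    obtain ⟨q, rfl⟩ := Ideal.mem_span_singleton'.mp hp
    have h : MvPolynomial.aeval v W.toProjective.polynomial = 0 := by
      have h := hv
      rw [WeierstrassCurve.Projective.Equation] at h
      erw [WeierstrassCurve.Projective.map_polynomial] at h
      rwa [MvPolynomial.eval_map] at h
    simp [h])

/-- The `L`-point `[v₀ : v₁ : v₂]` of the projective curve of `W`. -/
def pointOfVec {L : Type} [Field L] [Algebra F L] (v : Fin 3 → L)
    (hv : (W.baseChange L).toProjective.Equation v) (i : Fin 3) (hi : v i ≠ 0) :
    Spec (.of L) ⟶ (weierstrassScheme W).left :=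
  Proj.fromOfGlobalSections (grading W)
    ((Scheme.ΓSpecIso (.of L)).inv.hom.comp (evalCone v hv)) (by
      have hmem : (Ideal.Quotient.mk (Ideal.span {W.toProjective.polynomial})
          (MvPolynomial.X i)) ∈ (HomogeneousIdeal.irrelevant (grading W)).toIdeal := by
        have h := mk_mem_grading W (MvPolynomial.isHomogeneous_X F i)
        change GradedRing.proj (grading W) 0 _ = 0
        rw [GradedRing.proj_apply]
        exact DirectSum.decompose_of_mem_ne (grading W) h one_ne_zero
      refine Ideal.eq_top_of_isUnit_mem _ (Ideal.mem_map_of_mem _ hmem) ?_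
      rw [RingHom.comp_apply]
      refine IsUnit.map _ (isUnit_iff_ne_zero.mpr ?_)
      simpa [evalCone] using hi)

/-- The morphism `Spec L → E` of an `L`-point of the Weierstrass curve `E`: the point at infinity
is `[0 : 1 : 0]` and the affine point `(x, y)` is `[x : y : 1]`. -/
def pointHom {L : Type} [Field L] [Algebra F L] :
    (W.baseChange L).toAffine.Point → (Spec (.of L) ⟶ (weierstrassScheme W).left)
  | .zero => pointOfVec ![0, 1, 0] WeierstrassCurve.Projective.equation_zero 1 (by simp)
  | .some x y h => pointOfVec ![x, y, 1]
      ((WeierstrassCurve.Projective.equation_some x y).mpr h.1) 2 (by simp)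

end Weierstrass

/-! ### Cubic polynomials with a marked point of period two -/

section Cubic

variable {R : Type*} [CommRing R]

/-- The cubic polynomial `f(z) = z³ + az + b`. -/
def cubic (a b z : R) : R := z ^ 3 + a * z + b

/-- The derivative `f'(z) = 3z² + a`. -/
def cubicDeriv (a z : R) : R := 3 * z ^ 2 + a

open Polynomial in
lemma cubicDeriv_eq (a b z : R) : cubicDeriv a z = (derivative (cubic (C a) (C b) X)).eval z := by
  simp [cubic, cubicDeriv]; ring

/-- The second dynatomic polynomial of `z³ + az + b`. -/
def Φ₂ (a b z : R) : R :=
  z ^ 6 + 2 * a * z ^ 4 + z ^ 4 + 2 * b * z ^ 3 + a ^ 2 * z ^ 2 + a * z ^ 2 + z ^ 2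
    + 2 * a * b * z + b * z + a + b ^ 2 + 1

/-- `f²(z) - z = Φ₁ Φ₂` with `Φ₁ = f(z) - z`. -/
lemma cubic_cubic_sub (a b z : R) : cubic a b (cubic a b z) - z = (cubic a b z - z) * Φ₂ a b z := by
  simp only [cubic, Φ₂]; ring

end Cubic

/-- The field `ℂ(λ)`. -/
abbrev K : Type := RatFunc ℂ

/-- The element `λ` of `ℂ(λ)`. -/
abbrev lam : K := RatFunc.X

/-- Coordinate functions `a, b, z₁, z₂` on affine `4`-space over `ℂ(λ)`. -/
abbrev Coord : Type := MvPolynomial (Fin 4) K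

namespace Coord
/-- The coordinate `a`. -/
abbrev a : Coord := MvPolynomial.X 0
/-- The coordinate `b`. -/
abbrev b : Coord := MvPolynomial.X 1
/-- The coordinate `z₁`. -/
abbrev z₁ : Coord := MvPolynomial.X 2
/-- The coordinate `z₂`. -/
abbrev z₂ : Coord := MvPolynomial.X 3
end Coord

open Coord in
/-- The equations of `Y₁(2)`: `f(z₁) = z₂`, `f(z₂) = z₁`, `Φ₂(a, b, z₁) = 0` and
`f'(z₁) f'(z₂) = λ`. -/
def idealY : Ideal Coord :=
  Ideal.span {cubic a b z₁ - z₂, cubic a b z₂ - z₁, Φ₂ a b z₁,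
    cubicDeriv a z₁ * cubicDeriv a z₂ - MvPolynomial.C lam}

/-- The coordinate ring of `Y₁(2)`. -/
abbrev RingY₁ : Type := Coord ⧸ idealY

/-- The substitution exchanging `z₁` and `z₂`. -/
def swapCoord : Coord →ₐ[K] Coord := MvPolynomial.rename (Equiv.swap (2 : Fin 4) 3)

open Coord in
lemma idealY_le_comap : idealY ≤ idealY.comap swapCoord := by
  have ha : swapCoord a = a := by
    simp [swapCoord, MvPolynomial.rename_X, Equiv.swap_apply_of_ne_of_ne]
  have hb : swapCoord b = b := by
    simp [swapCoord, MvPolynomial.rename_X, Equiv.swap_apply_of_ne_of_ne]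
  have h₁ : swapCoord z₁ = z₂ := by simp [swapCoord, MvPolynomial.rename_X]
  have h₂ : swapCoord z₂ = z₁ := by simp [swapCoord, MvPolynomial.rename_X]
  have hC : swapCoord (MvPolynomial.C lam) = MvPolynomial.C lam := by
    simp [swapCoord]
  have m₁ : cubic a b z₁ - z₂ ∈ idealY := Ideal.subset_span (by simp)
  have m₂ : cubic a b z₂ - z₁ ∈ idealY := Ideal.subset_span (by simp)
  have m₃ : Φ₂ a b z₁ ∈ idealY := Ideal.subset_span (by simp)
  have m₄ : cubicDeriv a z₁ * cubicDeriv a z₂ - MvPolynomial.C lam ∈ idealY :=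
    Ideal.subset_span (by simp)
  refine Ideal.span_le.mpr ?_
  rintro p (rfl | rfl | rfl | rfl)
  · simpa [cubic, ha, hb, h₁, h₂] using m₂
  · simpa [cubic, ha, hb, h₁, h₂] using m₁
  · change swapCoord _ ∈ idealY
    have h : swapCoord (Φ₂ a b z₁) = Φ₂ a b z₂ := by
      simp only [Φ₂, map_add, map_mul, map_pow, map_one, map_ofNat, ha, hb, h₁]
    have e : Φ₂ a b z₂ = Φ₂ a b z₁ - (z₁ + cubic a b z₁ + z₂) * (cubic a b z₁ - z₂)
        + (z₂ + cubic a b z₂ + z₁) * (cubic a b z₂ - z₁) := by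
      simp only [Φ₂, cubic]; ring
    rw [h, e]
    exact add_mem (sub_mem m₃ (Ideal.mul_mem_left _ _ m₁)) (Ideal.mul_mem_left _ _ m₂)
  · change swapCoord _ ∈ idealY
    have h : swapCoord (cubicDeriv a z₁ * cubicDeriv a z₂ - MvPolynomial.C lam) =
        cubicDeriv a z₁ * cubicDeriv a z₂ - MvPolynomial.C lam := by
      simp only [cubicDeriv, map_sub, map_mul, map_add, map_pow, ha, h₁, h₂, hC, map_ofNat]
      ring
    rw [h]
    exact m₄

/-- The automorphism of the coordinate ring of `Y₁(2)` exchanging `z₁` and `z₂`. -/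
def swapY₁ : RingY₁ →ₐ[K] RingY₁ := Ideal.quotientMapₐ idealY swapCoord idealY_le_comap

/-- The coordinate ring of `Y₀(2)`: the functions on `Y₁(2)` invariant under the exchange of `z₁`
and `z₂`. -/
def RingY₀ : Subalgebra K RingY₁ := AlgHom.equalizer swapY₁ (AlgHom.id K RingY₁)

/-- `Y₁(2)`, over `ℂ(λ)`. -/
def Y₁ : SchOver K := Over.mk (Spec.map (CommRingCat.ofHom (algebraMap K RingY₁)))

/-- `Y₀(2)`, the quotient of `Y₁(2)` by the exchange of `z₁` and `z₂`. -/
def Y₀ : SchOver K := Over.mk (Spec.map (CommRingCat.ofHom (algebraMap K RingY₀)))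

/-- The quotient map `Y₁(2) → Y₀(2)`. -/
def quotientMap : Y₁ ⟶ Y₀ :=
  Over.homMk (Spec.map (CommRingCat.ofHom (RingY₀.val : RingY₀ →+* RingY₁))) (by
    simp only [Y₁, Y₀, Over.mk_hom, Over.mk_left]
    rw [← Spec.map_comp, ← CommRingCat.ofHom_comp]
    rfl)

/-- The function `a` on `Y₁(2)`. -/
def a₁ : RingY₁ := Ideal.Quotient.mk idealY Coord.a
/-- The function `b` on `Y₁(2)`. -/
def b₁ : RingY₁ := Ideal.Quotient.mk idealY Coord.b
/-- The function `z₁` (the marked point) on `Y₁(2)`. -/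
def z₁ : RingY₁ := Ideal.Quotient.mk idealY Coord.z₁
/-- The function `a` on `Y₀(2)`. -/
def a₀ : RingY₀ := ⟨a₁, by
  change Ideal.Quotient.mk idealY (swapCoord Coord.a) = Ideal.Quotient.mk idealY Coord.a
  simp [swapCoord, MvPolynomial.rename_X, Equiv.swap_apply_of_ne_of_ne]⟩
/-- The function `b` on `Y₀(2)`. -/
def b₀ : RingY₀ := ⟨b₁, by
  change Ideal.Quotient.mk idealY (swapCoord Coord.b) = Ideal.Quotient.mk idealY Coord.b
  simp [swapCoord, MvPolynomial.rename_X, Equiv.swap_apply_of_ne_of_ne]⟩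

/-- The value of a function `r ∈ R` at a point `Spec L → Spec R`. -/
def valueAt {R L : Type} [CommRing R] [Field L] (y : Spec (.of L) ⟶ Spec (.of R)) (r : R) : L :=
  (Spec.preimage y).hom r

/-! ### Smooth projective models -/

/-- A birational map over `F` between `F`-schemes: an isomorphism over `F` of a dense open
subscheme of the source with a dense open subscheme of the target. -/
structure BirationalMap {F : Type} [Field F] (X Y : SchOver F) where
  /-- The isomorphism between dense open subschemes. -/
  toPartialIso : X.left.PartialIso Y.left
  isOver : toPartialIso.IsOver X.hom Y.hom

namespace BirationalMap

variable {F : Type} [Field F] {X Y X' Y' : SchOver F} (β : BirationalMap X Y)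
  (β' : BirationalMap X' Y')

/-- The dense open subscheme on which a birational map is defined. -/
abbrev source : Scheme := β.toPartialIso.source.toScheme

/-- The inclusion of the domain of definition. -/
abbrev incl : β.source ⟶ X.left := β.toPartialIso.source.ι

/-- The birational map as a morphism on its domain of definition. -/
abbrev toHom : β.source ⟶ Y.left := β.toPartialIso.iso.hom ≫ β.toPartialIso.target.ι

/-- `π : X → X'` is induced by `q : Y → Y'` through the birational maps `β : X ⇢ Y` and
`β' : X' ⇢ Y'`: whenever `x` and `x'` are (scheme-valued) points at which `β` and `β'` are defined
and `q(β(x)) = β'(x')`, one has `π(x) = x'`. -/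
def Induces (q : Y ⟶ Y') (π : X ⟶ X') : Prop :=
  ∀ (T : Scheme.{0}) (x : T ⟶ β.source) (x' : T ⟶ β'.source),
    x ≫ β.toHom ≫ q.left = x' ≫ β'.toHom → x ≫ β.incl ≫ π.left = x' ≫ β'.incl

end BirationalMap

/-! ### The elliptic curves -/

/-- `E₀ : v² = u (u² + 2u + 1 - λ)`. -/
def E₀ : WeierstrassCurve K := { a₁ := 0, a₂ := 2, a₃ := 0, a₄ := 1 - lam, a₆ := 0 }

/-- `E₁ : e² = d (d² - 4d + 4λ)`. -/
def E₁ : WeierstrassCurve K := { a₁ := 0, a₂ := -4, a₃ := 0, a₄ := 4 * lam, a₆ := 0 }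

/-- A morphism `ψ : E → E'` of Weierstrass curves over `F` acts on `L`-points through `h`. -/
def ActsOnPoints {F : Type} [Field F] {W W' : WeierstrassCurve F}
    (ψ : weierstrassScheme W ⟶ weierstrassScheme W') {L : Type} [Field L] [Algebra F L]
    (h : (W.baseChange L).toAffine.Point → (W'.baseChange L).toAffine.Point) : Prop :=
  ∀ P, pointHom P ≫ ψ.left = pointHom (h P)

/-- A morphism of elliptic curves over `F` is an isogeny if it is surjective and a group
homomorphism on points over every extension field of `F`. -/
def IsIsogeny {F : Type} [Field F] {W W' : WeierstrassCurve F}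
    (ψ : weierstrassScheme W ⟶ weierstrassScheme W') : Prop :=
  Surjective ψ.left ∧ ∀ (L : Type) [Field L] [DecidableEq L] [Algebra F L],
    ∃ h : (W.baseChange L).toAffine.Point →+ (W'.baseChange L).toAffine.Point, ActsOnPoints ψ h

end TwoCycles

end

/-!
The curves `Y₁(2)` and `Y₀(2)` are described by the sum and the difference of the two points of the
cycle. Since `Φ₂(a, b, z₁)` is `1 + a + z₁² + z₁ z₂ + z₂²` modulo `f(z₁) = z₂` (`Φ₂_eq`), the
equations determine `a` and `b` in terms of `z₁` and `z₂` (`a₁_eq`, `b₁_eq`), and with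
`s = z₁ + z₂` and `t = z₁ - z₂` what remains is the plane curve `(t² - 2)² - 9 s² t² = 4 λ`
(`curve_eq`). As `λ` is neither `0` nor `1`, the functions `t` and `d = 3 s t - t² + 2` are
invertible on it, and with a square root `ρ` of `-2` the functions `d` and `e = -ρ d t` identify
`Y₁(2)` with the open subscheme `e ≠ 0` of the affine part of `E₁` (`isLocalization_ringY₁`). The
exchange of `z₁` and `z₂` fixes `s` and changes the sign of `t`, so that the invariant functions
are generated by `s`, `t²` and its inverse; the functions `u = -t² / 2` and `v = 3 ρ s t² / 4`
identify `Y₀(2)` with the open subscheme `u ≠ 0` of the affine part of `E₀`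
(`isLocalization_ringY₀`). The formulas for `a`, `b` and `z₁` are identities in these rings
(`a₁_mul`, `b₁_mul`, `six_mul_eFun_mul_z₁`).

The rest is the theory of smooth projective curves. A curve smooth over a field is locally étale
over the affine line, so that its local rings are valuation rings, and by the valuative criterion a
morphism from a nonempty open subscheme to a proper scheme extends (`exists_extension`). Hence
smooth projective curves with a common open subscheme are isomorphic (`exists_iso_extension`), and
the quotient map extends to a morphism `ψ : E₁ → E₀` (`exists_isogeny`), which corresponds to the
morphism between any other models. That a Weierstrass curve of nonzero discriminant is a smooth
projective curve follows from Eisenstein's criterion for the homogeneous equation and from the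
Jacobian criterion on the three standard charts (`isSmoothProjectiveCurve_weierstrassScheme`).

To see that `ψ` is an isogeny, its effect on points over a field is computed. It is given by the
formulas for `u` and `v` at points of `Y₁(2)`, in particular at the generic point of `E₁`; every
point over a field is a specialization of the generic point, and the value of `ψ` is found from any
triple of forms proportional to the formulas that does not vanish at the point
(`pointHom_comp_isogeny`). The resulting map on points is additive since it maps the three
intersection points with a line to three points on a line (`IsTwoIsogenous.map_add`).
-/

open CategoryTheory AlgebraicGeometry WeierstrassCurve.Affine

noncomputable section

namespace TwoCycles

/-! ### Extending rational maps from smooth curves -/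

section ValuationStalks

instance {F : Type*} [Field F] : IsPrincipalIdealRing (MvPolynomial (Fin 1) F) :=
  IsPrincipalIdealRing.of_surjective
    (MvPolynomial.uniqueAlgEquiv F (Fin 1)).symm.toRingEquiv.toRingHom
    (MvPolynomial.uniqueAlgEquiv F (Fin 1)).symm.surjective

/-- A local ring of a domain étale over the affine line is a valuation ring: its maximal ideal is
generated by the maximal ideal of the local ring below, which is principal. -/
lemma valuationRing_of_etale_line {F S : Type*} [Field F] [CommRing S] [IsDomain S]
    [Algebra (MvPolynomial (Fin 1) F) S] [Algebra.Etale (MvPolynomial (Fin 1) F) S]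
    (q : Ideal S) [q.IsPrime] : ValuationRing (Localization.AtPrime q) := by
  let A := MvPolynomial (Fin 1) F
  have : IsNoetherianRing S := Algebra.FiniteType.isNoetherianRing A S
  let p := q.under A
  have : q.LiesOver p := ⟨rfl⟩
  let := Localization.AtPrime.algebraOfLiesOver p q
  have : Algebra.FormallyUnramified A (Localization.AtPrime q) :=
    have := Algebra.FormallyUnramified.of_isLocalization (Rₘ := Localization.AtPrime q)
      q.primeCompl
    Algebra.FormallyUnramified.comp A S (Localization.AtPrime q)
  have h := ((Algebra.isUnramifiedAt_iff_map_eq A p q).mp this).2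
  have : IsNoetherianRing (Localization.AtPrime q) :=
    IsLocalization.isNoetherianRing q.primeCompl _ inferInstance
  have hp : (IsLocalRing.maximalIdeal (Localization.AtPrime q)).IsPrincipal := by
    rw [← h]; infer_instance
  exact ((tfae_of_isNoetherianRing_of_isLocalRing_of_isDomain
    (R := Localization.AtPrime q)).out 4 1).mp hp

/-- The local rings of an integral curve smooth over a field are valuation rings. -/
lemma valuationRing_stalk {F : Type} [Field F] {X : Scheme.{0}} [IsIntegral X]
    (f : X ⟶ Spec (.of F)) [SmoothOfRelativeDimension 1 f] (x : X) :
    ValuationRing (X.presheaf.stalk x) := by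
  obtain ⟨U, hU, V, hV, hxV, e, h⟩ :=
    SmoothOfRelativeDimension.exists_isStandardSmoothOfRelativeDimension (n := 1) (f := f) x
  -- A nonempty open subscheme of `Spec F` is everything, so that its functions are `F`.
  have hU' : U = ⊤ := by
    have : Subsingleton (Spec (.of F)) := inferInstanceAs (Subsingleton (PrimeSpectrum F))
    ext y
    simp only [TopologicalSpace.Opens.coe_top, Set.mem_univ, iff_true]
    rw [Subsingleton.elim y (f x)]
    exact e hxV
  subst hU'
  let φ : F →+* Γ(X, V) :=
    (f.appLE ⊤ V e).hom.comp (Scheme.ΓSpecIso (.of F)).inv.hom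
  have hφ : φ.IsStandardSmoothOfRelativeDimension 1 := by
    refine RingHom.isStandardSmoothOfRelativeDimension_respectsIso.2 _
      (Scheme.ΓSpecIso (.of F)).symm.commRingCatIsoToRingEquiv h
  obtain ⟨g, -, hg⟩ := hφ.exists_etale_mvPolynomial
  algebraize [g]
  have : Nonempty V := ⟨⟨x, hxV⟩⟩
  let y := hV.primeIdealOf ⟨x, hxV⟩
  have := valuationRing_of_etale_line (F := F) y.asIdeal
  have hloc := hV.isLocalization_stalk ⟨x, hxV⟩
  let := TopCat.Presheaf.algebra_section_stalk X.presheaf ⟨x, hxV⟩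
  let ε := IsLocalization.algEquiv y.asIdeal.primeCompl (Localization.AtPrime y.asIdeal)
    (X.presheaf.stalk x)
  exact { Function.Surjective.preValuationRing ε.toMulEquiv.toMulHom ε.surjective with }

end ValuationStalks

section Extension

variable {X Y S : Scheme.{0}}

lemma isDominant_of_isOpenImmersion [IsIntegral X] {U : Scheme.{0}} [Nonempty U] (j : U ⟶ X)
    [IsOpenImmersion j] : IsDominant j :=
  ⟨j.opensRange.2.dense ⟨_, Set.mem_range_self (Classical.arbitrary U)⟩⟩

/-- The restrictions of a partial map to the spectra of a local ring and of the function field are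
compatible. -/
lemma fromSpecStalkOfMem_stalkSpecializes [IsIntegral X] (P : X.PartialMap Y) {x : X}
    (hx : x ∈ P.domain) :
    Spec.map (X.presheaf.stalkSpecializes (genericPoint_specializes x)) ≫
      P.fromSpecStalkOfMem hx = P.fromFunctionField := by
  simp only [Scheme.PartialMap.fromFunctionField, Scheme.PartialMap.fromSpecStalkOfMem,
    ← Category.assoc]
  congr 1
  rw [← cancel_mono P.domain.ι]
  simp

/-- The valuative criterion at a single valuation ring. -/
lemma exists_lift_of_isProper {f : Y ⟶ S} [IsProper f] (R L : CommRingCat.{0}) [IsDomain R]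
    [ValuationRing R] (hL : IsField L) (r : R ⟶ L) (hr : @IsFractionRing R _ L _ r.hom.toAlgebra)
    (i₁ : Spec L ⟶ Y) (i₂ : Spec R ⟶ S) (h : i₁ ≫ f = Spec.map r ≫ i₂) :
    ∃ φ : Spec R ⟶ Y, Spec.map r ≫ φ = i₁ ∧ φ ≫ f = i₂ := by
  let := r.hom.toAlgebra
  let sq : ValuativeCommSq f :=
    { R := R, K := L, field := hL.toField, i₁ := i₁, i₂ := i₂, commSq := ⟨h⟩ }
  have hv : ValuativeCriterion f := by
    have h : IsProper f := inferInstance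
    rw [IsProper.eq_valuativeCriterion] at h
    exact h.1.1.1
  have hl := hv.existence sq
  exact ⟨sq.commSq.lift, sq.commSq.fac_left, sq.commSq.fac_right⟩

/-- A morphism from the generic point to a proper scheme extends to the spectrum of every local ring
that is a valuation ring. -/
lemma exists_stalk_lift [IsIntegral X] (sX : X ⟶ S) (sY : Y ⟶ S) [IsProper sY] {x : X}
    [ValuationRing (X.presheaf.stalk x)] (f : Spec X.functionField ⟶ Y)
    (hf : f ≫ sY = X.fromSpecStalk _ ≫ sX) :
    ∃ φ : Spec (X.presheaf.stalk x) ⟶ Y, φ ≫ sY = X.fromSpecStalk x ≫ sX ∧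
      Spec.map (X.presheaf.stalkSpecializes (genericPoint_specializes x)) ≫ φ = f := by
  obtain ⟨φ, h₁, h₂⟩ := exists_lift_of_isProper (f := sY) (X.presheaf.stalk x) X.functionField
    (Field.toIsField _) (X.presheaf.stalkSpecializes (genericPoint_specializes x))
    (inferInstanceAs (IsFractionRing (X.presheaf.stalk x) X.functionField))
    f (X.fromSpecStalk x ≫ sX) (by
      rw [hf, ← Scheme.SpecMap_stalkSpecializes_fromSpecStalk
            (genericPoint_specializes x), Category.assoc])
  exact ⟨φ, h₂, h₁⟩

/-- A rational map from an integral scheme whose local rings are valuation rings to a proper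
scheme is defined everywhere. -/
lemma exists_extension_of_valuationRing [IsIntegral X] (sX : X ⟶ S) (sY : Y ⟶ S) [IsProper sY]
    [Y.IsSeparated] (hX : ∀ x : X, ValuationRing (X.presheaf.stalk x)) (P : X.PartialMap Y)
    (hP : P.hom ≫ sY = P.domain.ι ≫ sX) :
    ∃ g : X ⟶ Y, P.domain.ι ≫ g = P.hom := by
  have hP' : P.fromFunctionField ≫ sY = X.fromSpecStalk _ ≫ sX := by
    simp [Scheme.PartialMap.fromFunctionField, Scheme.PartialMap.fromSpecStalkOfMem, hP]
  have htop : P.toRationalMap.domain = ⊤ := by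
    refine top_le_iff.mp fun x _ ↦ ?_
    have := hX x
    obtain ⟨φ, hφ, hφ'⟩ := exists_stalk_lift sX sY (x := x) P.fromFunctionField hP'
    refine Scheme.RationalMap.mem_domain.mpr
      ⟨.ofFromSpecStalk sX sY φ hφ, Scheme.PartialMap.mem_domain_ofFromSpecStalk sX sY φ hφ, ?_⟩
    refine Scheme.RationalMap.eq_of_fromFunctionField_eq _ _ ?_
    change Scheme.PartialMap.fromFunctionField _ = P.fromFunctionField
    rw [← fromSpecStalkOfMem_stalkSpecializes _
      (Scheme.PartialMap.mem_domain_ofFromSpecStalk sX sY φ hφ),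
      Scheme.PartialMap.fromSpecStalkOfMem_ofFromSpecStalk, hφ']
  -- The rational map is represented by a partial map on all of `X`, whose restriction is `P`.
  have hr := P.toPartialMap_toRationalMap_restrict
  have hQ : P.toRationalMap.toPartialMap.domain = ⊤ := htop
  generalize_proofs h₁ h₂ at hr
  generalize P.toRationalMap.toPartialMap = Q at *
  obtain ⟨U, hU, q⟩ := Q
  obtain rfl : U = ⊤ := hQ
  refine ⟨X.topIso.inv ≫ q, ?_⟩
  rw [← hr, Scheme.PartialMap.restrict_hom, ← Category.assoc]
  congr 1
  rw [← cancel_mono (⊤ : X.Opens).ι]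
  simp

/-- A morphism from a nonempty open subscheme of a curve smooth over `F` to a proper `F`-scheme
extends to the curve. -/
theorem exists_extension {F : Type} [Field F] [IsIntegral X] (sX : X ⟶ Spec (.of F))
    [SmoothOfRelativeDimension 1 sX] (sY : Y ⟶ Spec (.of F)) [IsProper sY]
    {U : Scheme.{0}} [Nonempty U] (j : U ⟶ X) [IsOpenImmersion j] (f : U ⟶ Y)
    (hf : f ≫ sY = j ≫ sX) : ∃ g : X ⟶ Y, j ≫ g = f ∧ g ≫ sY = sX := by
  have : Y.IsSeparated := by
    have h : IsSeparated (sY ≫ Limits.terminal.from _) := inferInstance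
    exact ⟨by convert h; exact Subsingleton.elim _ _⟩
  let P : X.PartialMap Y :=
    { domain := j.opensRange
      dense_domain := j.opensRange.2.dense
        ⟨_, Set.mem_range_self (Classical.arbitrary U)⟩
      hom := j.isoOpensRange.inv ≫ f }
  have hj : j.isoOpensRange.inv ≫ j = j.opensRange.ι := by simp
  obtain ⟨g, hg⟩ := exists_extension_of_valuationRing sX sY (valuationRing_stalk sX) P (by
    simp only [P, Category.assoc, hf]
    rw [← Category.assoc, hj])
  have hjg : j ≫ g = f := by
    simp only [P] at hg
    rw [← hj, Category.assoc, cancel_epi] at hg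
    exact hg
  refine ⟨g, hjg, ?_⟩
  have : IsDominant j := ⟨P.dense_domain⟩
  exact ext_of_isDominant_of_isSeparated (Limits.terminal.from _) (Limits.terminal.hom_ext _ _) j
    (by rw [← Category.assoc, hjg, hf])

/-- Morphisms from an integral scheme to a separated one agree if they agree on a nonempty open
subscheme. -/
lemma hom_ext_of_isOpenImmersion [IsIntegral X] {sY : Y ⟶ S} [IsSeparated sY] {U : Scheme.{0}}
    [Nonempty U] (j : U ⟶ X) [IsOpenImmersion j] {g g' : X ⟶ Y} (h : g ≫ sY = g' ≫ sY)
    (hj : j ≫ g = j ≫ g') : g = g' := by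
  have := isDominant_of_isOpenImmersion j
  exact ext_of_isDominant_of_isSeparated sY h j hj

/-- Smooth proper curves over `F` with a common nonempty open subscheme are isomorphic. -/
theorem exists_iso_extension {F : Type} [Field F] [IsIntegral X] [IsIntegral Y]
    (sX : X ⟶ Spec (.of F)) (sY : Y ⟶ Spec (.of F)) [SmoothOfRelativeDimension 1 sX]
    [SmoothOfRelativeDimension 1 sY] [IsProper sX] [IsProper sY] {U : Scheme.{0}} [Nonempty U]
    (j : U ⟶ X) [IsOpenImmersion j] (i : U ⟶ Y) [IsOpenImmersion i] (h : j ≫ sX = i ≫ sY) :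
    ∃ φ : X ≅ Y, j ≫ φ.hom = i ∧ φ.hom ≫ sY = sX := by
  obtain ⟨g, hg, hg'⟩ := exists_extension sX sY j i h.symm
  obtain ⟨k, hk, hk'⟩ := exists_extension sY sX i j h
  refine ⟨⟨g, k, ?_, ?_⟩, hg, hg'⟩
  · exact hom_ext_of_isOpenImmersion (sY := sX) j (by simp [hk', hg']) (by
      rw [← Category.assoc, hg, hk, Category.comp_id])
  · exact hom_ext_of_isOpenImmersion (sY := sY) i (by simp [hk', hg']) (by
      rw [← Category.assoc, hk, hg, Category.comp_id])

end Extension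

section Proper

variable {F : Type} [Field F]

/-- `Proj` of a finitely generated graded algebra with constants `F` in degree zero is proper. -/
lemma isProper_projOver {A : Type} [CommRing A] [Algebra F A] (𝒜 : ℕ → Submodule F A)
    [GradedAlgebra 𝒜] [Algebra.FiniteType F A]
    (h₀ : Function.Surjective (algebraMap F (𝒜 0))) : IsProper (projOver 𝒜).hom := by
  have : Algebra.FiniteType (𝒜 0) A :=
    have : @IsScalarTower F (𝒜 0) A Algebra.toSMul Algebra.toSMul Algebra.toSMul :=
      .of_algebraMap_eq fun _ ↦ rfl
    .of_restrictScalars_finiteType F _ _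
  have : IsClosedImmersion (Spec.map (CommRingCat.ofHom (algebraMap F (𝒜 0)))) :=
    IsClosedImmersion.spec_of_surjective _ h₀
  exact inferInstanceAs (IsProper (Proj.toSpecZero 𝒜 ≫ _))

instance isProper_projSpace (n : ℕ) : IsProper (projSpace F n).hom := by
  let _ : GradedAlgebra (MvPolynomial.homogeneousSubmodule (Fin (n + 1)) F) :=
    MvPolynomial.gradedAlgebra
  refine isProper_projOver (MvPolynomial.homogeneousSubmodule (Fin (n + 1)) F) ?_
  rintro ⟨p, hp⟩
  refine ⟨p.coeff 0, Subtype.ext ?_⟩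
  exact (MvPolynomial.totalDegree_eq_zero_iff_eq_C.mp
    (Nat.le_zero.mp (MvPolynomial.IsHomogeneous.totalDegree_le hp))).symm

lemma IsSmoothProjectiveCurve.isProper {X : SchOver F} (hX : IsSmoothProjectiveCurve X) :
    IsProper X.hom := by
  obtain ⟨n, i, hi⟩ := hX.projective
  rw [← Over.w i]
  infer_instance

instance (W : WeierstrassCurve F) : IsProper (weierstrassScheme W).hom := by
  refine isProper_projOver (grading W) ?_
  rintro ⟨_, p, hp, rfl⟩
  refine ⟨p.coeff 0, Subtype.ext ?_⟩
  have h := MvPolynomial.totalDegree_eq_zero_iff_eq_C.mp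
    (Nat.le_zero.mp (MvPolynomial.IsHomogeneous.totalDegree_le hp))
  exact congrArg (Ideal.Quotient.mk (Ideal.span {W.toProjective.polynomial})) h.symm

end Proper

/-! ### Ring-valued points of the projective curve -/

section Proj

/-- On the basic open subset of a global section `x`, the morphism to the spectrum of the global
sections factors through the localization away from `x`. -/
lemma basicOpen_toSpecΓ (X : Scheme.{0}) (x : Γ(X, ⊤)) :
    (X.isoOfEq (X.toSpecΓ_preimage_basicOpen x)).inv ≫
      X.toSpecΓ ∣_ (PrimeSpectrum.basicOpen x) ≫ (basicOpenIsoSpecAway x).hom ≫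
        Spec.map (CommRingCat.ofHom (algebraMap Γ(X, ⊤) (Localization.Away x))) =
      (X.basicOpen x).ι ≫ X.toSpecΓ := by
  have h : (basicOpenIsoSpecAway x).hom ≫
      Spec.map (CommRingCat.ofHom (algebraMap Γ(X, ⊤) (Localization.Away x))) =
        Scheme.Opens.ι (X := Spec Γ(X, ⊤)) (PrimeSpectrum.basicOpen x) :=
    basicOpenIsoSpecAway_hom_SpecMap (R := Γ(X, ⊤)) x
  refine (congrArg (fun q ↦ (X.isoOfEq (X.toSpecΓ_preimage_basicOpen x)).inv ≫
      X.toSpecΓ ∣_ (PrimeSpectrum.basicOpen x) ≫ q) h).trans ?_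
  refine (congrArg (fun q ↦ (X.isoOfEq (X.toSpecΓ_preimage_basicOpen x)).inv ≫ q)
    (morphismRestrict_ι X.toSpecΓ (PrimeSpectrum.basicOpen x))).trans ?_
  exact Scheme.isoOfEq_inv_ι_assoc ..

/-- The morphism to `Proj` given by global sections one of which is invertible factors through the
corresponding affine chart. -/
lemma fromOfGlobalSections_eq_of_isUnit {σ A : Type} [CommRing A] [SetLike σ A]
    [AddSubgroupClass σ A] (𝒜 : ℕ → σ) [GradedRing 𝒜] {X : Scheme.{0}} (f : A →+* Γ(X, ⊤))
    (hf : (HomogeneousIdeal.irrelevant 𝒜).toIdeal.map f = ⊤) {r : A} {n : ℕ} (hn : 0 < n)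
    (hr : r ∈ 𝒜 n) (hu : IsUnit (f r)) :
    Proj.fromOfGlobalSections 𝒜 f hf = X.toSpecΓ ≫
      Spec.map (CommRingCat.ofHom ((IsLocalization.Away.lift (S := Localization.Away r) r
        (g := f) hu).comp (algebraMap (HomogeneousLocalization.Away 𝒜 r) _))) ≫
      Proj.awayι 𝒜 r hr hn := by
  have htop : X.basicOpen (f r) = ⊤ := Scheme.basicOpen_of_isUnit _ hu
  have hepi : IsIso (X.basicOpen (f r)).ι := by
    rw [htop]; exact inferInstanceAs (IsIso X.topIso.hom)
  rw [← cancel_epi (X.basicOpen (f r)).ι]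
  have h' := congrArg (· ≫ (Proj.basicOpen 𝒜 r).ι)
    (Proj.fromOfGlobalSections_resLE 𝒜 f hf hn hr)
  simp only [Scheme.Hom.resLE_comp_ι] at h'
  rw [h', Proj.toBasicOpenOfGlobalSections]
  simp only [Category.assoc, Proj.basicOpenIsoSpec_inv_ι]
  have hmap : IsLocalization.map (M := .powers r) (T := .powers (f r)) (Localization.Away (f r)) f
      (by
        rw [← Submonoid.map_le_iff_le_comap, Submonoid.map_powers]) =
      (algebraMap _ _).comp
        (IsLocalization.Away.lift (S := Localization.Away r) r (g := f) hu) := by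
    apply IsLocalization.ringHom_ext (Submonoid.powers r)
    ext y
    simp
  rw [hmap, RingHom.comp_assoc]
  generalize (IsLocalization.Away.lift (S := Localization.Away r) r (g := f) hu).comp
    (algebraMap (HomogeneousLocalization.Away 𝒜 r) _) = φ
  have h := basicOpen_toSpecΓ X (f r)
  rw [CommRingCat.ofHom_comp, Spec.map_comp, Category.assoc]
  have h'' := congrArg (· ≫ Spec.map (CommRingCat.ofHom φ) ≫ Proj.awayι 𝒜 r hr hn) h
  simp only [Category.assoc] at h''
  exact h''

/-- The morphism from an affine scheme to `Proj` given by functions one of which is a unit: the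
factorization through a chart, in terms of rings. -/
lemma fromOfGlobalSections_Spec {σ A L : Type} [CommRing A] [CommRing L] [SetLike σ A]
    [AddSubgroupClass σ A] (𝒜 : ℕ → σ) [GradedRing 𝒜] (f : A →+* L)
    (hf : (HomogeneousIdeal.irrelevant 𝒜).toIdeal.map
      ((Scheme.ΓSpecIso (.of L)).inv.hom.comp f) = ⊤) {r : A} {n : ℕ} (hn : 0 < n)
    (hr : r ∈ 𝒜 n) (hu : IsUnit (f r)) :
    Proj.fromOfGlobalSections 𝒜 ((Scheme.ΓSpecIso (.of L)).inv.hom.comp f) hf =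
      Spec.map (CommRingCat.ofHom ((IsLocalization.Away.lift (S := Localization.Away r) r
        (g := f) hu).comp (algebraMap (HomogeneousLocalization.Away 𝒜 r) _))) ≫
      Proj.awayι 𝒜 r hr hn := by
  have hu' := hu.map (Scheme.ΓSpecIso (.of L)).inv.hom
  rw [fromOfGlobalSections_eq_of_isUnit 𝒜 _ hf hn hr hu']
  have h : (IsLocalization.Away.lift (S := Localization.Away r) r
      (g := (Scheme.ΓSpecIso (.of L)).inv.hom.comp f) hu') =
      (Scheme.ΓSpecIso (.of L)).inv.hom.comp
        (IsLocalization.Away.lift (S := Localization.Away r) r (g := f) hu) := by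
    refine IsLocalization.ringHom_ext (Submonoid.powers r) (RingHom.ext fun y ↦ ?_)
    simp
  rw [h, RingHom.comp_assoc]
  generalize (IsLocalization.Away.lift (S := Localization.Away r) r (g := f) hu).comp
    (algebraMap (HomogeneousLocalization.Away 𝒜 r) _) = φ
  have h' : (Spec (.of L)).toSpecΓ ≫ Spec.map (Scheme.ΓSpecIso (.of L)).inv = 𝟙 _ := by simp
  rw [CommRingCat.ofHom_comp, Spec.map_comp, CommRingCat.ofHom_hom, Category.assoc,
    ← Category.assoc, h', Category.id_comp]

end Proj

section Charts

variable {F : Type} [Field F] (W : WeierstrassCurve F)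

/-- The homogeneous coordinates `X, Y, Z`, as elements of the homogeneous coordinate ring. -/
def coord (i : Fin 3) : HomogCoordRing W :=
  Ideal.Quotient.mk (Ideal.span {W.toProjective.polynomial}) (MvPolynomial.X i)

lemma coord_mem (i : Fin 3) : coord W i ∈ grading W 1 :=
  mk_mem_grading W (MvPolynomial.isHomogeneous_X F i)

/-- The ring of functions on the chart of the projective curve where the `i`-th homogeneous
coordinate is invertible. -/
abbrev ChartRing (i : Fin 3) : Type := HomogeneousLocalization.Away (grading W) (coord W i)

/-- The inclusion of the chart where the `i`-th homogeneous coordinate is invertible. -/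
def chartι (i : Fin 3) : Spec (.of (ChartRing W i)) ⟶ (weierstrassScheme W).left :=
  Proj.awayι (grading W) (coord W i) (coord_mem W i) one_pos

instance (i : Fin 3) : IsOpenImmersion (chartι W i) :=
  inferInstanceAs (IsOpenImmersion (Proj.awayι _ _ _ _))

/-- The function `Xₖ / Xᵢ` on the `i`-th chart. -/
def chartCoord (i k : Fin 3) : ChartRing W i :=
  HomogeneousLocalization.Away.mk (grading W) (coord_mem W i) 1 (coord W k)
    (by simpa using coord_mem W k)

/-- The structure map of the `i`-th chart over the base field. -/
def chartConst (i : Fin 3) : F →+* ChartRing W i :=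
  (HomogeneousLocalization.fromZeroRingHom (grading W) _).comp (algebraMap F (grading W 0))

lemma chartι_comp (i : Fin 3) : chartι W i ≫ (weierstrassScheme W).hom =
    Spec.map (CommRingCat.ofHom (chartConst W i)) := by
  change Proj.awayι _ _ _ _ ≫ Proj.toSpecZero _ ≫ _ = _
  rw [Proj.awayι_toSpecZero_assoc, ← Spec.map_comp]
  rfl

variable {W}

lemma val_chartConst (i : Fin 3) (c : F) :
    (chartConst W i c).val = algebraMap _ _ (algebraMap F (HomogCoordRing W) c) :=
  Localization.mk_one_eq_algebraMap _

/-- Clearing denominators: `Xᵢⁿ · (x / Xᵢⁿ) = x`. -/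
lemma algebraMap_mul_val_mk (i : Fin 3) (n : ℕ) (x : HomogCoordRing W)
    (hx : x ∈ grading W (n • 1)) :
    algebraMap _ (Localization.Away (coord W i)) (coord W i) ^ n *
      (HomogeneousLocalization.Away.mk (grading W) (coord_mem W i) n x hx).val =
      algebraMap _ _ x := by
  rw [HomogeneousLocalization.Away.val_mk, ← map_pow, ← Localization.mk_one_eq_algebraMap,
    ← Localization.mk_one_eq_algebraMap, Localization.mk_mul, Localization.mk_eq_mk_iff,
    Localization.r_iff_exists]
  exact ⟨1, by simp⟩

lemma algebraMap_mul_val_chartCoord (i k : Fin 3) :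
    algebraMap _ (Localization.Away (coord W i)) (coord W i) * (chartCoord W i k).val =
      algebraMap _ _ (coord W k) := by
  have h := algebraMap_mul_val_mk i 1 (coord W k) (by simpa using coord_mem W k)
  rw [pow_one] at h
  exact h

/-- Homogeneous polynomials scale by the power of their degree. -/
lemma eval₂_mul_of_isHomogeneous {R S σ : Type*} [CommSemiring R] [CommSemiring S] {n : ℕ}
    {p : MvPolynomial σ R} (hp : p.IsHomogeneous n) (f : R →+* S) (s : S) (g : σ → S) :
    MvPolynomial.eval₂ f (fun k ↦ s * g k) p = s ^ n * MvPolynomial.eval₂ f g p := by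
  rw [MvPolynomial.eval₂_eq, MvPolynomial.eval₂_eq, Finset.mul_sum]
  refine Finset.sum_congr rfl fun d hd ↦ ?_
  rw [← hp (MvPolynomial.mem_support_iff.mp hd)]
  simp only [mul_pow, Finset.prod_mul_distrib, Finset.prod_pow_eq_pow_sum]
  simp [Finsupp.weight_apply, Finsupp.sum]
  ring

/-- Clearing denominators: `Xᵢⁿ · p(X₀ / Xᵢ, X₁ / Xᵢ, X₂ / Xᵢ) = p(X₀, X₁, X₂)` for `p`
homogeneous of degree `n`. -/
lemma algebraMap_mul_val_eval (i : Fin 3) {n : ℕ} {p : MvPolynomial (Fin 3) F}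
    (hp : p.IsHomogeneous n) :
    algebraMap _ (Localization.Away (coord W i)) (coord W i) ^ n *
      (MvPolynomial.eval₂ (chartConst W i) (chartCoord W i) p).val =
      algebraMap _ _ (Ideal.Quotient.mk (Ideal.span {W.toProjective.polynomial}) p) := by
  rw [← HomogeneousLocalization.algebraMap_apply, MvPolynomial.hom_eval₂,
    ← eval₂_mul_of_isHomogeneous hp]
  simp only [HomogeneousLocalization.algebraMap_apply,
    algebraMap_mul_val_chartCoord]
  have h : (algebraMap (ChartRing W i) (Localization.Away (coord W i))).comp (chartConst W i) =
      ((algebraMap (HomogCoordRing W) (Localization.Away (coord W i))).comp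
        (Ideal.Quotient.mk _)).comp MvPolynomial.C := RingHom.ext (val_chartConst i)
  rw [h]
  exact (MvPolynomial.eval₂_comp_left
    ((algebraMap (HomogCoordRing W) (Localization.Away (coord W i))).comp (Ideal.Quotient.mk _))
    MvPolynomial.C MvPolynomial.X p).symm.trans (by rw [MvPolynomial.eval₂_eta]; rfl)

lemma isUnit_algebraMap_coord_pow (i : Fin 3) (n : ℕ) :
    IsUnit (algebraMap _ (Localization.Away (coord W i)) (coord W i) ^ n) :=
  (IsLocalization.Away.algebraMap_isUnit (coord W i)).pow n

lemma eval_chartCoord_polynomial (i : Fin 3) :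
    MvPolynomial.eval₂ (chartConst W i) (chartCoord W i) W.toProjective.polynomial = 0 := by
  refine HomogeneousLocalization.val_injective _ ((isUnit_algebraMap_coord_pow i 3).mul_left_cancel
    ((algebraMap_mul_val_eval i (polynomial_isHomogeneous W)).trans ?_))
  rw [Ideal.Quotient.eq_zero_iff_mem.mpr (Ideal.mem_span_singleton_self _)]
  simp

/-- Functions on a chart are polynomials in the coordinate functions. -/
lemma exists_eval_chartCoord (i : Fin 3) (x : ChartRing W i) :
    ∃ p, MvPolynomial.eval₂ (chartConst W i) (chartCoord W i) p = x := by
  obtain ⟨n, _, ⟨p, hp, rfl⟩, rfl⟩ := HomogeneousLocalization.Away.mk_surjective (grading W)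
    (coord_mem W i) x
  have hp' : p.IsHomogeneous n := by simpa using hp
  exact ⟨p, HomogeneousLocalization.val_injective _
    ((isUnit_algebraMap_coord_pow i n).mul_left_cancel
      ((algebraMap_mul_val_eval i hp').trans (algebraMap_mul_val_mk i n _ _).symm))⟩

lemma chart_hom_ext {A : Type} [CommRing A] {i : Fin 3} {f g : ChartRing W i →+* A}
    (hc : f.comp (chartConst W i) = g.comp (chartConst W i))
    (hx : ∀ k, f (chartCoord W i k) = g (chartCoord W i k)) : f = g := by
  ext x
  obtain ⟨p, rfl⟩ := exists_eval_chartCoord i x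
  simp only [MvPolynomial.hom_eval₂, hc, hx]

lemma chartCoord_self (i : Fin 3) : chartCoord W i i = 1 := by
  refine HomogeneousLocalization.val_injective _
    ((isUnit_algebraMap_coord_pow i 1).mul_left_cancel ?_)
  rw [pow_one, algebraMap_mul_val_chartCoord, HomogeneousLocalization.val_one, mul_one]

variable {A : Type} [CommRing A] [Algebra F A]

/-- The evaluation of the homogeneous coordinate ring at an `A`-valued vector on the cone over the
curve. -/
def coneHom (v : Fin 3 → A) (hv : (W.baseChange A).toProjective.Equation v) :
    HomogCoordRing W →ₐ[F] A :=
  Ideal.Quotient.liftₐ _ (MvPolynomial.aeval v) (by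
    intro p hp
    obtain ⟨q, rfl⟩ := Ideal.mem_span_singleton'.mp hp
    have h : MvPolynomial.aeval v W.toProjective.polynomial = 0 := by
      have h := hv
      rw [WeierstrassCurve.Projective.Equation] at h
      erw [WeierstrassCurve.Projective.map_polynomial] at h
      rwa [MvPolynomial.eval_map] at h
    simp [h])

@[simp] lemma coneHom_coord (v : Fin 3 → A) (hv : (W.baseChange A).toProjective.Equation v)
    (i : Fin 3) : coneHom v hv (coord W i) = v i :=
  MvPolynomial.aeval_X v i

/-- The homomorphism from the functions on the `i`-th chart to `A` given by an `A`-valued vector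
on the cone whose `i`-th coordinate is invertible. -/
def chartHom (v : Fin 3 → A) (hv : (W.baseChange A).toProjective.Equation v) (i : Fin 3)
    (hi : IsUnit (v i)) : ChartRing W i →+* A :=
  (IsLocalization.Away.lift (S := Localization.Away (coord W i)) (coord W i)
    (g := (coneHom v hv).toRingHom) (by simpa using hi)).comp (algebraMap _ _)

lemma chartHom_chartCoord (v : Fin 3 → A) (hv : (W.baseChange A).toProjective.Equation v)
    (i : Fin 3) (hi : IsUnit (v i)) (k : Fin 3) :
    chartHom v hv i hi (chartCoord W i k) * v i = v k := by
  have h := congrArg (IsLocalization.Away.lift (S := Localization.Away (coord W i)) (coord W i)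
    (g := (coneHom v hv).toRingHom) (by simpa using hi)) (algebraMap_mul_val_chartCoord i k)
  rw [map_mul, IsLocalization.Away.lift_eq, IsLocalization.Away.lift_eq, mul_comm] at h
  refine Eq.trans ?_ (h.trans (coneHom_coord v hv k))
  exact congrArg _ (coneHom_coord v hv i).symm

lemma chartHom_comp_chartConst (v : Fin 3 → A) (hv : (W.baseChange A).toProjective.Equation v)
    (i : Fin 3) (hi : IsUnit (v i)) :
    (chartHom v hv i hi).comp (chartConst W i) = algebraMap F A := by
  ext c
  change IsLocalization.Away.lift (S := Localization.Away (coord W i)) (coord W i)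
    (g := (coneHom v hv).toRingHom) (by simpa using hi) (chartConst W i c).val = _
  rw [val_chartConst, IsLocalization.Away.lift_eq]
  exact (coneHom v hv).commutes c

/-- A homomorphism from the functions on the `i`-th chart is `chartHom` of a vector as soon as it
has the right values at the coordinate functions. -/
lemma eq_chartHom {i : Fin 3} {f : ChartRing W i →+* A} (v : Fin 3 → A)
    (hv : (W.baseChange A).toProjective.Equation v) (hi : IsUnit (v i))
    (hc : f.comp (chartConst W i) = algebraMap F A)
    (hx : ∀ k, f (chartCoord W i k) * v i = v k) : f = chartHom v hv i hi :=
  chart_hom_ext (by rw [hc, chartHom_comp_chartConst]) fun k ↦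
    hi.mul_left_injective (by
      change _ * _ = _ * _
      rw [hx, chartHom_chartCoord])

/-- The `A`-valued point `[v₀ : v₁ : v₂]` of the projective curve. -/
def ringPoint (v : Fin 3 → A) (hv : (W.baseChange A).toProjective.Equation v) (i : Fin 3)
    (hi : IsUnit (v i)) : Spec (.of A) ⟶ (weierstrassScheme W).left :=
  Spec.map (CommRingCat.ofHom (chartHom v hv i hi)) ≫ chartι W i

lemma ringPoint_comp_hom (v : Fin 3 → A) (hv : (W.baseChange A).toProjective.Equation v)
    (i : Fin 3) (hi : IsUnit (v i)) : ringPoint v hv i hi ≫ (weierstrassScheme W).hom =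
      Spec.map (CommRingCat.ofHom (algebraMap F A)) := by
  rw [ringPoint, Category.assoc, chartι_comp, ← Spec.map_comp, ← CommRingCat.ofHom_comp,
    chartHom_comp_chartConst]

lemma equation_comp {B : Type} [CommRing B] [Algebra F B] (f : A →ₐ[F] B) {v : Fin 3 → A}
    (hv : (W.baseChange A).toProjective.Equation v) :
    (W.baseChange B).toProjective.Equation (f ∘ v) := by
  have h : W.baseChange B = (W.baseChange A).map f.toRingHom := by
    rw [WeierstrassCurve.baseChange, WeierstrassCurve.baseChange, WeierstrassCurve.map_map]
    congr 1
    exact f.comp_algebraMap.symm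
  rw [h]
  exact hv.map f.toRingHom

lemma SpecMap_ringPoint {B : Type} [CommRing B] [Algebra F B] (f : A →ₐ[F] B) (v : Fin 3 → A)
    (hv : (W.baseChange A).toProjective.Equation v) (i : Fin 3) (hi : IsUnit (v i)) :
    Spec.map (CommRingCat.ofHom f.toRingHom) ≫ ringPoint v hv i hi =
      ringPoint (f ∘ v) (equation_comp f hv) i (hi.map f) := by
  rw [ringPoint, ← Category.assoc, ← Spec.map_comp, ← CommRingCat.ofHom_comp, ringPoint]
  congr 3
  refine eq_chartHom _ _ _ ?_ fun k ↦ ?_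
  · rw [RingHom.comp_assoc, chartHom_comp_chartConst]
    exact f.comp_algebraMap
  · simp only [RingHom.comp_apply, Function.comp_apply, ← chartHom_chartCoord v hv i hi k]
    exact (map_mul f _ _).symm

/-- The point given by a vector does not depend on the chart used to define it. -/
lemma ringPoint_index (v : Fin 3 → A) (hv : (W.baseChange A).toProjective.Equation v)
    (i j : Fin 3) (hi : IsUnit (v i)) (hj : IsUnit (v j)) :
    ringPoint v hv i hi = ringPoint v hv j hj := by
  have hij : IsUnit ((coneHom v hv).toRingHom (coord W i * coord W j)) := by
    simpa using ⟨hi, hj⟩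
  obtain ⟨g, hg⟩ : ∃ g : HomogeneousLocalization.Away (grading W) (coord W i * coord W j) →+* A,
      g = (IsLocalization.Away.lift (S := Localization.Away (coord W i * coord W j))
        (coord W i * coord W j) (g := (coneHom v hv).toRingHom) hij).comp (algebraMap _ _) :=
    ⟨_, rfl⟩
  -- The equation `x = Xᵢ Xⱼ` is carried along to use the statement for both orders of `i` and `j`.
  have key (i j : Fin 3) (x : HomogCoordRing W) (hi : IsUnit (v i))
      (hx : x = coord W i * coord W j) (g : HomogeneousLocalization.Away (grading W) x →+* A)
      (hx' : IsUnit ((coneHom v hv).toRingHom x))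
      (hg : g = (IsLocalization.Away.lift (S := Localization.Away x)
        x (g := (coneHom v hv).toRingHom) hx').comp (algebraMap _ _)) :
      g.comp (HomogeneousLocalization.awayMap (grading W) (coord_mem W j) hx) =
        chartHom v hv i hi := by
    subst hg
    have h : (IsLocalization.Away.lift (S := Localization.Away x)
        x (g := (coneHom v hv).toRingHom) hx').comp
        (Localization.awayLift (algebraMap (HomogCoordRing W) (Localization.Away x)) (coord W i)
          (isUnit_of_dvd_unit (hx ▸ map_dvd _ (Dvd.intro _ rfl))
            (IsLocalization.Away.algebraMap_isUnit x))) =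
        IsLocalization.Away.lift (S := Localization.Away (coord W i)) (coord W i)
          (g := (coneHom v hv).toRingHom) (by simpa using hi) := by
      apply IsLocalization.ringHom_ext (Submonoid.powers (coord W i))
      ext y
      · simp [Localization.awayLift]
      · simp [Localization.awayLift]
    ext y
    rw [chartHom, ← h]
    simp [HomogeneousLocalization.val_awayMap]
  rw [ringPoint, ringPoint, ← key i j _ hi rfl g hij hg,
    ← key j i _ hj (mul_comm _ _) g hij hg, CommRingCat.ofHom_comp, CommRingCat.ofHom_comp,
    Spec.map_comp, Spec.map_comp, Category.assoc, Category.assoc]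
  refine congrArg (Spec.map (CommRingCat.ofHom g) ≫ ·) ?_
  exact (Proj.SpecMap_awayMap_awayι (grading W) (coord_mem W i) one_pos (coord_mem W j) rfl).trans
    (Proj.SpecMap_awayMap_awayι (grading W) (coord_mem W j) one_pos (coord_mem W i)
      (mul_comm _ _)).symm

/-- Proportional vectors define the same point. -/
lemma ringPoint_eq_of_mul_eq_mul {v w : Fin 3 → A}
    (hv : (W.baseChange A).toProjective.Equation v)
    (hw : (W.baseChange A).toProjective.Equation w) {i j : Fin 3} (hi : IsUnit (v i))
    (hj : IsUnit (w j)) (h : ∀ k l, v k * w l = v l * w k) :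
    ringPoint v hv i hi = ringPoint w hw j hj := by
  have hi' : IsUnit (w i) :=
    isUnit_of_mul_isUnit_right (h i j ▸ hi.mul hj : IsUnit (v j * w i))
  rw [ringPoint_index w hw j i hj hi', ringPoint, ringPoint]
  congr 3
  refine eq_chartHom _ _ _ (chartHom_comp_chartConst ..) fun k ↦ hi.mul_left_cancel ?_
  rw [← mul_assoc, mul_comm (v i), chartHom_chartCoord, h k i]

lemma mul_eq_mul_of_ringPoint_eq {v w : Fin 3 → A}
    (hv : (W.baseChange A).toProjective.Equation v)
    (hw : (W.baseChange A).toProjective.Equation w) {i : Fin 3} (hi : IsUnit (v i))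
    (hj : IsUnit (w i)) (h : ringPoint v hv i hi = ringPoint w hw i hj) (k : Fin 3) :
    v k * w i = w k * v i := by
  rw [ringPoint, ringPoint, cancel_mono] at h
  have h' : chartHom v hv i hi = chartHom w hw i hj := by
    simpa using congrArg (fun f ↦ f.hom) (Spec.map_injective h)
  rw [← chartHom_chartCoord v hv i hi k, ← chartHom_chartCoord w hw i hj k, h']
  ring

/-- The definition of field-valued points by global sections agrees with the one by charts. -/
lemma pointOfVec_eq_ringPoint {L : Type} [Field L] [Algebra F L] (v : Fin 3 → L)
    (hv : (W.baseChange L).toProjective.Equation v) (i : Fin 3) (hi : v i ≠ 0) :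
    pointOfVec v hv i hi = ringPoint v hv i hi.isUnit := by
  have hu : IsUnit ((coneHom v hv).toRingHom (coord W i)) := by simpa using hi
  exact fromOfGlobalSections_Spec (grading W) (coneHom v hv).toRingHom _ one_pos (coord_mem W i) hu

end Charts

/-! ### The projective curve is integral -/

section Integral

variable {F : Type} [Field F] (W : WeierstrassCurve F)

/-- The homogeneous Weierstrass polynomial, viewed as a cubic in `X`, is Eisenstein at `Z`. -/
lemma irreducible_polynomial_projective : Irreducible W.toProjective.polynomial := by
  let y : MvPolynomial (Fin 2) F := MvPolynomial.X 0
  let z : MvPolynomial (Fin 2) F := MvPolynomial.X 1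
  let c (a : F) : MvPolynomial (Fin 2) F := MvPolynomial.C a
  let f : Cubic (MvPolynomial (Fin 2) F) :=
    ⟨1, c W.a₂ * z, c W.a₄ * z ^ 2 - c W.a₁ * y * z,
      z * (c W.a₆ * z ^ 2 - c W.a₃ * y * z - y ^ 2)⟩
  -- The sign makes the polynomial monic in `X`.
  have hf : MvPolynomial.finSuccEquiv F 2 (-W.toProjective.polynomial) = f.toPoly := by
    have h₁ : MvPolynomial.finSuccEquiv F 2 (MvPolynomial.X 1) = Polynomial.C y :=
      MvPolynomial.finSuccEquiv_X_succ (j := 0)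
    have h₂ : MvPolynomial.finSuccEquiv F 2 (MvPolynomial.X 2) = Polynomial.C z :=
      MvPolynomial.finSuccEquiv_X_succ (j := 1)
    have hC (a : F) : MvPolynomial.finSuccEquiv F 2 (MvPolynomial.C a) =
      Polynomial.C (c a) := by simp [MvPolynomial.finSuccEquiv_apply, c]
    simp only [WeierstrassCurve.Projective.polynomial, map_neg, map_sub, map_add, map_mul, map_pow,
      h₁, h₂, hC, MvPolynomial.finSuccEquiv_X_zero, Cubic.toPoly, f]
    rw [map_one]
    ring
  have hdeg : f.toPoly.natDegree = 3 := Cubic.natDegree_of_a_ne_zero one_ne_zero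
  have hdeg' : f.toPoly.degree = 3 := Cubic.degree_of_a_ne_zero one_ne_zero
  have hmon : f.toPoly.Monic := Cubic.monic_of_a_eq_one rfl
  have hz : (Ideal.span {z}).IsPrime :=
    (Ideal.span_singleton_prime (MvPolynomial.X_ne_zero 1)).mpr (MvPolynomial.X_prime (i := 1))
  have hmem {p : MvPolynomial (Fin 2) F} : p ∈ Ideal.span {z} ↔ z ∣ p := Ideal.mem_span_singleton
  have hirr : Irreducible f.toPoly := by
    refine Polynomial.irreducible_of_eisenstein_criterion hz ?_ ?_ ?_ ?_ hmon.isPrimitive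
    · rw [hmon.leadingCoeff]
      exact fun h ↦ hz.ne_top ((Ideal.eq_top_iff_one _).mpr h)
    · intro n hn
      rw [hdeg'] at hn
      have hn' : n < 3 := by exact_mod_cast hn
      interval_cases n
      · rw [Cubic.coeff_eq_d, hmem]; exact Dvd.intro _ rfl
      · rw [Cubic.coeff_eq_c, hmem]
        exact ⟨c W.a₄ * z - c W.a₁ * y, by simp only [f]; ring⟩
      · rw [Cubic.coeff_eq_b, hmem]; exact Dvd.intro_left _ rfl
    · rw [hdeg']; norm_num
    · rw [Cubic.coeff_eq_d, Ideal.span_singleton_pow, Ideal.mem_span_singleton]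
      rintro ⟨q, hq⟩
      have h : c W.a₆ * z ^ 2 - c W.a₃ * y * z - y ^ 2 = z * q :=
        mul_left_cancel₀ (MvPolynomial.X_ne_zero 1 : z ≠ 0) (hq.trans (by ring))
      simpa [c, y, z] using congrArg (MvPolynomial.eval ![1, 0]) h
  rw [← hf, MulEquiv.irreducible_iff] at hirr
  exact (Associated.refl _).neg_left.irreducible hirr

instance : IsDomain (HomogCoordRing W) := by
  have h : (Ideal.span {W.toProjective.polynomial}).IsPrime :=
    (Ideal.span_singleton_prime (irreducible_polynomial_projective W).ne_zero).mpr
      (irreducible_polynomial_projective W).prime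
  infer_instance

lemma mem_idealOfVars_of_isHomogeneous {n : ℕ} (hn : 0 < n) {p : MvPolynomial (Fin 3) F}
    (hp : p.IsHomogeneous n) : p ∈ MvPolynomial.idealOfVars (Fin 3) F := by
  rw [← pow_one (MvPolynomial.idealOfVars (Fin 3) F), MvPolynomial.mem_pow_idealOfVars_iff]
  intro x hx
  have h := hp (MvPolynomial.mem_support_iff.mp hx)
  have hd : x.degree = Finsupp.weight 1 x := by rw [Finsupp.degree_eq_weight_one]; rfl
  rw [← hd] at h
  omega

lemma irrelevant_le_span_coord : (HomogeneousIdeal.irrelevant (grading W)).toIdeal ≤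
    Ideal.span (Set.range (coord W)) := by
  rw [HomogeneousIdeal.toIdeal_irrelevant_le]
  rintro n hn _ ⟨p, hp, rfl⟩
  have h' := Ideal.mem_map_of_mem (Ideal.Quotient.mk (Ideal.span {W.toProjective.polynomial}))
    (mem_idealOfVars_of_isHomogeneous hn hp)
  rw [Ideal.map_span, ← Set.range_comp] at h'
  exact h'

/-- The projective curve is covered by the three charts. -/
def chartCover : (weierstrassScheme W).left.AffineOpenCover :=
  Proj.affineOpenCoverOfIrrelevantLESpan (grading W) (coord W) (coord_mem W) (fun _ ↦ one_pos)
    (irrelevant_le_span_coord W)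

lemma coord_two_ne_zero : coord W 2 ≠ 0 := by
  intro h
  rw [coord, Ideal.Quotient.eq_zero_iff_mem, Ideal.mem_span_singleton] at h
  have hX : Irreducible (MvPolynomial.X 2 : MvPolynomial (Fin 3) F) :=
    MvPolynomial.X_prime.irreducible
  obtain ⟨q, hq⟩ := (irreducible_polynomial_projective W).dvd_symm hX h
  have h := congrArg (MvPolynomial.eval ![1, 0, 0]) hq
  rw [WeierstrassCurve.Projective.eval_polynomial] at h
  simp at h

instance (i : Fin 3) : _root_.IsReduced (ChartRing W i) :=
  _root_.isReduced_of_injective (algebraMap (ChartRing W i) (Localization.Away (coord W i)))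
    (HomogeneousLocalization.val_injective _)

instance isIntegral_weierstrassScheme : IsIntegral (weierstrassScheme W).left := by
  have hred : IsReduced (weierstrassScheme W).left := by
    have h (i : Fin 3) : IsReduced (Spec (.of (ChartRing W i))) :=
      (affine_isReduced_iff (.of (ChartRing W i))).mpr
        (inferInstanceAs (_root_.IsReduced (ChartRing W i)))
    exact @AlgebraicGeometry.IsReduced.of_openCover _ (chartCover W).openCover h
  -- The zero ideal is the generic point.
  let η : ProjectiveSpectrum (grading W) :=
    { asHomogeneousIdeal := ⊥
      isPrime := by
        rw [HomogeneousIdeal.toIdeal_bot]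
        exact Ideal.isPrime_bot
      not_irrelevant_le := by
        intro h
        have h2 : coord W 2 ∈ (HomogeneousIdeal.irrelevant (grading W)).toIdeal :=
          HomogeneousIdeal.mem_irrelevant_of_mem (grading W) one_pos (coord_mem W 2)
        exact coord_two_ne_zero W ((Ideal.mem_bot).mp (h h2)) }
  have hirr : IrreducibleSpace (ProjectiveSpectrum (grading W)) := by
    have h : closure {η} = Set.univ :=
      Set.eq_univ_of_forall fun x ↦ (ProjectiveSpectrum.le_iff_mem_closure _ _ _).mp
        (show (⊥ : HomogeneousIdeal (grading W)) ≤ _ from bot_le)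
    have := isIrreducible_singleton (x := η).closure
    rw [h] at this
    exact (irreducibleSpace_def _).mpr this
  have : IrreducibleSpace (weierstrassScheme W).left := hirr
  exact isIntegral_of_irreducibleSpace_of_isReduced _

end Integral

/-! ### The projective curve is smooth -/

section Smooth

variable {F : Type} [Field F] (W : WeierstrassCurve F)

/-- The equations of the `i`-th chart in affine `3`-space: the Weierstrass equation and `Xᵢ = 1`. -/
def chartRel (i : Fin 3) : Fin 2 → MvPolynomial (Fin 3) F :=
  ![W.toProjective.polynomial, MvPolynomial.X i - 1]

/-- The ring presented by the equations of the `i`-th chart. -/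
abbrev ChartPres (i : Fin 3) : Type :=
  MvPolynomial (Fin 3) F ⧸ Ideal.span (Set.range (chartRel W i))

variable {W}

lemma equation_of_aeval {A : Type} [CommRing A] [Algebra F A] {v : Fin 3 → A}
    (h : MvPolynomial.aeval v W.toProjective.polynomial = 0) :
    (W.baseChange A).toProjective.Equation v := by
  rw [WeierstrassCurve.Projective.Equation]
  erw [WeierstrassCurve.Projective.map_polynomial]
  rwa [MvPolynomial.eval_map]

lemma mk_chartRel (i : Fin 3) (j : Fin 2) :
    Ideal.Quotient.mk (Ideal.span (Set.range (chartRel W i))) (chartRel W i j) = 0 :=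
  Ideal.Quotient.eq_zero_iff_mem.mpr (Ideal.subset_span ⟨j, rfl⟩)

lemma equation_chartPres (i : Fin 3) : (W.baseChange (ChartPres W i)).toProjective.Equation
    fun k ↦ Ideal.Quotient.mk (Ideal.span (Set.range (chartRel W i))) (MvPolynomial.X k) := by
  refine equation_of_aeval (Eq.trans ?_ (mk_chartRel i 0))
  exact congrArg (fun φ : MvPolynomial (Fin 3) F →ₐ[F] ChartPres W i ↦ φ W.toProjective.polynomial)
    (MvPolynomial.algHom_ext (g := Ideal.Quotient.mkₐ F _) fun k ↦ by
      rw [MvPolynomial.aeval_X]; rfl)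

lemma mk_X_self (i : Fin 3) :
    Ideal.Quotient.mk (Ideal.span (Set.range (chartRel W i))) (MvPolynomial.X i) = 1 :=
  sub_eq_zero.mp ((map_sub (Ideal.Quotient.mk _) _ 1).symm.trans (mk_chartRel i 1))

lemma chartHom_chartPres (i : Fin 3) (h) (k : Fin 3) :
    chartHom _ (equation_chartPres (W := W) i) i h (chartCoord W i k) =
      Ideal.Quotient.mk (Ideal.span (Set.range (chartRel W i))) (MvPolynomial.X k) :=
  (mul_one _).symm.trans ((congrArg _ (mk_X_self i).symm).trans
    (chartHom_chartCoord _ (equation_chartPres i) i h k))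

variable (W)

/-- Functions on the `i`-th chart are presented by the Weierstrass equation and `Xᵢ = 1`. -/
def chartEquiv (i : Fin 3) : ChartPres W i ≃+* ChartRing W i :=
  RingEquiv.ofRingHom
    (Ideal.Quotient.lift _ (MvPolynomial.eval₂Hom (chartConst W i) (chartCoord W i)) (by
      have h : Ideal.span (Set.range (chartRel W i)) ≤
          RingHom.ker (MvPolynomial.eval₂Hom (chartConst W i) (chartCoord W i)) := by
        rw [Ideal.span_le]
        rintro _ ⟨k, rfl⟩
        fin_cases k
        · exact eval_chartCoord_polynomial i
        · change MvPolynomial.eval₂Hom (chartConst W i) (chartCoord W i)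
            (MvPolynomial.X i - 1) = 0
          simp [chartCoord_self]
      exact fun p hp ↦ h hp))
    (chartHom _ (equation_chartPres i) i (mk_X_self (W := W) i ▸ isUnit_one))
    (chart_hom_ext (by
      rw [RingHom.comp_assoc, chartHom_comp_chartConst]
      exact RingHom.ext fun c ↦ MvPolynomial.eval₂_C _ _ c) (fun k ↦ by
      rw [RingHom.comp_apply, chartHom_chartPres]
      exact MvPolynomial.eval₂_X _ _ k))
    (by
      refine Ideal.Quotient.ringHom_ext (MvPolynomial.ringHom_ext (fun c ↦ ?_) fun k ↦ ?_)
      · refine (congrArg (chartHom _ (equation_chartPres i) i (mk_X_self (W := W) i ▸ isUnit_one))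
          (MvPolynomial.eval₂_C (chartConst W i) (chartCoord W i) c)).trans ?_
        exact RingHom.congr_fun (chartHom_comp_chartConst _ (equation_chartPres i) i
          (mk_X_self (W := W) i ▸ isUnit_one)) c
      · refine (congrArg (chartHom _ (equation_chartPres i) i (mk_X_self (W := W) i ▸ isUnit_one))
          (MvPolynomial.eval₂_X (chartConst W i) (chartCoord W i) k)).trans ?_
        exact chartHom_chartPres i _ k)

lemma chartEquiv_comp_algebraMap (i : Fin 3) :
    (chartEquiv W i).toRingHom.comp (algebraMap F (ChartPres W i)) = chartConst W i := by
  exact RingHom.ext fun c ↦ MvPolynomial.eval₂_C (chartConst W i) (chartCoord W i) c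

variable {W}

/-- The Jacobian criterion on a chart: where the partial derivative of the Weierstrass equation
with respect to another coordinate is invertible, the chart is standard smooth. -/
lemma isStandardSmooth_chartPres {i j : Fin 3} (hij : j ≠ i) (S : Type) [CommRing S]
    [Algebra (ChartPres W i) S] [Algebra F S] [IsScalarTower F (ChartPres W i) S]
    [IsLocalization.Away (Ideal.Quotient.mk (Ideal.span (Set.range (chartRel W i)))
      (MvPolynomial.pderiv j W.toProjective.polynomial)) S] :
    Algebra.IsStandardSmoothOfRelativeDimension 1 F S := by
  let P : Algebra.PreSubmersivePresentation F (ChartPres W i) (Fin 3) (Fin 2) :=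
    .naive (v := chartRel W i) ![j, i] (by
      intro a b
      fin_cases a <;> fin_cases b <;> simp [hij, hij.symm])
  let t := Ideal.Quotient.mk (Ideal.span (Set.range (chartRel W i)))
      (MvPolynomial.pderiv j W.toProjective.polynomial)
  let Q := Algebra.PreSubmersivePresentation.localizationAway S t
  have hP : P.jacobian = t := by
    rw [Algebra.PreSubmersivePresentation.jacobian_eq_jacobiMatrix_det, Matrix.det_fin_two]
    have h (a b : Fin 2) : P.jacobiMatrix a b =
        MvPolynomial.pderiv ((![j, i] : Fin 2 → Fin 3) a) (chartRel W i b) :=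
      Algebra.PreSubmersivePresentation.jacobiMatrix_naive ..
    rw [h, h, h, h]
    have hX : MvPolynomial.pderiv j (MvPolynomial.X i : MvPolynomial (Fin 3) F) = 0 :=
      MvPolynomial.pderiv_X_of_ne hij.symm
    simp only [chartRel, Matrix.cons_val_zero, Matrix.cons_val_one, map_sub,
      MvPolynomial.pderiv_X_self, hX, Derivation.map_one_eq_zero, sub_zero, mul_one,
      zero_mul]
    rw [P.algebraMap_apply]
    exact congrArg (fun φ : MvPolynomial (Fin 3) F →ₐ[F] ChartPres W i ↦
      φ (MvPolynomial.pderiv j W.toProjective.polynomial))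
      (MvPolynomial.algHom_ext (f := MvPolynomial.aeval P.val) (g := Ideal.Quotient.mkₐ F _)
        fun k ↦ by rw [MvPolynomial.aeval_X]; rfl)
  have hunit : IsUnit (algebraMap (ChartPres W i) S t) := IsLocalization.Away.algebraMap_isUnit t
  refine Algebra.SubmersivePresentation.isStandardSmoothOfRelativeDimension
    (P := ⟨Q.comp P, ?_⟩) ?_
  · rw [Algebra.PreSubmersivePresentation.comp_jacobian_eq_jacobian_smul_jacobian, hP,
      Algebra.PreSubmersivePresentation.localizationAway_jacobian, Algebra.smul_def]
    exact hunit.mul hunit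
  · rw [Algebra.PreSubmersivePresentation.dimension_comp_eq_dimension_add_dimension]
    have h : Q.dimension = 0 := Algebra.Presentation.localizationAway_dimension_zero t
    rw [h]
    simp [Algebra.Presentation.dimension]

lemma nonsingular_projective_of_Δ_ne_zero {L : Type} [Field L] {W : WeierstrassCurve L}
    (hW : W.Δ ≠ 0) {v : Fin 3 → L} (hv : W.toProjective.Equation v) (hv' : v ≠ 0) :
    W.toProjective.Nonsingular v := by
  by_cases hz : v 2 = 0
  · have hx : v 0 = 0 := by
      rw [WeierstrassCurve.Projective.equation_of_Z_eq_zero hz] at hv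
      exact eq_zero_of_pow_eq_zero hv
    rw [WeierstrassCurve.Projective.nonsingular_of_Z_eq_zero hz]
    refine ⟨hv, .inr ?_⟩
    rw [hx]
    intro hy
    refine hv' (funext fun i ↦ ?_)
    fin_cases i
    · exact hx
    · simpa using hy
    · exact hz
  · rw [WeierstrassCurve.Projective.nonsingular_of_Z_ne_zero hz]
    rw [WeierstrassCurve.Projective.equation_of_Z_ne_zero hz] at hv
    exact (WeierstrassCurve.Affine.equation_iff_nonsingular_of_Δ_ne_zero hW).mp hv

lemma eval_pderiv_baseChange {A : Type} [CommRing A] [Algebra F A] (v : Fin 3 → A) (j : Fin 3) :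
    MvPolynomial.eval v (MvPolynomial.pderiv j (W.baseChange A).toProjective.polynomial) =
      MvPolynomial.aeval v (MvPolynomial.pderiv j W.toProjective.polynomial) := by
  erw [WeierstrassCurve.Projective.map_polynomial]
  rw [MvPolynomial.pderiv_map, MvPolynomial.eval_map]
  rfl

/-- At every point of a chart some partial derivative does not vanish, by Euler's formula one with
respect to a coordinate that is not normalized to `1`. -/
lemma span_pderiv_eq_top (hW : W.Δ ≠ 0) (i : Fin 3) :
    Ideal.span {t | ∃ j ≠ i, Ideal.Quotient.mk (Ideal.span (Set.range (chartRel W i)))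
      (MvPolynomial.pderiv j W.toProjective.polynomial) = t} = ⊤ := by
  by_contra h
  obtain ⟨m, hm, hle⟩ := Ideal.exists_le_maximal _ h
  let _ := Ideal.Quotient.field m
  have hv := equation_comp (Ideal.Quotient.mkₐ F m) (equation_chartPres (W := W) i)
  set v := (Ideal.Quotient.mkₐ F m) ∘ fun k ↦
    Ideal.Quotient.mk (Ideal.span (Set.range (chartRel W i))) (MvPolynomial.X k) with hv_def
  have haeval (p : MvPolynomial (Fin 3) F) : MvPolynomial.aeval v p =
      Ideal.Quotient.mk m (Ideal.Quotient.mk (Ideal.span (Set.range (chartRel W i))) p) :=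
    congrArg (fun φ : MvPolynomial (Fin 3) F →ₐ[F] (ChartPres W i ⧸ m) ↦ φ p)
      (MvPolynomial.algHom_ext
        (g := (Ideal.Quotient.mkₐ F m).comp (Ideal.Quotient.mkₐ F _)) fun k ↦ by
          rw [MvPolynomial.aeval_X]; rfl)
  have hvi : v i = 1 := by
    rw [hv_def, Function.comp_apply, mk_X_self, map_one]
  have hpd (j : Fin 3) (hj : j ≠ i) : MvPolynomial.eval v
      (MvPolynomial.pderiv j (W.baseChange (ChartPres W i ⧸ m)).toProjective.polynomial) = 0 := by
    rw [eval_pderiv_baseChange, haeval]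
    exact Ideal.Quotient.eq_zero_iff_mem.mpr (hle (Ideal.subset_span ⟨j, hj, rfl⟩))
  have hns : (W.baseChange (ChartPres W i ⧸ m)).toProjective.Nonsingular v := by
    refine nonsingular_projective_of_Δ_ne_zero ?_ hv fun h0 ↦ ?_
    · rw [WeierstrassCurve.baseChange, WeierstrassCurve.map_Δ]
      exact (map_ne_zero _).mpr hW
    · rw [h0] at hvi
      exact zero_ne_one hvi
  have heuler := WeierstrassCurve.Projective.polynomial_relation
    (W' := (W.baseChange (ChartPres W i ⧸ m)).toProjective) v
  rw [show MvPolynomial.eval v _ = 0 from hv] at heuler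
  have hall (j : Fin 3) : MvPolynomial.eval v
      (MvPolynomial.pderiv j (W.baseChange (ChartPres W i ⧸ m)).toProjective.polynomial) = 0 := by
    by_cases hj : j = i
    · subst hj
      change _ = v 0 * MvPolynomial.eval v (MvPolynomial.pderiv 0 _) +
        v 1 * MvPolynomial.eval v (MvPolynomial.pderiv 1 _) +
        v 2 * MvPolynomial.eval v (MvPolynomial.pderiv 2 _) at heuler
      fin_cases j
      all_goals
        simp_all
    · exact hpd j hj
  rcases hns.2 with h | h | h
  exacts [h (hall 0), h (hall 1), h (hall 2)]

instance : IsZariskiLocalAtSource (@SmoothOfRelativeDimension.{0} 1) :=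
  HasRingHomProperty.instIsZariskiLocalAtSource (P := @SmoothOfRelativeDimension.{0} 1)

instance : MorphismProperty.RespectsIso (@SmoothOfRelativeDimension.{0} 1) :=
  (HasRingHomProperty.instIsZariskiLocalAtSource
    (P := @SmoothOfRelativeDimension.{0} 1)).toRespects

lemma smooth_SpecMap_chartConst (hW : W.Δ ≠ 0) (i : Fin 3) :
    SmoothOfRelativeDimension 1 (Spec.map (CommRingCat.ofHom (chartConst W i))) := by
  have h : SmoothOfRelativeDimension 1
      (Spec.map (CommRingCat.ofHom (algebraMap F (ChartPres W i)))) := by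
    rw [HasRingHomProperty.Spec_iff (P := @SmoothOfRelativeDimension.{0} 1)]
    refine ⟨_, span_pderiv_eq_top hW i, ?_⟩
    rintro _ ⟨j, hj, rfl⟩
    have := isStandardSmooth_chartPres (W := W) hj (Localization.Away (Ideal.Quotient.mk
      (Ideal.span (Set.range (chartRel W i))) (MvPolynomial.pderiv j W.toProjective.polynomial)))
    exact (RingHom.isStandardSmoothOfRelativeDimension_algebraMap 1).mpr this
  rw [← chartEquiv_comp_algebraMap, CommRingCat.ofHom_comp, Spec.map_comp]
  have : IsIso (CommRingCat.ofHom (chartEquiv W i).toRingHom) :=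
    (chartEquiv W i).toCommRingCatIso.isIso_hom
  exact MorphismProperty.RespectsIso.precomp (P := @SmoothOfRelativeDimension.{0} 1) _ _ h

lemma smooth_weierstrassScheme (hW : W.Δ ≠ 0) :
    SmoothOfRelativeDimension 1 (weierstrassScheme W).hom := by
  rw [IsZariskiLocalAtSource.iff_of_openCover (P := @SmoothOfRelativeDimension.{0} 1)
    (chartCover W).openCover]
  have h (i : Fin 3) : SmoothOfRelativeDimension 1 (chartι W i ≫ (weierstrassScheme W).hom) := by
    rw [chartι_comp]
    exact smooth_SpecMap_chartConst hW i
  exact h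

end Smooth

/-! ### The projective curve as a closed subscheme of the plane -/

section Plane

/-- A graded homomorphism that is surjective on the charts of elements of degree one generating the
irrelevant ideal induces a closed immersion of `Proj`. -/
lemma isClosedImmersion_projMap {A B σ τ ι : Type} [CommRing A] [CommRing B] [SetLike σ A]
    [AddSubgroupClass σ A] [SetLike τ B] [AddSubgroupClass τ B] {𝒜 : ℕ → σ} {ℬ : ℕ → τ}
    [GradedRing 𝒜] [GradedRing ℬ] (f : 𝒜 →+*ᵍ ℬ)
    (hf : HomogeneousIdeal.irrelevant ℬ ≤ (HomogeneousIdeal.irrelevant 𝒜).map f) (s : ι → A)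
    (hs : ∀ i, s i ∈ 𝒜 1) (hspan : (HomogeneousIdeal.irrelevant 𝒜).toIdeal ≤ Ideal.span (.range s))
    (hsurj : ∀ i, Function.Surjective (HomogeneousLocalization.Away.map f (s i))) :
    IsClosedImmersion (Proj.map f hf) := by
  refine IsZariskiLocalAtTarget.of_iSup_eq_top (P := @IsClosedImmersion) _
    (Proj.iSup_basicOpen_eq_top _ s hspan) fun i ↦ ?_
  obtain ⟨e, he⟩ : ∃ e : (Proj.map f hf ⁻¹ᵁ Proj.basicOpen 𝒜 (s i)).toScheme ≅
      Spec (.of (HomogeneousLocalization.Away ℬ (f (s i)))),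
      e.inv ≫ (Proj.map f hf ⁻¹ᵁ Proj.basicOpen 𝒜 (s i)).ι =
        Proj.awayι ℬ (f (s i)) (f.map_mem (hs i)) one_pos :=
    ⟨Proj.basicOpenIsoSpec ℬ (f (s i)) (f.map_mem (hs i)) one_pos, Proj.basicOpenIsoSpec_inv_ι ..⟩
  have h : (Proj.map f hf) ∣_ (Proj.basicOpen 𝒜 (s i)) =
      e.hom ≫ Spec.map (CommRingCat.ofHom (HomogeneousLocalization.Away.map f (s i))) ≫
        (Proj.basicOpenIsoSpec 𝒜 (s i) (hs i) one_pos).inv := by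
    rw [← Iso.inv_comp_eq, ← cancel_mono (Proj.basicOpen 𝒜 (s i)).ι, Category.assoc,
      Category.assoc, morphismRestrict_ι, Proj.basicOpenIsoSpec_inv_ι, reassoc_of% he]
    exact Proj.awayι_comp_map f hf one_pos (s i) (hs i)
  have h' : IsClosedImmersion (Spec.map (CommRingCat.ofHom
      (HomogeneousLocalization.Away.map f (s i)))) :=
    IsClosedImmersion.spec_of_surjective _ (hsurj i)
  rw [h]
  infer_instance

variable {F : Type} [Field F] (W : WeierstrassCurve F)

open HomogeneousIdeal Graded

instance : GradedAlgebra (MvPolynomial.homogeneousSubmodule (Fin 3) F) := MvPolynomial.gradedAlgebra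

/-- The quotient map from `F[X, Y, Z]` to the homogeneous coordinate ring. -/
def mkGradedHom : (MvPolynomial.homogeneousSubmodule (Fin 3) F) →+*ᵍ grading W where
  __ := Ideal.Quotient.mk (Ideal.span {W.toProjective.polynomial})
  map_mem hp := mk_mem_grading W hp

lemma X_mem (i : Fin 3) :
    MvPolynomial.X i ∈ MvPolynomial.homogeneousSubmodule (Fin 3) F 1 :=
  MvPolynomial.isHomogeneous_X F i

lemma mkGradedHom_X_mem (i : Fin 3) : mkGradedHom W (MvPolynomial.X i) ∈ grading W 1 :=
  coord_mem W i

lemma irrelevant_le_map_mkGradedHom : HomogeneousIdeal.irrelevant (grading W) ≤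
    (HomogeneousIdeal.irrelevant (MvPolynomial.homogeneousSubmodule (Fin 3) F)).map
      (mkGradedHom W) := by
  refine (irrelevant_le_span_coord W).trans (Ideal.span_le.mpr ?_)
  rintro _ ⟨i, rfl⟩
  exact Ideal.mem_map_of_mem (mkGradedHom W)
    (HomogeneousIdeal.mem_irrelevant_of_mem _ one_pos (X_mem i))

/-- The inclusion of the projective curve in the projective plane. -/
def toPlane : Proj (grading W) ⟶ Proj (MvPolynomial.homogeneousSubmodule (Fin 3) F) :=
  Proj.map (mkGradedHom W) (irrelevant_le_map_mkGradedHom W)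

lemma awayι_comp_toPlane (i : Fin 3) :
    Proj.awayι (grading W) (mkGradedHom W (MvPolynomial.X i)) (mkGradedHom_X_mem W i) one_pos ≫
        toPlane W =
    Spec.map (CommRingCat.ofHom
      (HomogeneousLocalization.Away.map (mkGradedHom W) (MvPolynomial.X i))) ≫
        Proj.awayι (MvPolynomial.homogeneousSubmodule (Fin 3) F) (MvPolynomial.X i)
          (X_mem i) one_pos :=
  Proj.awayι_comp_map (mkGradedHom W) (irrelevant_le_map_mkGradedHom W) one_pos
    (MvPolynomial.X i) (X_mem i)

lemma toPlane_comp_hom : toPlane W ≫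
    (projOver (MvPolynomial.homogeneousSubmodule (Fin 3) F)).hom = (weierstrassScheme W).hom := by
  refine Scheme.Cover.hom_ext (chartCover W).openCover _ _ fun i ↦ ?_
  have h (i : Fin 3) : Proj.awayι (grading W) (mkGradedHom W (MvPolynomial.X i))
      (mkGradedHom_X_mem W i) one_pos ≫ toPlane W ≫
        (projOver (MvPolynomial.homogeneousSubmodule (Fin 3) F)).hom =
      chartι W i ≫ (weierstrassScheme W).hom := by
    rw [chartι_comp]
    change _ ≫ toPlane W ≫ Proj.toSpecZero _ ≫ _ = _
    rw [← Category.assoc, awayι_comp_toPlane, Category.assoc, Proj.awayι_toSpecZero_assoc,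
      ← Spec.map_comp, ← Spec.map_comp]
    rfl
  exact h i

lemma map_mkGradedHom_surjective (i : Fin 3) : Function.Surjective
    (HomogeneousLocalization.Away.map (mkGradedHom W) (MvPolynomial.X i)) := by
  intro x
  obtain ⟨n, _, ⟨p, hp, rfl⟩, rfl⟩ := HomogeneousLocalization.Away.mk_surjective (grading W)
    (coord_mem W i) x
  exact ⟨_, HomogeneousLocalization.Away.map_mk (mkGradedHom W) (MvPolynomial.X i)
    (X_mem i) n p hp⟩

instance : IsClosedImmersion (toPlane W) := by
  refine isClosedImmersion_projMap (mkGradedHom W) (irrelevant_le_map_mkGradedHom W)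
    MvPolynomial.X X_mem ?_ (map_mkGradedHom_surjective W)
  rw [HomogeneousIdeal.toIdeal_irrelevant_le]
  exact fun n hn p hp ↦ mem_idealOfVars_of_isHomogeneous hn hp

/-- An elliptic curve in Weierstrass form is a smooth projective curve. -/
lemma isSmoothProjectiveCurve_weierstrassScheme {W : WeierstrassCurve F} (hW : W.Δ ≠ 0) :
    IsSmoothProjectiveCurve (weierstrassScheme W) where
  isIntegral := inferInstance
  smooth := smooth_weierstrassScheme hW
  projective := ⟨2, Over.homMk (toPlane W) (toPlane_comp_hom W),
    inferInstanceAs (IsClosedImmersion (toPlane W))⟩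

end Plane

/-! ### The affine chart -/

section Affine

open Polynomial

variable {F : Type} [Field F] (W : WeierstrassCurve F)

/-- The affine coordinate `x`, as a function on the affine curve. -/
def affX : W.toAffine.CoordinateRing := algebraMap F[X] _ X

/-- The affine coordinate `y`, as a function on the affine curve. -/
def affY : W.toAffine.CoordinateRing := AdjoinRoot.root _

lemma affine_equation : affY W ^ 2 + algebraMap F _ W.a₁ * affX W * affY W +
    algebraMap F _ W.a₃ * affY W = affX W ^ 3 + algebraMap F _ W.a₂ * affX W ^ 2 +
      algebraMap F _ W.a₄ * affX W + algebraMap F _ W.a₆ := by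
  have h (p) (hp : p = W.toAffine.polynomial) : AdjoinRoot.mk W.toAffine.polynomial p = 0 :=
    hp ▸ AdjoinRoot.mk_self
  have hc (c : F) : AdjoinRoot.mk W.toAffine.polynomial (C (C c)) = algebraMap F _ c := rfl
  have hx : AdjoinRoot.mk W.toAffine.polynomial (C X) = affX W := rfl
  have hy : AdjoinRoot.mk W.toAffine.polynomial X = affY W := rfl
  have h := h _ (WeierstrassCurve.Affine.polynomial.eq_1 _).symm
  simp only [map_sub, map_add, map_mul, map_pow, hc, hx, hy] at h
  linear_combination h

variable {W}

lemma equation_iff_eval {A : Type} [CommRing A] [Algebra F A] {x y : A} :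
    (W.baseChange A).toProjective.Equation ![x, y, 1] ↔
    y ^ 2 + algebraMap F A W.a₁ * x * y + algebraMap F A W.a₃ * y =
      x ^ 3 + algebraMap F A W.a₂ * x ^ 2 + algebraMap F A W.a₄ * x + algebraMap F A W.a₆ := by
  rw [WeierstrassCurve.Projective.equation_some, WeierstrassCurve.Affine.equation_iff]
  rfl

/-- The homomorphism from the affine coordinate ring given by a point of the affine curve. -/
def affHom {A : Type} [CommRing A] [Algebra F A] (x y : A)
    (h : (W.baseChange A).toProjective.Equation ![x, y, 1]) :
    W.toAffine.CoordinateRing →ₐ[F] A :=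
  AdjoinRoot.liftAlgHom _ (aeval x) y (by
    rw [equation_iff_eval] at h
    simp only [WeierstrassCurve.Affine.polynomial, map_add, map_mul, map_pow,
      eval₂_sub, eval₂_add, eval₂_mul, eval₂_pow, eval₂_X, eval₂_C, aeval_X,
      aeval_C, RingHom.coe_coe]
    linear_combination h)

lemma affHom_affX {A : Type} [CommRing A] [Algebra F A] (x y : A)
    (h : (W.baseChange A).toProjective.Equation ![x, y, 1]) : affHom x y h (affX W) = x := by
  refine (AdjoinRoot.liftAlgHom_of _ _ _ _ X).trans ?_
  simp

lemma affHom_affY {A : Type} [CommRing A] [Algebra F A] (x y : A)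
    (h : (W.baseChange A).toProjective.Equation ![x, y, 1]) : affHom x y h (affY W) = y :=
  AdjoinRoot.liftAlgHom_root _ _ _ _

lemma aff_hom_ext {A : Type} [CommRing A] [Algebra F A] {f g : W.toAffine.CoordinateRing →ₐ[F] A}
    (hx : f (affX W) = g (affX W)) (hy : f (affY W) = g (affY W)) : f = g :=
  AdjoinRoot.algHom_ext' (Polynomial.algHom_ext hx) hy

variable (W)

lemma equation_affine :
    (W.baseChange W.toAffine.CoordinateRing).toProjective.Equation ![affX W, affY W, 1] :=
  equation_iff_eval.mpr (affine_equation W)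

lemma isUnit_vec_two {A : Type} [CommRing A] (x y : A) : IsUnit ((![x, y, 1] : Fin 3 → A) 2) :=
  isUnit_one

/-- The inclusion of the affine curve in the projective curve. -/
def affι : Spec (.of W.toAffine.CoordinateRing) ⟶ (weierstrassScheme W).left :=
  ringPoint ![affX W, affY W, 1] (equation_affine W) 2 (isUnit_vec_two _ _)

/-- The functions on the chart `Z ≠ 0` are the affine coordinate ring. -/
lemma bijective_chartHom_affine : Function.Bijective
    (chartHom ![affX W, affY W, 1] (equation_affine W) 2 (isUnit_vec_two _ _)) := by
  have hv (k : Fin 3) : chartHom ![affX W, affY W, 1] (equation_affine W) 2 (isUnit_vec_two _ _)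
      (chartCoord W 2 k) = (![affX W, affY W, 1] : Fin 3 → W.toAffine.CoordinateRing) k :=
    (mul_one _).symm.trans (chartHom_chartCoord _ (equation_affine W) 2 (isUnit_vec_two _ _) k)
  let _ : Algebra F (ChartRing W 2) := (chartConst W 2).toAlgebra
  have heq : (W.baseChange (ChartRing W 2)).toProjective.Equation
      ![chartCoord W 2 0, chartCoord W 2 1, 1] := by
    have h := eval_chartCoord_polynomial (W := W) 2
    have h' : chartCoord W 2 = ![chartCoord W 2 0, chartCoord W 2 1, 1] := by
      ext k
      fin_cases k
      exacts [rfl, rfl, congrArg _ (chartCoord_self 2)]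
    rw [h'] at h
    exact equation_of_aeval h
  let g := affHom _ _ heq
  constructor
  · refine Function.LeftInverse.injective (g := g) fun b ↦ ?_
    refine RingHom.congr_fun
      (f := g.toRingHom.comp (chartHom _ (equation_affine W) 2 (isUnit_vec_two _ _)))
      (g := RingHom.id _) (chart_hom_ext ?_ fun k ↦ ?_) b
    · rw [RingHom.comp_assoc, chartHom_comp_chartConst]
      exact g.comp_algebraMap
    · rw [RingHom.comp_apply, hv]
      fin_cases k
      · exact affHom_affX ..
      · exact affHom_affY ..
      · exact (map_one g).trans (chartCoord_self 2).symm
  · let f : ChartRing W 2 →ₐ[F] W.toAffine.CoordinateRing :=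
      { chartHom _ (equation_affine W) 2 (isUnit_vec_two _ _) with
        commutes' := RingHom.congr_fun (chartHom_comp_chartConst _ (equation_affine W) 2
          (isUnit_vec_two _ _)) }
    intro b
    exact ⟨g b, congrArg (fun φ : W.toAffine.CoordinateRing →ₐ[F] _ ↦ φ b)
      (aff_hom_ext (f := f.comp g) (g := AlgHom.id F _)
        ((congrArg f (affHom_affX _ _ heq)).trans (hv 0))
        ((congrArg f (affHom_affY _ _ heq)).trans (hv 1)))⟩

instance : IsOpenImmersion (affι W) := by
  have : IsIso (CommRingCat.ofHom
      (chartHom ![affX W, affY W, 1] (equation_affine W) 2 (isUnit_vec_two _ _))) :=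
    (RingEquiv.ofBijective _ (bijective_chartHom_affine W)).toCommRingCatIso.isIso_hom
  exact inferInstanceAs (IsOpenImmersion (Spec.map (CommRingCat.ofHom
    (chartHom ![affX W, affY W, 1] (equation_affine W) 2 (isUnit_vec_two _ _))) ≫ chartι W 2))

variable {W}

/-- A homomorphism from the affine coordinate ring of a Weierstrass curve is injective as soon as
the image of `x` is transcendental, since the coordinate ring is integral over `F[x]`. -/
lemma affHom_injective {A : Type} [CommRing A] [Algebra F A]
    (f : W.toAffine.CoordinateRing →ₐ[F] A) (hf : Transcendental F (f (affX W))) :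
    Function.Injective f := by
  rw [injective_iff_map_eq_zero]
  have : Module.Finite F[X] W.toAffine.CoordinateRing :=
    .of_basis (WeierstrassCurve.Affine.CoordinateRing.basis W.toAffine)
  have h : RingHom.ker f = ⊥ := by
    refine Ideal.eq_bot_of_comap_eq_bot (R := F[X]) ((Submodule.eq_bot_iff _).mpr fun p hp ↦ ?_)
    by_contra hp0
    refine hf ⟨p, hp0, ?_⟩
    rw [aeval_algHom_apply, affX, aeval_algebraMap_apply, aeval_X_left_apply]
    exact hp
  exact fun a ha ↦ (Submodule.eq_bot_iff _).mp h a ha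

lemma transcendental_affX : Transcendental F (affX W) :=
  (transcendental_algebraMap_iff (FaithfulSMul.algebraMap_injective F[X] _)).mpr
    (Polynomial.transcendental_X F)

/-- The point `(x, y)` of the affine curve, as a point of the projective curve. -/
def affPoint {A : Type} [CommRing A] [Algebra F A] (x y : A)
    (h : (W.baseChange A).toProjective.Equation ![x, y, 1]) :
    Spec (.of A) ⟶ (weierstrassScheme W).left :=
  ringPoint ![x, y, 1] h 2 (isUnit_vec_two x y)

lemma affPoint_congr {A : Type} [CommRing A] [Algebra F A] {x y x' y' : A}
    {h : (W.baseChange A).toProjective.Equation ![x, y, 1]}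
    {h' : (W.baseChange A).toProjective.Equation ![x', y', 1]} (hx : x = x') (hy : y = y') :
    affPoint x y h = affPoint x' y' h' := by
  subst hx hy
  rfl

lemma affPoint_eq {A : Type} [CommRing A] [Algebra F A] (x y : A)
    (h : (W.baseChange A).toProjective.Equation ![x, y, 1]) :
    affPoint x y h = Spec.map (CommRingCat.ofHom (affHom x y h).toRingHom) ≫ affι W := by
  rw [affι, SpecMap_ringPoint, affPoint]
  congr 1
  ext k
  fin_cases k
  exacts [(affHom_affX x y h).symm, (affHom_affY x y h).symm, (map_one (affHom x y h)).symm]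

lemma affPoint_comp_hom {A : Type} [CommRing A] [Algebra F A] (x y : A)
    (h : (W.baseChange A).toProjective.Equation ![x, y, 1]) :
    affPoint x y h ≫ (weierstrassScheme W).hom = Spec.map (CommRingCat.ofHom (algebraMap F A)) :=
  ringPoint_comp_hom ..

lemma equation_vec_map {A B : Type} [CommRing A] [Algebra F A] [CommRing B] [Algebra F B]
    (f : A →ₐ[F] B) {x y : A} (h : (W.baseChange A).toProjective.Equation ![x, y, 1]) :
    (W.baseChange B).toProjective.Equation ![f x, f y, 1] := by
  rw [equation_iff_eval] at h ⊢
  simpa using congrArg f h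

lemma SpecMap_affPoint {A B : Type} [CommRing A] [Algebra F A] [CommRing B] [Algebra F B]
    (f : A →ₐ[F] B) (x y : A) (h : (W.baseChange A).toProjective.Equation ![x, y, 1]) :
    Spec.map (CommRingCat.ofHom f.toRingHom) ≫ affPoint x y h =
      affPoint (f x) (f y) (equation_vec_map f h) := by
  rw [affPoint, SpecMap_ringPoint, affPoint]
  congr 1
  ext k
  fin_cases k
  exacts [rfl, rfl, map_one f]

lemma affPoint_injective {A : Type} [CommRing A] [Algebra F A] {x y x' y' : A}
    {h : (W.baseChange A).toProjective.Equation ![x, y, 1]}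
    {h' : (W.baseChange A).toProjective.Equation ![x', y', 1]}
    (he : affPoint x y h = affPoint x' y' h') : x = x' ∧ y = y' := by
  have key := mul_eq_mul_of_ringPoint_eq h h' (isUnit_vec_two x y) (isUnit_vec_two x' y') he
  exact ⟨by simpa using key 0, by simpa using key 1⟩

lemma pointHom_some {L : Type} [Field L] [Algebra F L] {x y : L}
    (h : (W.baseChange L).toAffine.Nonsingular x y) :
    pointHom (.some x y h) =
      affPoint x y ((WeierstrassCurve.Projective.equation_some x y).mpr h.1) :=
  pointOfVec_eq_ringPoint _ _ _ (by simp)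

lemma pointHom_zero {L : Type} [Field L] [Algebra F L] :
    pointHom (W := W) (L := L) .zero =
      ringPoint ![0, 1, 0] WeierstrassCurve.Projective.equation_zero 1 isUnit_one :=
  pointOfVec_eq_ringPoint _ _ _ (by simp)

/-- If the functions on an affine scheme over `F` form a localization of the affine coordinate
ring, the corresponding point is an open immersion. -/
lemma isOpenImmersion_affPoint {A : Type} [CommRing A] [Algebra F A] (x y : A)
    (h : (W.baseChange A).toProjective.Equation ![x, y, 1]) (g : W.toAffine.CoordinateRing)
    (hloc : letI := (affHom x y h).toRingHom.toAlgebra; IsLocalization.Away g A) :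
    IsOpenImmersion (affPoint x y h) := by
  let _ := (affHom x y h).toRingHom.toAlgebra
  have : IsOpenImmersion (Spec.map (CommRingCat.ofHom (affHom x y h).toRingHom)) :=
    IsOpenImmersion.of_isLocalization (S := A) g
  rw [affPoint_eq]
  infer_instance

end Affine

/-! ### The two-isogeny on points -/

section Isogeny

open WeierstrassCurve.Affine.Point

variable {L : Type} [Field L]

/-- `W` is the curve `y² = x (x² + a x + b)`. -/
structure HasTwoTorsion (W : WeierstrassCurve.Affine L) (a b : L) : Prop where
  a₁ : W.a₁ = 0
  a₂ : W.a₂ = a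
  a₃ : W.a₃ = 0
  a₄ : W.a₄ = b
  a₆ : W.a₆ = 0

variable {W W' : WeierstrassCurve.Affine L} {a b : L}

lemma some_congr {x y x' y' : L} {h : W.Nonsingular x y}
    {h' : W.Nonsingular x' y'} (hx : x = x') (hy : y = y') : some x y h = some x' y' h' := by
  subst hx hy
  rfl

namespace HasTwoTorsion

lemma equation_iff (hW : HasTwoTorsion W a b) {x y : L} :
    W.Equation x y ↔ y ^ 2 = x ^ 3 + a * x ^ 2 + b * x := by
  rw [WeierstrassCurve.Affine.equation_iff, hW.a₁, hW.a₂, hW.a₃, hW.a₄, hW.a₆]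
  simp

lemma negY (hW : HasTwoTorsion W a b) (x y : L) : W.negY x y = -y := by
  simp [WeierstrassCurve.Affine.negY, hW.a₁, hW.a₃]

lemma Δ (hW : HasTwoTorsion W a b) : W.Δ = 16 * b ^ 2 * (a ^ 2 - 4 * b) := by
  simp only [WeierstrassCurve.Δ, WeierstrassCurve.b₂, WeierstrassCurve.b₄, WeierstrassCurve.b₆,
    WeierstrassCurve.b₈, hW.a₁, hW.a₂, hW.a₃, hW.a₄, hW.a₆]
  ring

variable [DecidableEq L]

/-- Points adding up to an affine point lie on a line, and the line meets the curve exactly in the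
three points in question. -/
lemma exists_line (hW : HasTwoTorsion W a b) {x₁ y₁ x₂ y₂ x₃ y₃ : L} {h₁ : W.Nonsingular x₁ y₁}
    {h₂ : W.Nonsingular x₂ y₂} {h₃ : W.Nonsingular x₃ y₃}
    (h : some x₁ y₁ h₁ + some x₂ y₂ h₂ = some x₃ y₃ h₃) :
    ∃ m c, y₁ = m * x₁ + c ∧ y₂ = m * x₂ + c ∧ -y₃ = m * x₃ + c ∧
      x₁ + x₂ + x₃ = m ^ 2 - a ∧ x₁ * x₂ + x₁ * x₃ + x₂ * x₃ = b - 2 * m * c ∧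
      x₁ * x₂ * x₃ = c ^ 2 := by
  have hxy : ¬(x₁ = x₂ ∧ y₁ = W.negY x₂ y₂) := fun h' ↦ by
    rw [add_of_Y_eq h'.1 h'.2] at h
    exact some_ne_zero h₃ h.symm
  have hpoly := addPolynomial_slope h₁.1 h₂.1 hxy
  rw [add_some hxy] at h
  set m := W.slope x₁ x₂ y₁ y₂ with hm
  simp only [Point.some.injEq] at h
  obtain ⟨hx₃, hy₃⟩ := h
  rw [hx₃, addPolynomial_eq, neg_inj, Cubic.prod_X_sub_C_eq, Cubic.toPoly_injective] at hpoly
  simp only [Cubic.mk.injEq, hW.a₁, hW.a₂, hW.a₃, hW.a₄, hW.a₆] at hpoly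
  obtain ⟨-, hb, hc, hd⟩ := hpoly
  have e₁ := hW.equation_iff.mp h₁.1
  have e₂ := hW.equation_iff.mp h₂.1
  rw [addY, hW.negY, negAddY, hx₃] at hy₃
  have hy₂ : y₂ = m * x₂ + (y₁ - m * x₁) := by
    by_cases hx : x₁ = x₂
    · have := Y_eq_of_Y_ne h₁.1 h₂.1 hx fun hy ↦ hxy ⟨hx, hy⟩
      subst hx this
      ring
    · rw [hm, slope_of_X_ne hx]
      have := sub_ne_zero.mpr hx
      field_simp
      ring
  refine ⟨m, y₁ - m * x₁, by ring, hy₂, ?_, ?_, ?_, ?_⟩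
  · linear_combination hy₃
  · linear_combination hb
  · linear_combination -hc
  · linear_combination hd

/-- If a line meets the curve exactly in three given points, these add up to zero. -/
lemma add_eq_of_line (hW : HasTwoTorsion W a b) {x₁ y₁ x₂ y₂ x₃ y₃ : L} {h₁ : W.Nonsingular x₁ y₁}
    {h₂ : W.Nonsingular x₂ y₂} {h₃ : W.Nonsingular x₃ y₃} (h2 : (2 : L) ≠ 0) {m c : L}
    (hy₁ : y₁ = m * x₁ + c) (hy₂ : y₂ = m * x₂ + c) (hy₃ : -y₃ = m * x₃ + c)
    (hs₁ : x₁ + x₂ + x₃ = m ^ 2 - a) (hs₂ : x₁ * x₂ + x₁ * x₃ + x₂ * x₃ = b - 2 * m * c) :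
    some x₁ y₁ h₁ + some x₂ y₂ h₂ = some x₃ y₃ h₃ := by
  have key : ¬(x₁ = x₂ ∧ y₁ = W.negY x₂ y₂) ∧ W.slope x₁ x₂ y₁ y₂ = m := by
    by_cases hx : x₁ = x₂
    · subst hx
      have hy : y₁ = y₂ := hy₁.trans hy₂.symm
      subst hy
      have htan : 3 * x₁ ^ 2 + 2 * a * x₁ + b = m * (2 * y₁) := by
        linear_combination (2 * x₁) * hs₁ - hs₂ - 2 * m * hy₁
      have hy : y₁ ≠ -y₁ := by
        intro hy
        have hy0 : y₁ = 0 := by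
          have : 2 * y₁ = 0 := by linear_combination hy
          exact (mul_eq_zero.mp this).resolve_left h2
        have hns := (WeierstrassCurve.Affine.nonsingular_iff' x₁ y₁).mp h₁
        rw [hW.a₁, hW.a₂, hW.a₃, hW.a₄] at hns
        rcases hns.2 with h | h
        · refine h ?_
          linear_combination -htan - (2 * m) * hy0
        · refine h ?_
          linear_combination 2 * hy0
      refine ⟨fun h ↦ hy (by rw [← hW.negY x₁]; exact h.2), ?_⟩
      rw [slope_of_Y_ne rfl (by rwa [hW.negY]), hW.negY, hW.a₁, hW.a₂, hW.a₄, div_eq_iff]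
      · linear_combination htan
      · exact fun h ↦ hy (by linear_combination h)
    · refine ⟨fun h ↦ hx h.1, ?_⟩
      rw [slope_of_X_ne hx, div_eq_iff (sub_ne_zero.mpr hx)]
      linear_combination hy₁ - hy₂
  have hX : W.addX x₁ x₂ (W.slope x₁ x₂ y₁ y₂) = x₃ := by
    rw [key.2, addX, hW.a₁, hW.a₂]
    linear_combination -hs₁
  rw [add_some key.1]
  refine some_congr hX ?_
  rw [addY, hW.negY, negAddY, hX, key.2]
  linear_combination hy₃ - hy₁

end HasTwoTorsion

/-- The curves `W : y² = x (x² + a x + b)` and `W' : v² = u (u² - (a / 2) u + (a² - 4 b) / 16)`,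
which are related by a two-isogeny with kernel generated by `(0, 0)`. -/
structure IsTwoIsogenous (W W' : WeierstrassCurve.Affine L) (a b : L) : Prop where
  left : HasTwoTorsion W a b
  right : HasTwoTorsion W' (-a / 2) ((a ^ 2 - 4 * b) / 16)
  two_ne_zero : (2 : L) ≠ 0
  b_ne_zero : b ≠ 0
  disc_ne_zero : a ^ 2 - 4 * b ≠ 0

namespace IsTwoIsogenous

lemma nonsingular_zero (H : IsTwoIsogenous W W' a b) : W.Nonsingular 0 0 := by
  rw [WeierstrassCurve.Affine.nonsingular_zero, H.left.a₆, H.left.a₄]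
  exact ⟨rfl, .inr H.b_ne_zero⟩

lemma nonsingular (H : IsTwoIsogenous W W' a b) {x y : L} (h : W.Equation x y) (hx : x ≠ 0) :
    W'.Nonsingular (y ^ 2 / (4 * x ^ 2)) (y * (b - x ^ 2) / (8 * x ^ 2)) := by
  have h2 := H.two_ne_zero
  have h8 : (8 : L) ≠ 0 := by
    rw [show (8 : L) = 2 ^ 3 by norm_num]; exact pow_ne_zero _ h2
  have h4 : (4 : L) ≠ 0 := by
    rw [show (4 : L) = 2 ^ 2 by norm_num]; exact pow_ne_zero _ h2
  have h16 : (16 : L) ≠ 0 := by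
    rw [show (16 : L) = 2 ^ 4 by norm_num]; exact pow_ne_zero _ h2
  refine (WeierstrassCurve.Affine.equation_iff_nonsingular_of_Δ_ne_zero ?_).mp ?_
  · rw [H.right.Δ]
    have h : 16 * ((a ^ 2 - 4 * b) / 16) ^ 2 * ((-a / 2) ^ 2 - 4 * ((a ^ 2 - 4 * b) / 16)) =
        (a ^ 2 - 4 * b) ^ 2 * b / 16 := by
      field_simp
      ring
    rw [h]
    exact div_ne_zero (mul_ne_zero (pow_ne_zero _ H.disc_ne_zero) H.b_ne_zero) h16
  · rw [H.right.equation_iff]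
    rw [H.left.equation_iff] at h
    field_simp
    linear_combination (-2048 * y ^ 2 * (y ^ 2 + (x ^ 3 + a * x ^ 2 + b * x) - 2 * a * x ^ 2)) * h

/-- The two-isogeny on points: the point `(0, 0)`, which is the only one with `x = 0`, and the
point at infinity go to zero. -/
def map (H : IsTwoIsogenous W W' a b) [DecidableEq L] : W.Point → W'.Point
  | .zero => 0
  | .some x y h => if hx : x = 0 then 0 else
    some (y ^ 2 / (4 * x ^ 2)) (y * (b - x ^ 2) / (8 * x ^ 2)) (H.nonsingular h.1 hx)

variable [DecidableEq L] (H : IsTwoIsogenous W W' a b)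

lemma map_zero : H.map 0 = 0 := rfl

lemma map_some {x y : L} (h : W.Nonsingular x y) (hx : x ≠ 0) :
    H.map (some x y h) = some _ _ (H.nonsingular h.1 hx) := dif_neg hx

lemma map_some_zero {y : L} (h : W.Nonsingular 0 y) : H.map (some 0 y h) = 0 := dif_pos rfl

omit [DecidableEq L] in
include H in
lemma eq_zero_of_nonsingular_zero {y : L} (h : W.Nonsingular 0 y) : y = 0 := by
  have := H.left.equation_iff.mp h.1
  simpa using this

lemma map_neg (P : W.Point) : H.map (-P) = -H.map P := by
  rcases P with _ | ⟨x, y, h⟩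
  · rfl
  · by_cases hx : x = 0
    · subst hx
      rw [neg_some, map_some_zero, map_some_zero, _root_.neg_zero]
    · rw [neg_some, map_some H _ hx, map_some H _ hx, neg_some]
      refine some_congr ?_ ?_
      · rw [H.left.negY, neg_sq]
      · rw [H.left.negY, H.right.negY, neg_mul, neg_div]

/-- The isogeny is invariant under translation by `(0, 0)`. -/
lemma map_add_torsion (P : W.Point) : H.map (P + some 0 0 H.nonsingular_zero) = H.map P := by
  rcases P with _ | ⟨x, y, h⟩
  · rw [← zero_def, zero_add, map_some_zero, map_zero]
  · by_cases hx : x = 0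
    · subst hx
      have hy := H.eq_zero_of_nonsingular_zero h
      subst hy
      rw [add_self_of_Y_eq (by rw [H.left.negY, _root_.neg_zero]), map_some_zero, map_zero]
    · have he := H.left.equation_iff.mp h.1
      have hX : W.addX x 0 (W.slope x 0 y 0) = b / x := by
        rw [slope_of_X_ne hx, addX, H.left.a₁, H.left.a₂, sub_zero, sub_zero]
        field_simp
        linear_combination x * he
      have hb := H.b_ne_zero
      have h2 := H.two_ne_zero
      rw [add_of_X_ne hx, map_some H _ (by rw [hX]; exact div_ne_zero hb hx), map_some H _ hx]
      refine some_congr ?_ ?_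
      · rw [addY, H.left.negY, negAddY, hX, slope_of_X_ne hx]
        field_simp
        ring
      · rw [addY, H.left.negY, negAddY, hX, slope_of_X_ne hx]
        field_simp
        ring

/-- The isogeny is additive. Away from the kernel this is seen on lines: three points on the line
`y = m x + c` are mapped to three points on the line with slope `(b / c - m) / 2`. -/
lemma map_add (P Q : W.Point) : H.map (P + Q) = H.map P + H.map Q := by
  -- Translation by `(0, 0)` reduces the cases involving `x = 0` to the compatibility with negation.
  have htors (P : W.Point) (y : L) (h : W.Nonsingular 0 y) : H.map (P + some 0 y h) = H.map P := by
    have hy := H.eq_zero_of_nonsingular_zero h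
    subst hy
    exact H.map_add_torsion P
  rcases hP : P with _ | ⟨x₁, y₁, h₁⟩
  · rw [← zero_def, zero_add, map_zero, zero_add]
  rcases hQ : Q with _ | ⟨x₂, y₂, h₂⟩
  · rw [← zero_def, add_zero, map_zero, add_zero]
  by_cases hx₁ : x₁ = 0
  · subst hx₁
    rw [add_comm, htors, map_some_zero, zero_add]
  by_cases hx₂ : x₂ = 0
  · subst hx₂
    rw [htors, map_some_zero, add_zero]
  rcases hR : some x₁ y₁ h₁ + some x₂ y₂ h₂ with _ | ⟨x₃, y₃, h₃⟩
  · rw [← zero_def] at hR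
    rw [← zero_def, map_zero, eq_neg_of_add_eq_zero_left hR, map_neg, neg_add_cancel]
  by_cases hx₃ : x₃ = 0
  · subst hx₃
    have h : some x₁ y₁ h₁ = -some x₂ y₂ h₂ + some 0 y₃ h₃ := by rw [← hR]; abel
    rw [map_some_zero, h, htors, map_neg, neg_add_cancel]
  obtain ⟨m, c, hy₁, hy₂, hy₃, hs₁, hs₂, hs₃⟩ := H.left.exists_line hR
  have h2 := H.two_ne_zero
  have hc : c ≠ 0 := by
    rintro rfl
    simp [hx₁, hx₂, hx₃] at hs₃
  rw [map_some H _ hx₁, map_some H _ hx₂, map_some H _ hx₃]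
  -- In terms of `pᵢ = c / xᵢ` everything is polynomial: the `xᵢ` are the roots of a cubic
  -- polynomial with constant term `-c²`, which gives the elementary symmetric functions of the
  -- `pᵢ`, and `xᵢ = pⱼ pₖ` and `yᵢ = (m + pᵢ) xᵢ` up to the sign of `y₃`.
  obtain ⟨p₁, hp₁⟩ : ∃ p, p * x₁ = c := ⟨c / x₁, div_mul_cancel₀ _ hx₁⟩
  obtain ⟨p₂, hp₂⟩ : ∃ p, p * x₂ = c := ⟨c / x₂, div_mul_cancel₀ _ hx₂⟩
  obtain ⟨p₃, hp₃⟩ : ∃ p, p * x₃ = c := ⟨c / x₃, div_mul_cancel₀ _ hx₃⟩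
  obtain ⟨β, hβ⟩ : ∃ β, b = β * c := ⟨b / c, (div_mul_cancel₀ _ hc).symm⟩
  have hx : x₁ * x₂ * x₃ ≠ 0 := by simp [hx₁, hx₂, hx₃]
  have e₃ : p₁ * p₂ * p₃ = c := by
    refine mul_right_cancel₀ hx ?_
    linear_combination (p₂ * x₂ * p₃ * x₃) * hp₁ + (c * p₃ * x₃) * hp₂ + c ^ 2 * hp₃ - c * hs₃
  have e₁ : p₁ + p₂ + p₃ = β - 2 * m := by
    refine mul_right_cancel₀ (mul_ne_zero hc hx) ?_
    linear_combination (c * x₂ * x₃) * hp₁ + (c * x₁ * x₃) * hp₂ + (c * x₁ * x₂) * hp₃ +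
      c ^ 2 * hs₂ + c ^ 2 * hβ - (c * β - 2 * m * c) * hs₃
  have e₂ : p₁ * p₂ + p₁ * p₃ + p₂ * p₃ = m ^ 2 - a := by
    refine mul_right_cancel₀ hx ?_
    linear_combination (x₃ * p₂ * x₂) * hp₁ + (c * x₃) * hp₂ + (x₂ * p₃ * x₃) * hp₁ +
      (c * x₂) * hp₃ + (x₁ * p₃ * x₃) * hp₂ + (c * x₁) * hp₃ + c ^ 2 * hs₁ - (m ^ 2 - a) * hs₃
  symm
  have h8 : (8 : L) ≠ 0 := by
    rw [show (8 : L) = 2 ^ 3 by norm_num]; exact pow_ne_zero _ h2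
  have h4 : (4 : L) ≠ 0 := by
    rw [show (4 : L) = 2 ^ 2 by norm_num]; exact pow_ne_zero _ h2
  have h16 : (16 : L) ≠ 0 := by
    rw [show (16 : L) = 2 ^ 4 by norm_num]; exact pow_ne_zero _ h2
  have hp : p₁ * p₂ * p₃ ≠ 0 := e₃ ▸ hc
  have hx₁' : x₁ = p₂ * p₃ := by
    refine mul_left_cancel₀ (left_ne_zero_of_mul (left_ne_zero_of_mul hp)) ?_
    rw [hp₁, ← e₃, mul_assoc]
  have hx₂' : x₂ = p₁ * p₃ := by
    refine mul_left_cancel₀ (right_ne_zero_of_mul (left_ne_zero_of_mul hp)) ?_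
    rw [hp₂, ← e₃]; ring
  have hx₃' : x₃ = p₁ * p₂ := by
    refine mul_left_cancel₀ (right_ne_zero_of_mul hp) ?_
    rw [hp₃, ← e₃]; ring
  obtain rfl : β = p₁ + p₂ + p₃ + 2 * m := by linear_combination -e₁
  obtain rfl : a = m ^ 2 - (p₁ * p₂ + p₁ * p₃ + p₂ * p₃) := by linear_combination e₂
  have hu {x y w : L} (hx : x ≠ 0) (hy : y = w * x) : y ^ 2 / (4 * x ^ 2) = w ^ 2 / 4 := by
    rw [hy]
    field_simp
  have hv {x y w p : L} (hx : x ≠ 0) (hy : y = w * x) (hpx : p * x = c) :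
      y * (b - x ^ 2) / (8 * x ^ 2) = w * ((p₁ + p₂ + p₃ + 2 * m) * p - x) / 8 := by
    rw [hy, hβ, ← hpx]
    field_simp
  have hy₁' : y₁ = (m + p₁) * x₁ := by linear_combination hy₁ - hp₁
  have hy₂' : y₂ = (m + p₂) * x₂ := by linear_combination hy₂ - hp₂
  have hy₃' : y₃ = -(m + p₃) * x₃ := by linear_combination -hy₃ + hp₃
  refine H.right.add_eq_of_line h2 (m := (p₁ + p₂ + p₃ + m) / 2)
    (c := -(m ^ 2 * (p₁ + p₂ + p₃ + 2 * m) + p₁ * p₂ * p₃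
      - m * (m ^ 2 - (p₁ * p₂ + p₁ * p₃ + p₂ * p₃))) / 8) ?_ ?_ ?_ ?_ ?_
  · rw [hu hx₁ hy₁', hv hx₁ hy₁' hp₁, hx₁']
    field_simp
    ring
  · rw [hu hx₂ hy₂', hv hx₂ hy₂' hp₂, hx₂']
    field_simp
    ring
  · rw [hu hx₃ hy₃', hv hx₃ hy₃' hp₃, hx₃']
    field_simp
    ring
  · rw [hu hx₁ hy₁', hu hx₂ hy₂', hu hx₃ hy₃']
    field_simp
    ring
  · rw [hu hx₁ hy₁', hu hx₂ hy₂', hu hx₃ hy₃', hβ, ← e₃]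
    field_simp
    ring

/-- The two-isogeny as a group homomorphism. -/
def hom : W.Point →+ W'.Point where
  toFun := H.map
  map_zero' := H.map_zero
  map_add' := H.map_add

lemma addOrderOf_torsion : addOrderOf (some 0 0 H.nonsingular_zero) = 2 := by
  refine addOrderOf_eq_prime ?_ (some_ne_zero _)
  rw [two_nsmul]
  exact add_self_of_Y_eq (by rw [H.left.negY, _root_.neg_zero])

lemma ker_hom : H.hom.ker = AddSubgroup.zmultiples (some 0 0 H.nonsingular_zero) := by
  refine le_antisymm (fun P hP ↦ ?_) ((AddSubgroup.zmultiples_le_of_mem ?_))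
  · rcases P with _ | ⟨x, y, h⟩
    · exact zero_mem _
    · by_cases hx : x = 0
      · subst hx
        have hy := H.eq_zero_of_nonsingular_zero h
        subst hy
        exact AddSubgroup.mem_zmultiples _
      · exact absurd ((H.map_some h hx).symm.trans hP) (some_ne_zero _)
  · exact H.map_some_zero H.nonsingular_zero

end IsTwoIsogenous

end Isogeny

/-! ### Coordinates on the affine models -/

section Coordinates

instance : CharZero K := charZero_of_injective_algebraMap (algebraMap ℂ K).injective

lemma lam_ne_zero : lam ≠ 0 := RatFunc.X_ne_zero

lemma lam_ne_one : lam ≠ 1 := by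
  rw [lam, ← RatFunc.algebraMap_X, ← map_one (algebraMap (Polynomial ℂ) K)]
  exact (RatFunc.algebraMap_injective ℂ).ne fun h ↦ by
    simpa using congrArg (Polynomial.eval 0) h

/-- The function `λ` on a scheme over `ℂ(λ)`. -/
abbrev lamA (A : Type) [CommRing A] [Algebra K A] : A := algebraMap K A lam

/-- The function `z₂` on `Y₁(2)`. -/
def z₂ : RingY₁ := Ideal.Quotient.mk idealY Coord.z₂

lemma cubic_z₁ : cubic a₁ b₁ z₁ = z₂ :=
  Ideal.Quotient.eq.mpr (Ideal.subset_span (.inl rfl))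

lemma Φ₂_z₁ : Φ₂ a₁ b₁ z₁ = 0 :=
  Ideal.Quotient.eq_zero_iff_mem.mpr (Ideal.subset_span (.inr (.inr (.inl rfl))))

lemma cubicDeriv_mul_cubicDeriv : cubicDeriv a₁ z₁ * cubicDeriv a₁ z₂ = lamA RingY₁ :=
  Ideal.Quotient.eq.mpr (Ideal.subset_span (.inr (.inr (.inr rfl))))

/-- Since `f(f(z)) - z = (f(f(z)) - f(z)) + (f(z) - z)`, the dynatomic polynomial is one plus the
divided difference of `f` at `f(z)` and `z`. -/
lemma Φ₂_eq {R : Type*} [CommRing R] (a b z : R) :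
    Φ₂ a b z = z ^ 2 + z * cubic a b z + cubic a b z ^ 2 + a + 1 := by
  simp only [Φ₂, cubic]; ring

lemma a₁_eq : a₁ = -(1 + z₁ ^ 2 + z₁ * z₂ + z₂ ^ 2) := by
  have h := Φ₂_z₁
  rw [Φ₂_eq, cubic_z₁] at h
  linear_combination h

lemma b₁_eq : b₁ = (z₁ + z₂) * (1 + z₁ * z₂) := by
  have h := cubic_z₁
  rw [cubic] at h
  linear_combination h - z₁ * a₁_eq

/-- In terms of `s = z₁ + z₂` and `t = z₁ - z₂`, the curve `Y₁(2)` is `(t² - 2)² - 9 s² t² = 4λ`. -/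
lemma curve_eq : ((z₁ - z₂) ^ 2 - 2) ^ 2 - 9 * (z₁ + z₂) ^ 2 * (z₁ - z₂) ^ 2 =
    4 * lamA RingY₁ := by
  have h := cubicDeriv_mul_cubicDeriv
  rw [cubicDeriv, cubicDeriv, a₁_eq] at h
  linear_combination 4 * h

/-- Elements satisfying the defining relations of `Y₁(2)`, in terms of `z₁` and `z₂`, define a
homomorphism from its coordinate ring. -/
lemma exists_hom_of_curve_eq {A : Type} [CommRing A] [Algebra K A] (x y : A)
    (h : ((x - y) ^ 2 - 2) ^ 2 - 9 * (x + y) ^ 2 * (x - y) ^ 2 = 4 * lamA A) :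
    ∃ g : RingY₁ →ₐ[K] A, g z₁ = x ∧ g z₂ = y := by
  have h4 : (4 : A) * algebraMap K A (1 / 4) = 1 := by
    rw [← map_ofNat (algebraMap K A), ← map_mul]
    norm_num
  let v : Fin 4 → A := ![-(1 + x ^ 2 + x * y + y ^ 2), (x + y) * (1 + x * y), x, y]
  have hv : ∀ p ∈ idealY, MvPolynomial.aeval (R := K) v p = 0 := by
    intro p hp
    rw [← AlgHom.coe_toRingHom, ← RingHom.mem_ker]
    refine (Ideal.span_le.mpr ?_) hp
    rintro p (rfl | rfl | rfl | rfl) <;>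
      simp only [SetLike.mem_coe, RingHom.mem_ker, AlgHom.coe_toRingHom, cubic, Φ₂, cubicDeriv,
        map_sub, map_add, map_mul, map_pow, map_one, map_ofNat, MvPolynomial.aeval_X,
        MvPolynomial.algHom_C, v, Matrix.cons_val]
    · ring
    · ring
    · ring
    · have hlam : 4 * algebraMap K A (1 / 4) * lamA A = lamA A := by rw [h4, one_mul]
      linear_combination (algebraMap K A (1 / 4)) * h + hlam -
        ((3 * x ^ 2 + -(1 + x ^ 2 + x * y + y ^ 2)) * (3 * y ^ 2 + -(1 + x ^ 2 + x * y + y ^ 2)))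
          * h4
  exact ⟨Ideal.Quotient.liftₐ idealY (MvPolynomial.aeval v) hv,
    MvPolynomial.aeval_X v 2, MvPolynomial.aeval_X v 3⟩

lemma ringY₁_hom_ext {A : Type} [CommRing A] [Algebra K A] {f g : RingY₁ →ₐ[K] A}
    (h₁ : f z₁ = g z₁) (h₂ : f z₂ = g z₂) : f = g := by
  refine Ideal.Quotient.algHom_ext _ (MvPolynomial.algHom_ext fun i ↦ ?_)
  fin_cases i
  · change f a₁ = g a₁
    rw [a₁_eq]
    simp [h₁, h₂]
  · change f b₁ = g b₁
    rw [b₁_eq]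
    simp [h₁, h₂]
  · exact h₁
  · exact h₂

lemma swapY₁_z₁ : swapY₁ z₁ = z₂ := by
  change Ideal.Quotient.mk idealY (swapCoord Coord.z₁) = Ideal.Quotient.mk idealY Coord.z₂
  simp [swapCoord, MvPolynomial.rename_X]

lemma swapY₁_z₂ : swapY₁ z₂ = z₁ := by
  change Ideal.Quotient.mk idealY (swapCoord Coord.z₂) = Ideal.Quotient.mk idealY Coord.z₁
  simp [swapCoord, MvPolynomial.rename_X]

/-- As `λ ≠ 1`, the two points of the cycle are distinct everywhere on `Y₁(2)`. -/
lemma isUnit_sub : IsUnit (z₁ - z₂) := by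
  have h : IsUnit (algebraMap K RingY₁ (4 * (lam - 1))) :=
    (isUnit_iff_ne_zero.mpr (mul_ne_zero (by norm_num) (sub_ne_zero.mpr lam_ne_one))).map _
  refine isUnit_of_dvd_unit ⟨(z₁ - z₂) * ((z₁ - z₂) ^ 2 - 4 - 9 * (z₁ + z₂) ^ 2), ?_⟩ h
  simp only [map_mul, map_sub, map_one, map_ofNat]
  linear_combination -curve_eq

/-- The coordinate `d` of `E₁` as a function on `Y₁(2)`. -/
def dFun : RingY₁ := 3 * (z₁ + z₂) * (z₁ - z₂) - (z₁ - z₂) ^ 2 + 2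

lemma dFun_mul : dFun * (2 - (z₁ - z₂) ^ 2 - 3 * (z₁ + z₂) * (z₁ - z₂)) = 4 * lamA RingY₁ := by
  rw [dFun]
  linear_combination curve_eq

/-- As `λ ≠ 0`, the function `d` vanishes nowhere on `Y₁(2)`. -/
lemma isUnit_dFun : IsUnit dFun := by
  have h : IsUnit (algebraMap K RingY₁ (4 * lam)) :=
    (isUnit_iff_ne_zero.mpr (mul_ne_zero (by norm_num) lam_ne_zero)).map _
  rw [map_mul, map_ofNat (algebraMap K RingY₁), ← dFun_mul] at h
  exact isUnit_of_mul_isUnit_left h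

variable {ρ : K} (hρ : ρ ^ 2 = -2)

variable (ρ) in
/-- The coordinate `e` of `E₁` as a function on `Y₁(2)`; here `ρ` is a square root of `-2`. -/
def eFun : RingY₁ := -algebraMap K RingY₁ ρ * dFun * (z₁ - z₂)

include hρ

lemma algebraMap_sq (A : Type) [CommRing A] [Algebra K A] : algebraMap K A ρ ^ 2 = -2 := by
  rw [← map_pow, hρ, map_neg, map_ofNat (algebraMap K A)]

lemma isUnit_eFun : IsUnit (eFun ρ) := by
  have h : ρ ≠ 0 := by
    rintro rfl
    norm_num at hρ
  exact (((isUnit_iff_ne_zero.mpr h).map (algebraMap K RingY₁)).neg.mul isUnit_dFun).mul isUnit_sub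

lemma eFun_sq : eFun ρ ^ 2 = dFun ^ 3 - 4 * dFun ^ 2 + 4 * lamA RingY₁ * dFun := by
  have h : dFun = 3 * (z₁ + z₂) * (z₁ - z₂) - (z₁ - z₂) ^ 2 + 2 := rfl
  rw [eFun]
  linear_combination (dFun ^ 2 * (z₁ - z₂) ^ 2) * algebraMap_sq hρ RingY₁ - dFun ^ 2 * h +
    dFun * dFun_mul

omit hρ in
lemma E₁_equation_iff {A : Type} [CommRing A] [Algebra K A] {x y : A} :
    (E₁.baseChange A).toProjective.Equation ![x, y, 1] ↔
      y ^ 2 = x ^ 3 - 4 * x ^ 2 + 4 * lamA A * x := by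
  rw [equation_iff_eval]
  simp only [E₁, map_zero, map_neg, map_mul, map_ofNat]
  constructor <;> intro h <;> linear_combination h

omit hρ in
lemma E₀_equation_iff {A : Type} [CommRing A] [Algebra K A] {x y : A} :
    (E₀.baseChange A).toProjective.Equation ![x, y, 1] ↔
      y ^ 2 = x ^ 3 + 2 * x ^ 2 + (1 - lamA A) * x := by
  rw [equation_iff_eval]
  simp only [E₀, map_zero, map_one, map_sub, map_ofNat]
  constructor <;> intro h <;> linear_combination h

lemma equation_de : (E₁.baseChange RingY₁).toProjective.Equation ![dFun, eFun ρ, 1] :=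
  E₁_equation_iff.mpr (eFun_sq hρ)

omit hρ in
/-- `z₁` in terms of `d` and `e`. -/
lemma six_mul_eFun_mul_z₁ : 6 * eFun ρ * z₁ =
    algebraMap K RingY₁ ρ * (dFun ^ 2 - 6 * dFun + 8 * lamA RingY₁) := by
  have h : dFun = 3 * (z₁ + z₂) * (z₁ - z₂) - (z₁ - z₂) ^ 2 + 2 := rfl
  rw [eFun]
  linear_combination (2 * algebraMap K RingY₁ ρ) * dFun_mul -
    (algebraMap K RingY₁ ρ * dFun) * h

omit hρ in
/-- `z₂` in terms of `d` and `e`. -/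
lemma six_mul_eFun_mul_z₂ : 6 * eFun ρ * z₂ =
    2 * algebraMap K RingY₁ ρ * (-dFun ^ 2 + 3 * dFun - 2 * lamA RingY₁) := by
  have h : dFun = 3 * (z₁ + z₂) * (z₁ - z₂) - (z₁ - z₂) ^ 2 + 2 := rfl
  rw [eFun]
  linear_combination -algebraMap K RingY₁ ρ * dFun_mul + 2 * algebraMap K RingY₁ ρ * dFun * h

/-- The functions `d` and `e` identify `Y₁(2)` with the open subscheme `e ≠ 0` of the affine part
of `E₁`: the formulas for `z₁` and `z₂` in terms of `d` and `e` define the inverse. -/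
lemma isLocalization_ringY₁ :
    letI := (affHom dFun (eFun ρ) (equation_de hρ)).toRingHom.toAlgebra
    IsLocalization.Away (affY E₁) RingY₁ := by
  let _ := (affHom dFun (eFun ρ) (equation_de hρ)).toRingHom.toAlgebra
  let M := Localization.Away (affY E₁)
  let ι : E₁.toAffine.CoordinateRing →ₐ[K] M := IsScalarTower.toAlgHom _ _ _
  set x : M := ι (affX E₁) with hx
  set y : M := ι (affY E₁) with hy
  obtain ⟨i, hi⟩ : ∃ i, y * i = 1 :=
    (IsLocalization.Away.algebraMap_isUnit (S := M) (affY E₁)).exists_right_inv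
  have hxy : y ^ 2 = x ^ 3 - 4 * x ^ 2 + 4 * lamA M * x := by
    have h := congrArg ι (E₁_equation_iff.mp (equation_affine E₁))
    simpa only [map_pow, map_add, map_sub, map_mul, map_ofNat, AlgHom.commutes] using h
  -- The inverse homomorphism `g` has `1 / (6 e)` as a denominator, which is `q i`.
  set q : M := algebraMap K M (1 / 6)
  have hq : 6 * q = 1 := by
    rw [← map_ofNat (algebraMap K M), ← map_mul]
    norm_num
  set ρ' : M := algebraMap K M ρ with hρ'_def
  have hρ' : ρ' ^ 2 = -2 := algebraMap_sq hρ M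
  set l := lamA M
  have hj : 36 * (q * i) ^ 2 * x * (x ^ 2 - 4 * x + 4 * l) = 1 := by
    linear_combination (-36 * q ^ 2 * i ^ 2) * hxy + (36 * q ^ 2 * (y * i + 1)) * hi +
      (6 * q + 1) * hq
  have ht : ρ' * (x ^ 2 - 6 * x + 8 * l) * (q * i) -
      2 * ρ' * (-x ^ 2 + 3 * x - 2 * l) * (q * i) =
      3 * ρ' * (q * i) * (x ^ 2 - 4 * x + 4 * l) := by ring
  have hs : ρ' * (x ^ 2 - 6 * x + 8 * l) * (q * i) +
      2 * ρ' * (-x ^ 2 + 3 * x - 2 * l) * (q * i) = ρ' * (q * i) * (4 * l - x ^ 2) := by ring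
  obtain ⟨g, hg₁, hg₂⟩ := exists_hom_of_curve_eq (ρ' * (x ^ 2 - 6 * x + 8 * l) * (q * i))
    (2 * ρ' * (-x ^ 2 + 3 * x - 2 * l) * (q * i)) (by
      rw [ht, hs]
      have h₁ : (3 * ρ' * (q * i) * (x ^ 2 - 4 * x + 4 * l)) ^ 2 =
          -18 * (q * i) ^ 2 * (x ^ 2 - 4 * x + 4 * l) ^ 2 := by
        linear_combination (9 * (q * i) ^ 2 * (x ^ 2 - 4 * x + 4 * l) ^ 2) * hρ'
      have h₂ : (ρ' * (q * i) * (4 * l - x ^ 2)) ^ 2 =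
          -2 * (q * i) ^ 2 * (4 * l - x ^ 2) ^ 2 := by
        linear_combination ((q * i) ^ 2 * (4 * l - x ^ 2) ^ 2) * hρ'
      rw [h₁, h₂]
      -- The coefficient arises by writing `2 = 4 w x` with `w = 18 j² (x² - 4x + 4l)`.
      generalize q * i = j at hj
      linear_combination (4 * l * (36 * j ^ 2 * (x ^ 2 - 4 * x + 4 * l) * x + 1) -
        4 * (18 * j ^ 2 * (x ^ 2 - 4 * x + 4 * l)) * (x ^ 2 - 4 * x + 4 * l + 4 * x) +
        4 * (36 * j ^ 2 * (x ^ 2 - 4 * x + 4 * l) * x - 1)) * hj)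
  have hgd : g dFun = x := by
    rw [dFun, map_add, map_sub, map_mul, map_mul, map_pow, map_sub, map_add, map_ofNat, map_ofNat,
      hg₁, hg₂, ht, hs]
    linear_combination (9 * (q * i) ^ 2 * (x ^ 2 - 4 * x + 4 * l) *
      (4 * l - x ^ 2 - (x ^ 2 - 4 * x + 4 * l))) * hρ' + (x - 2) * hj
  have hge : g (eFun ρ) = y := by
    rw [eFun, map_mul, map_mul, map_neg, AlgHom.commutes, hgd, map_sub, hg₁, hg₂, ht, ← hρ'_def]
    linear_combination (-3 * x * (q * i) * (x ^ 2 - 4 * x + 4 * l)) * hρ' - 6 * q * i * hxy +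
      6 * q * y * hi + y * hq
  have hgι : g.comp (affHom dFun (eFun ρ) (equation_de hρ)) = ι := by
    refine aff_hom_ext ?_ ?_
    · rw [AlgHom.comp_apply, affHom_affX, hgd]
    · rw [AlgHom.comp_apply, affHom_affY, hge]
  let ℓ : M →+* RingY₁ := IsLocalization.Away.lift (affY E₁)
    (g := algebraMap E₁.toAffine.CoordinateRing RingY₁) (by
      change IsUnit (affHom dFun (eFun ρ) (equation_de hρ) (affY E₁))
      rw [affHom_affY]
      exact isUnit_eFun hρ)
  have hℓ (p) : ℓ (algebraMap _ M p) = algebraMap _ _ p := IsLocalization.Away.lift_eq _ _ _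
  have hℓK (c : K) : ℓ (algebraMap K M c) = algebraMap K RingY₁ c := by
    rw [IsScalarTower.algebraMap_apply K E₁.toAffine.CoordinateRing M, hℓ]
    exact AlgHom.commutes (affHom dFun (eFun ρ) (equation_de hρ)) c
  have hℓx : ℓ x = dFun := (hℓ _).trans (affHom_affX _ _ (equation_de hρ))
  have hℓy : ℓ y = eFun ρ := (hℓ _).trans (affHom_affY _ _ (equation_de hρ))
  have hℓi : 6 * eFun ρ * ℓ (q * i) = 1 := by
    rw [← hℓy, ← map_ofNat ℓ 6, ← map_mul, ← map_mul, ← map_one ℓ]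
    congr 1
    linear_combination hq * y * i + hi
  have h₁ : (g : RingY₁ →+* M).comp ℓ = RingHom.id M := by
    refine IsLocalization.ringHom_ext (Submonoid.powers (affY E₁)) (RingHom.ext fun p ↦ ?_)
    simp only [RingHom.comp_apply, hℓ]
    exact DFunLike.congr_fun hgι p
  have h6e : IsUnit (6 * eFun ρ) := .of_mul_eq_one _ hℓi
  have h₂ : ℓ.comp (g : RingY₁ →+* M) = RingHom.id RingY₁ := by
    let ℓ' : M →ₐ[K] RingY₁ := { ℓ with commutes' := hℓK }
    refine congrArg AlgHom.toRingHom (a₁ := ℓ'.comp g) (a₂ := AlgHom.id K _) (ringY₁_hom_ext ?_ ?_)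
    · refine h6e.mul_left_cancel ?_
      change 6 * eFun ρ * ℓ (g z₁) = 6 * eFun ρ * z₁
      rw [hg₁, six_mul_eFun_mul_z₁, map_mul, mul_left_comm, hℓi]
      simp only [map_mul, map_add, map_sub, map_pow, map_ofNat, hℓx, mul_one, ρ', l, hℓK]
    · refine h6e.mul_left_cancel ?_
      change 6 * eFun ρ * ℓ (g z₂) = 6 * eFun ρ * z₂
      rw [hg₂, six_mul_eFun_mul_z₂, map_mul, mul_left_comm, hℓi]
      simp only [map_mul, map_add, map_sub, map_neg, map_pow, map_ofNat, hℓx, mul_one, ρ', l, hℓK]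
  exact IsLocalization.isLocalization_of_algEquiv (S := M) _
    (AlgEquiv.ofRingEquiv (f := RingEquiv.ofRingHom ℓ g h₂ h₁) hℓ)

end Coordinates

/-! ### The quotient curve -/

section Quotient

lemma isUnit_ofNat (A : Type) [CommRing A] [Algebra K A] (n : ℕ) [n.AtLeastTwo] :
    IsUnit (OfNat.ofNat n : A) := by
  rw [← map_ofNat (algebraMap K A) n]
  exact (isUnit_iff_ne_zero.mpr (OfNat.ofNat_ne_zero n)).map _

lemma subalgebra_eq_top_of_mem {T : Subalgebra K RingY₁} (h₁ : z₁ ∈ T) (h₂ : z₂ ∈ T) :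
    T = ⊤ := by
  refine eq_top_iff.mpr fun x _ ↦ ?_
  obtain ⟨p, rfl⟩ := Ideal.Quotient.mk_surjective x
  induction p using MvPolynomial.induction_on with
  | C c => exact T.algebraMap_mem c
  | add p q hp hq =>
    exact map_add (Ideal.Quotient.mk idealY) p q ▸ T.add_mem (hp trivial) (hq trivial)
  | mul_X p i hp =>
    rw [map_mul]
    refine T.mul_mem (hp trivial) ?_
    fin_cases i
    · change a₁ ∈ T
      rw [a₁_eq]
      exact T.neg_mem (T.add_mem (T.add_mem (T.add_mem T.one_mem (T.pow_mem h₁ 2))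
        (T.mul_mem h₁ h₂)) (T.pow_mem h₂ 2))
    · change b₁ ∈ T
      rw [b₁_eq]
      exact T.mul_mem (T.add_mem h₁ h₂) (T.add_mem T.one_mem (T.mul_mem h₁ h₂))
    · exact h₁
    · exact h₂

/-- The coordinate `u = -(z₁ - z₂)² / 2` of `E₀` as a function on `Y₀(2)`. -/
def uFun : RingY₀ := ⟨algebraMap K RingY₁ (-1 / 2) * (z₁ - z₂) ^ 2, by
  change swapY₁ _ = _
  rw [map_mul, map_pow, map_sub, AlgHom.commutes, swapY₁_z₁, swapY₁_z₂]
  simp only [AlgHom.coe_id, id_eq]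
  ring⟩

/-- The coordinate `v = 3 ρ (z₁ + z₂) (z₁ - z₂)² / 4` of `E₀` as a function on `Y₀(2)`; here `ρ`
is a square root of `-2`. -/
def vFun (ρ : K) : RingY₀ := ⟨algebraMap K RingY₁ (3 * ρ / 4) * (z₁ + z₂) * (z₁ - z₂) ^ 2, by
  change swapY₁ _ = _
  rw [map_mul, map_mul, map_pow, map_sub, map_add, AlgHom.commutes, swapY₁_z₁, swapY₁_z₂]
  simp only [AlgHom.coe_id, id_eq]
  ring⟩

lemma two_mul_uFun : 2 * (uFun : RingY₁) = -(z₁ - z₂) ^ 2 := by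
  change 2 * (algebraMap K RingY₁ (-1 / 2) * (z₁ - z₂) ^ 2) = _
  rw [← map_ofNat (algebraMap K RingY₁) 2, ← mul_assoc, ← map_mul,
    mul_div_cancel₀ _ (by norm_num), map_neg, map_one]
  ring

lemma four_mul_vFun (ρ : K) :
    4 * (vFun ρ : RingY₁) = 3 * algebraMap K RingY₁ ρ * (z₁ + z₂) * (z₁ - z₂) ^ 2 := by
  change 4 * (algebraMap K RingY₁ (3 * ρ / 4) * (z₁ + z₂) * (z₁ - z₂) ^ 2) = _
  rw [← map_ofNat (algebraMap K RingY₁) 4, ← mul_assoc, ← mul_assoc, ← map_mul,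
    mul_div_cancel₀ _ (by norm_num), map_mul, map_ofNat (algebraMap K RingY₁)]

variable {ρ : K} (hρ : ρ ^ 2 = -2)

section

include hρ

lemma equation_uv : (E₀.baseChange RingY₀).toProjective.Equation ![uFun, vFun ρ, 1] := by
  refine E₀_equation_iff.mpr (Subtype.ext ((isUnit_ofNat RingY₁ 16).mul_left_cancel ?_))
  change 16 * (vFun ρ : RingY₁) ^ 2 =
    16 * ((uFun : RingY₁) ^ 3 + 2 * (uFun : RingY₁) ^ 2 + (1 - lamA RingY₁) * (uFun : RingY₁))
  have h : 16 * (vFun ρ : RingY₁) ^ 2 = (4 * (vFun ρ : RingY₁)) ^ 2 := by ring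
  have h' : 16 * ((uFun : RingY₁) ^ 3 + 2 * (uFun : RingY₁) ^ 2 +
      (1 - lamA RingY₁) * (uFun : RingY₁)) = 2 * (2 * (uFun : RingY₁)) *
        ((2 * (uFun : RingY₁)) ^ 2 + 4 * (2 * (uFun : RingY₁)) + 4 * (1 - lamA RingY₁)) := by ring
  rw [h, h', four_mul_vFun, two_mul_uFun]
  linear_combination (9 * (z₁ + z₂) ^ 2 * (z₁ - z₂) ^ 4) * algebraMap_sq hρ RingY₁ +
    2 * (z₁ - z₂) ^ 2 * curve_eq

/-- The formula for the first coordinate of the isogeny. -/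
lemma uFun_mul : (uFun : RingY₁) * (4 * dFun ^ 2) = eFun ρ ^ 2 := by
  have h : (uFun : RingY₁) * (4 * dFun ^ 2) = 2 * (2 * (uFun : RingY₁)) * dFun ^ 2 := by ring
  rw [h, two_mul_uFun, eFun]
  linear_combination (-dFun ^ 2 * (z₁ - z₂) ^ 2) * algebraMap_sq hρ RingY₁

omit hρ in
/-- The formula for the second coordinate of the isogeny. -/
lemma vFun_mul : (vFun ρ : RingY₁) * (8 * dFun ^ 2) =
    eFun ρ * (4 * lamA RingY₁ - dFun ^ 2) := by
  have h : (vFun ρ : RingY₁) * (8 * dFun ^ 2) = 2 * (4 * (vFun ρ : RingY₁)) * dFun ^ 2 := by ring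
  have h' : dFun = 3 * (z₁ + z₂) * (z₁ - z₂) - (z₁ - z₂) ^ 2 + 2 := rfl
  rw [h, four_mul_vFun, eFun, ← dFun_mul]
  linear_combination (-algebraMap K RingY₁ ρ * dFun ^ 2 * (z₁ - z₂)) * h'

omit hρ in
/-- The function `a` in terms of `u`. -/
lemma a₁_mul : 6 * (uFun : RingY₁) * a₁ =
    4 * (uFun : RingY₁) ^ 2 - 4 * (uFun : RingY₁) + 1 - lamA RingY₁ := by
  refine (isUnit_ofNat RingY₁ 4).mul_left_cancel ?_
  have h : 4 * (6 * (uFun : RingY₁) * a₁) = 12 * (2 * (uFun : RingY₁)) * a₁ := by ring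
  have h' : 4 * (4 * (uFun : RingY₁) ^ 2 - 4 * (uFun : RingY₁) + 1 - lamA RingY₁) =
      4 * ((2 * (uFun : RingY₁)) ^ 2 - 2 * (2 * (uFun : RingY₁)) + 1) - 4 * lamA RingY₁ := by ring
  rw [h, h', two_mul_uFun, a₁_eq]
  linear_combination -curve_eq

/-- The function `b` in terms of `u` and `v`. -/
lemma b₁_mul : 54 * (uFun : RingY₁) ^ 2 * b₁ = algebraMap K RingY₁ ρ *
    (8 * (uFun : RingY₁) ^ 2 + 16 * (uFun : RingY₁) + lamA RingY₁ - 1) * (vFun ρ : RingY₁) := by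
  refine (isUnit_ofNat RingY₁ 16).mul_left_cancel ?_
  have h : 16 * (54 * (uFun : RingY₁) ^ 2 * b₁) = 216 * (2 * (uFun : RingY₁)) ^ 2 * b₁ := by ring
  have h' : 16 * (algebraMap K RingY₁ ρ * (8 * (uFun : RingY₁) ^ 2 + 16 * (uFun : RingY₁) +
      lamA RingY₁ - 1) * (vFun ρ : RingY₁)) = algebraMap K RingY₁ ρ *
        (4 * (2 * (2 * (uFun : RingY₁)) ^ 2 + 8 * (2 * (uFun : RingY₁)) - 1) + 4 * lamA RingY₁) *
        (4 * (vFun ρ : RingY₁)) := by ring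
  rw [h, h', two_mul_uFun, four_mul_vFun, b₁_eq]
  linear_combination (-3 * (z₁ + z₂) * (z₁ - z₂) ^ 2 *
    (8 * (z₁ - z₂) ^ 4 - 32 * (z₁ - z₂) ^ 2 - 4 + 4 * lamA RingY₁)) * algebraMap_sq hρ RingY₁
    - 6 * (z₁ + z₂) * (z₁ - z₂) ^ 2 * curve_eq

omit hρ in
lemma isUnit_uFun : IsUnit uFun := by
  have h : IsUnit (uFun : RingY₁) :=
    ((isUnit_iff_ne_zero.mpr (by norm_num)).map _).mul (isUnit_sub.pow 2)
  obtain ⟨w, hw⟩ := h.exists_right_inv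
  have hsw : swapY₁ w = w := by
    refine h.mul_left_cancel ?_
    have h' := congrArg swapY₁ hw
    rwa [map_mul, map_one, show swapY₁ (uFun : RingY₁) = uFun from uFun.2, ← hw] at h'
  exact .of_mul_eq_one ⟨w, hsw⟩ (Subtype.ext hw)

omit hρ in
/-- If `e` were zero, the cubic equation would make `d` algebraic. -/
lemma affY_E₁_ne_zero : affY E₁ ≠ 0 := by
  intro h
  have heq := E₁_equation_iff.mp (equation_affine E₁)
  rw [h] at heq
  refine transcendental_affX (W := E₁) (IsIntegral.isAlgebraic
    ⟨Polynomial.X ^ 3 - Polynomial.C 4 * Polynomial.X ^ 2 + Polynomial.C (4 * lam) * Polynomial.X,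
      by monicity!, ?_⟩)
  simp only [Polynomial.eval₂_add, Polynomial.eval₂_sub, Polynomial.eval₂_mul,
    Polynomial.eval₂_pow, Polynomial.eval₂_X, Polynomial.eval₂_C, map_mul,
    map_ofNat (algebraMap K E₁.toAffine.CoordinateRing)]
  linear_combination -heq

lemma isDomain_and_transcendental : IsDomain RingY₁ ∧ Transcendental K dFun := by
  let _ := (affHom dFun (eFun ρ) (equation_de hρ)).toRingHom.toAlgebra
  have hloc : IsLocalization.Away (affY E₁) RingY₁ := isLocalization_ringY₁ hρ
  have hle : Submonoid.powers (affY E₁) ≤ nonZeroDivisors E₁.toAffine.CoordinateRing :=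
    powers_le_nonZeroDivisors_of_noZeroDivisors affY_E₁_ne_zero
  have hinj : Function.Injective (affHom dFun (eFun ρ) (equation_de hρ)) :=
    IsLocalization.injective RingY₁ hle
  refine ⟨IsLocalization.isDomain_of_le_nonZeroDivisors _ hle, ?_⟩
  rw [← affHom_affX dFun (eFun ρ) (equation_de hρ), Transcendental, isAlgebraic_algHom_iff _ hinj]
  exact transcendental_affX

/-- Since `d² - 4 d + 4 λ = 4 d u`, the function `d` would be algebraic if `u` were. -/
lemma transcendental_uFun : Transcendental K uFun := by
  obtain ⟨_, hd⟩ := isDomain_and_transcendental hρ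
  intro hu
  refine hd (IsIntegral.isAlgebraic ?_)
  have hu' : IsIntegral K (uFun : RingY₁) := (hu.isIntegral).map RingY₀.val
  have hu₂ : (uFun : RingY₁) ∈ integralClosure K RingY₁ := hu'
  have h : dFun ^ 2 - (4 + 4 * (uFun : RingY₁)) * dFun + 4 * lamA RingY₁ = 0 := by
    refine isUnit_dFun.mul_left_cancel ?_
    linear_combination -uFun_mul hρ - eFun_sq hρ
  refine isIntegral_trans (A := integralClosure K RingY₁) dFun
    ⟨Polynomial.X ^ 2 - Polynomial.C (4 + 4 * ⟨_, hu₂⟩) * Polynomial.X +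
      Polynomial.C (4 * algebraMap K _ lam), by monicity!, ?_⟩
  simp only [Polynomial.eval₂_add, Polynomial.eval₂_sub, Polynomial.eval₂_mul,
    Polynomial.eval₂_pow, Polynomial.eval₂_X, Polynomial.eval₂_C]
  exact h

/-- The functions `u` and `v` identify `Y₀(2)` with the open subscheme `u ≠ 0` of the affine part
of `E₀`: they are algebraically as independent as on `E₀`, and together with `1 / u` they generate
the functions invariant under the exchange of `z₁` and `z₂`. -/
lemma isLocalization_ringY₀ :
    letI := (affHom uFun (vFun ρ) (equation_uv hρ)).toRingHom.toAlgebra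
    IsLocalization.Away (affX E₀) RingY₀ := by
  obtain ⟨_, hd⟩ := isDomain_and_transcendental hρ
  let _ := (affHom uFun (vFun ρ) (equation_uv hρ)).toRingHom.toAlgebra
  let M := Localization.Away (affX E₀)
  let ℓ : M →+* RingY₀ := IsLocalization.Away.lift (affX E₀)
    (g := algebraMap E₀.toAffine.CoordinateRing RingY₀) (by
      change IsUnit (affHom uFun (vFun ρ) (equation_uv hρ) (affX E₀))
      rw [affHom_affX]
      exact isUnit_uFun)
  have hℓ (p) : ℓ (algebraMap _ M p) = algebraMap _ _ p := IsLocalization.Away.lift_eq _ _ _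
  have hℓK (c : K) : ℓ (algebraMap K M c) = algebraMap K RingY₀ c := by
    rw [IsScalarTower.algebraMap_apply K E₀.toAffine.CoordinateRing M, hℓ]
    exact AlgHom.commutes (affHom uFun (vFun ρ) (equation_uv hρ)) c
  let ℓ' : M →ₐ[K] RingY₀ := { ℓ with commutes' := hℓK }
  have hinj₀ : Function.Injective (affHom uFun (vFun ρ) (equation_uv hρ)) := by
    refine affHom_injective _ ?_
    rw [affHom_affX]
    exact transcendental_uFun hρ
  have hX : affX E₀ ≠ 0 := fun h ↦
    transcendental_affX (W := E₀) (h ▸ isAlgebraic_zero)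
  have hinj : Function.Injective ℓ := by
    refine (IsLocalization.lift_injective_iff _).mpr fun x y ↦ ?_
    exact (IsLocalization.injective M (powers_le_nonZeroDivisors_of_noZeroDivisors hX)).eq_iff.trans
      (hinj₀.eq_iff (a := x) (b := y)).symm
  let B := (RingY₀.val.comp ℓ').range
  have hu : (uFun : RingY₁) ∈ B := ⟨algebraMap _ M (affX E₀), congrArg Subtype.val
    ((hℓ _).trans (affHom_affX _ _ (equation_uv hρ)))⟩
  have hv : (vFun ρ : RingY₁) ∈ B := ⟨algebraMap _ M (affY E₀), congrArg Subtype.val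
    ((hℓ _).trans (affHom_affY _ _ (equation_uv hρ)))⟩
  obtain ⟨w, hwB, hw⟩ : ∃ w ∈ B, (uFun : RingY₁) * w = 1 := by
    obtain ⟨i, hi⟩ := (IsLocalization.Away.algebraMap_isUnit (S := M) (affX E₀)).exists_right_inv
    refine ⟨_, ⟨i, rfl⟩, ?_⟩
    have h := congrArg (RingY₀.val.comp ℓ') hi
    rw [map_mul, map_one] at h
    rw [← h]
    congr 1
    exact (congrArg Subtype.val ((hℓ _).trans (affHom_affX _ _ (equation_uv hρ)))).symm
  have hK (c : K) : algebraMap K RingY₁ c ∈ B := B.algebraMap_mem c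
  have hs : z₁ + z₂ ∈ B := by
    have h : z₁ + z₂ = algebraMap K RingY₁ (ρ / 3) * vFun ρ * w := by
      have h3 : 3 * algebraMap K RingY₁ (ρ / 3) = algebraMap K RingY₁ ρ := by
        rw [← map_ofNat (algebraMap K RingY₁) 3, ← map_mul, mul_div_cancel₀ _ (by norm_num)]
      refine (isUnit_ofNat RingY₁ 12).mul_left_cancel ?_
      linear_combination (-12 * (z₁ + z₂)) * hw + (6 * (z₁ + z₂) * w) * two_mul_uFun -
        (4 * vFun ρ * w) * h3 - algebraMap K RingY₁ ρ * w * four_mul_vFun ρ -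
        (3 * (z₁ + z₂) * (z₁ - z₂) ^ 2 * w) * algebraMap_sq hρ RingY₁
    rw [h]
    exact B.mul_mem (B.mul_mem (hK _) hv) hwB
  have ht : (z₁ - z₂) ^ 2 ∈ B := by
    have h : (z₁ - z₂) ^ 2 = algebraMap K RingY₁ (-2) * uFun := by
      rw [map_neg, map_ofNat (algebraMap K RingY₁)]
      linear_combination two_mul_uFun
    rw [h]
    exact B.mul_mem (hK _) hu
  -- Every function on `Y₁(2)` is of the form `p + q (z₁ - z₂)` with `p` and `q` in `B`.
  let T : Subalgebra K RingY₁ :=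
    { carrier := {x | ∃ p ∈ B, ∃ q ∈ B, x = p + q * (z₁ - z₂)}
      mul_mem' := by
        rintro _ _ ⟨p, hp, q, hq, rfl⟩ ⟨p', hp', q', hq', rfl⟩
        exact ⟨p * p' + q * q' * (z₁ - z₂) ^ 2,
          B.add_mem (B.mul_mem hp hp') (B.mul_mem (B.mul_mem hq hq') ht), p * q' + q * p',
          B.add_mem (B.mul_mem hp hq') (B.mul_mem hq hp'), by ring⟩
      add_mem' := by
        rintro _ _ ⟨p, hp, q, hq, rfl⟩ ⟨p', hp', q', hq', rfl⟩
        exact ⟨p + p', B.add_mem hp hp', q + q', B.add_mem hq hq', by ring⟩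
      algebraMap_mem' := fun c ↦ ⟨_, hK c, 0, B.zero_mem, by ring⟩ }
  have hhalf : 2 * algebraMap K RingY₁ (1 / 2) = 1 := by
    rw [← map_ofNat (algebraMap K RingY₁) 2, ← map_mul]
    norm_num
  have hT : T = ⊤ := subalgebra_eq_top_of_mem
    ⟨_, B.mul_mem (hK (1 / 2)) hs, _, hK (1 / 2), by linear_combination -z₁ * hhalf⟩
    ⟨_, B.mul_mem (hK (1 / 2)) hs, -algebraMap K RingY₁ (1 / 2), B.neg_mem (hK _),
      by linear_combination -z₂ * hhalf⟩
  have hsurj : Function.Surjective ℓ := by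
    intro x
    obtain ⟨p, hp, q, hq, hx⟩ : (x : RingY₁) ∈ T := hT ▸ Algebra.mem_top
    have hBinv {y : RingY₁} (hy : y ∈ B) : swapY₁ y = y := by
      obtain ⟨m, rfl⟩ := hy
      exact (ℓ m).2
    have hx' : swapY₁ (x : RingY₁) = x := x.2
    -- The exchange maps `p + q (z₁ - z₂)` to `p - q (z₁ - z₂)`.
    rw [hx, map_add, map_mul, map_sub, swapY₁_z₁, swapY₁_z₂, hBinv hp, hBinv hq] at hx'
    have hq0 : 2 * (q * (z₁ - z₂)) = 0 := by linear_combination -hx'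
    have hq0' : q * (z₁ - z₂) = 0 := (isUnit_ofNat RingY₁ 2).mul_left_cancel (by rw [hq0, mul_zero])
    rw [hq0', add_zero] at hx
    obtain ⟨m, hm⟩ := hp
    exact ⟨m, Subtype.ext (hm.trans hx.symm)⟩
  exact IsLocalization.isLocalization_of_algEquiv (S := M) _
    (AlgEquiv.ofRingEquiv (f := RingEquiv.ofBijective ℓ ⟨hinj, hsurj⟩) hℓ)

end

end Quotient

/-! ### The isogeny as a morphism -/

section IsogenyMorphism

variable {ρ : K} (hρ : ρ ^ 2 = -2)

/-- The open immersion of `Y₁(2)` in `E₁` given by the functions `d` and `e`. -/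
def toE₁ : Y₁.left ⟶ (weierstrassScheme E₁).left := affPoint dFun (eFun ρ) (equation_de hρ)

/-- The open immersion of `Y₀(2)` in `E₀` given by the functions `u` and `v`. -/
def toE₀ : Y₀.left ⟶ (weierstrassScheme E₀).left := affPoint uFun (vFun ρ) (equation_uv hρ)

instance : IsOpenImmersion (toE₁ hρ) :=
  isOpenImmersion_affPoint _ _ _ (affY E₁) (isLocalization_ringY₁ hρ)

instance : IsOpenImmersion (toE₀ hρ) :=
  isOpenImmersion_affPoint _ _ _ (affX E₀) (isLocalization_ringY₀ hρ)

lemma toE₁_comp_hom : toE₁ hρ ≫ (weierstrassScheme E₁).hom = Y₁.hom := affPoint_comp_hom ..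

lemma toE₀_comp_hom : toE₀ hρ ≫ (weierstrassScheme E₀).hom = Y₀.hom := affPoint_comp_hom ..

lemma E₁_equation_vec_iff {A : Type} [CommRing A] [Algebra K A] {v : Fin 3 → A} :
    (E₁.baseChange A).toProjective.Equation v ↔
      v 1 ^ 2 * v 2 = v 0 ^ 3 - 4 * v 0 ^ 2 * v 2 + 4 * lamA A * v 0 * v 2 ^ 2 := by
  rw [WeierstrassCurve.Projective.equation_iff]
  change v 1 ^ 2 * v 2 + algebraMap K A 0 * v 0 * v 1 * v 2 + algebraMap K A 0 * v 1 * v 2 ^ 2 -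
    (v 0 ^ 3 + algebraMap K A (-4) * v 0 ^ 2 * v 2 + algebraMap K A (4 * lam) * v 0 * v 2 ^ 2 +
      algebraMap K A 0 * v 2 ^ 3) = 0 ↔ _
  simp only [map_zero, map_neg, map_mul, map_ofNat]
  constructor <;> intro h <;> linear_combination h

lemma E₀_equation_vec_iff {A : Type} [CommRing A] [Algebra K A] {v : Fin 3 → A} :
    (E₀.baseChange A).toProjective.Equation v ↔
      v 1 ^ 2 * v 2 = v 0 ^ 3 + 2 * v 0 ^ 2 * v 2 + (1 - lamA A) * v 0 * v 2 ^ 2 := by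
  rw [WeierstrassCurve.Projective.equation_iff]
  change v 1 ^ 2 * v 2 + algebraMap K A 0 * v 0 * v 1 * v 2 + algebraMap K A 0 * v 1 * v 2 ^ 2 -
    (v 0 ^ 3 + algebraMap K A 2 * v 0 ^ 2 * v 2 + algebraMap K A (1 - lam) * v 0 * v 2 ^ 2 +
      algebraMap K A 0 * v 2 ^ 3) = 0 ↔ _
  simp only [map_zero, map_one, map_sub, map_ofNat]
  constructor <;> intro h <;> linear_combination h

variable {ψ : (weierstrassScheme E₁).left ⟶ (weierstrassScheme E₀).left}
  (hψ : toE₁ hρ ≫ ψ = quotientMap.left ≫ toE₀ hρ)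

include hρ in
/-- A point `(x, y)` of `E₁` over a field with `y ≠ 0` is a point of `Y₁(2)`. -/
lemma exists_hom_of_ne_zero {L : Type} [Field L] [Algebra K L] {x y : L}
    (h : (E₁.baseChange L).toProjective.Equation ![x, y, 1]) (hy : y ≠ 0) :
    ∃ φ : RingY₁ →ₐ[K] L, φ dFun = x ∧ φ (eFun ρ) = y := by
  let _ := (affHom dFun (eFun ρ) (equation_de hρ)).toRingHom.toAlgebra
  have hloc : IsLocalization.Away (affY E₁) RingY₁ := isLocalization_ringY₁ hρ
  let φ : RingY₁ →+* L := IsLocalization.Away.lift (affY E₁) (g := (affHom x y h).toRingHom) (by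
    change IsUnit (affHom x y h (affY E₁))
    rw [affHom_affY]
    exact hy.isUnit)
  have hφ (p) : φ (affHom dFun (eFun ρ) (equation_de hρ) p) = affHom x y h p :=
    IsLocalization.Away.lift_eq _ _ _
  refine ⟨{ φ with
    commutes' := fun c ↦ by
      have := hφ (algebraMap K _ c)
      rwa [AlgHom.commutes, AlgHom.commutes] at this }, ?_, ?_⟩
  · have := hφ (affX E₁)
    rwa [affHom_affX, affHom_affX] at this
  · have := hφ (affY E₁)
    rwa [affHom_affY, affHom_affY] at this

include hρ in
/-- The formulas for the isogeny hold at every point of `Y₁(2)` over a field. -/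
lemma hom_uFun_vFun {L : Type} [Field L] [Algebra K L] (φ : RingY₁ →ₐ[K] L) :
    φ uFun = φ (eFun ρ) ^ 2 / (4 * φ dFun ^ 2) ∧
      φ (vFun ρ) = φ (eFun ρ) * (4 * lamA L - φ dFun ^ 2) / (8 * φ dFun ^ 2) := by
  have hx : φ dFun ≠ 0 := (isUnit_dFun.map φ).ne_zero
  have h4 : (4 : L) ≠ 0 := (isUnit_ofNat L 4).ne_zero
  have h8 : (8 : L) ≠ 0 := (isUnit_ofNat L 8).ne_zero
  have e4 : φ 4 = 4 := map_ofNat φ 4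
  have e8 : φ 8 = 8 := map_ofNat φ 8
  constructor
  · rw [eq_div_iff (mul_ne_zero h4 (pow_ne_zero 2 hx)), ← map_pow φ (eFun ρ), ← uFun_mul hρ,
      map_mul, map_mul, map_pow, e4]
  · have := congrArg φ (vFun_mul (ρ := ρ))
    rw [map_mul, map_mul, map_mul, map_sub, map_mul, map_pow, e8, e4, AlgHom.commutes] at this
    rw [eq_div_iff (mul_ne_zero h8 (pow_ne_zero 2 hx)), this]

lemma SpecMap_toE₁ {A : Type} [CommRing A] [Algebra K A] (φ : RingY₁ →ₐ[K] A) :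
    Spec.map (CommRingCat.ofHom φ.toRingHom) ≫ toE₁ hρ =
      affPoint (φ dFun) (φ (eFun ρ)) (equation_vec_map φ (equation_de hρ)) :=
  SpecMap_affPoint ..

lemma SpecMap_quotientMap_toE₀ {A : Type} [CommRing A] [Algebra K A] (φ : RingY₁ →ₐ[K] A) :
    Spec.map (CommRingCat.ofHom φ.toRingHom) ≫ quotientMap.left ≫ toE₀ hρ =
      affPoint ((φ.comp RingY₀.val) uFun) ((φ.comp RingY₀.val) (vFun ρ))
        (equation_vec_map (φ.comp RingY₀.val) (equation_uv hρ)) := by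
  rw [← SpecMap_affPoint]
  refine (Category.assoc _ _ _).symm.trans ?_
  exact congrArg (· ≫ toE₀ hρ) (Spec.map_comp _ _).symm

include hψ in
/-- The isogeny at the points of `E₁` with `e ≠ 0`, which are points of `Y₁(2)`. -/
lemma affPoint_comp_isogeny {L : Type} [Field L] [Algebra K L] {x y : L}
    (h : (E₁.baseChange L).toProjective.Equation ![x, y, 1]) (hy : y ≠ 0) :
    ∃ h', affPoint x y h ≫ ψ =
      affPoint (y ^ 2 / (4 * x ^ 2)) (y * (4 * lamA L - x ^ 2) / (8 * x ^ 2)) h' := by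
  obtain ⟨φ, rfl, rfl⟩ := exists_hom_of_ne_zero hρ h hy
  obtain ⟨hu, hv⟩ := hom_uFun_vFun hρ φ
  have key := ((congrArg (· ≫ ψ) (SpecMap_toE₁ hρ φ)).symm.trans
    ((Category.assoc _ _ _).trans
      (congrArg (Spec.map (CommRingCat.ofHom φ.toRingHom) ≫ ·) hψ))).trans
        (SpecMap_quotientMap_toE₀ hρ φ)
  have h' := equation_vec_map (φ.comp RingY₀.val) (equation_uv hρ)
  replace hu : (φ.comp RingY₀.val) uFun = _ := hu
  replace hv : (φ.comp RingY₀.val) (vFun ρ) = _ := hv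
  rw [hu, hv] at h'
  exact ⟨h', key.trans (affPoint_congr hu hv)⟩

lemma isDominant_SpecMap {A B : Type} [CommRing A] [CommRing B] (f : A →+* B)
    (hf : Function.Injective f) : IsDominant (Spec.map (CommRingCat.ofHom f)) := by
  refine ⟨(PrimeSpectrum.denseRange_comap_iff_ker_le_nilRadical f).mpr ?_⟩
  rw [(RingHom.injective_iff_ker_eq_bot f).mp hf]
  exact bot_le

variable (hψK : ψ ≫ (weierstrassScheme E₀).hom = (weierstrassScheme E₁).hom)

include hψ hψK in
/-- Two extensions to the spectrum of a domain `D` of a point over a field `B` containing it agree,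
as the spectrum of `B` maps to the generic point; over `B` the formulas for the isogeny hold. -/
lemma ringPoint_comp_isogeny_of_injective {D B : Type} [CommRing D] [IsDomain D] [Algebra K D]
    [Field B] [Algebra K B] (f : D →ₐ[K] B) (hf : Function.Injective f) {v w : Fin 3 → D}
    (hv : (E₁.baseChange D).toProjective.Equation v)
    (hw : (E₀.baseChange D).toProjective.Equation w) {i k : Fin 3} (hi : IsUnit (v i))
    (hk : IsUnit (w k)) (hv₁ : v 1 ≠ 0) (hv₂ : v 2 ≠ 0)
    (h₀ : w 0 * (4 * v 0 ^ 2) = v 1 ^ 2 * w 2)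
    (h₁ : w 1 * (8 * v 0 ^ 2 * v 2) = v 1 * (4 * lamA D * v 2 ^ 2 - v 0 ^ 2) * w 2) :
    ringPoint v hv i hi ≫ ψ = ringPoint w hw k hk := by
  have : IsDominant (Spec.map (CommRingCat.ofHom f.toRingHom)) := isDominant_SpecMap _ hf
  refine ext_of_isDominant_of_isSeparated (weierstrassScheme E₀).hom ?_
    (Spec.map (CommRingCat.ofHom f.toRingHom)) ?_
  · rw [Category.assoc, hψK, ringPoint_comp_hom, ringPoint_comp_hom]
  have hv₀ : v 0 ≠ 0 := by
    intro h
    have := E₁_equation_vec_iff.mp hv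
    rw [h] at this
    have : v 1 ^ 2 * v 2 = 0 := by linear_combination this
    simp [hv₁, hv₂] at this
  have hfv := E₁_equation_vec_iff.mp (equation_comp f hv)
  have h₀' := congrArg f h₀
  have h₁' := congrArg f h₁
  have e4 : f 4 = 4 := map_ofNat f 4
  have e8 : f 8 = 8 := map_ofNat f 8
  simp only [map_mul, map_pow, e4, e8, map_sub, AlgHom.commutes, Function.comp_apply] at h₀' h₁' hfv
  have hx : f (v 0) ≠ 0 := (map_ne_zero_iff f hf).mpr hv₀
  have hy : f (v 1) ≠ 0 := (map_ne_zero_iff f hf).mpr hv₁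
  have hz : f (v 2) ≠ 0 := (map_ne_zero_iff f hf).mpr hv₂
  have h4 : (4 : B) ≠ 0 := (isUnit_ofNat B 4).ne_zero
  have h8 : (8 : B) ≠ 0 := (isUnit_ofNat B 8).ne_zero
  have hE : (E₁.baseChange B).toProjective.Equation ![f (v 0) / f (v 2), f (v 1) / f (v 2), 1] := by
    rw [E₁_equation_iff]
    field_simp
    linear_combination hfv
  obtain ⟨h', hh⟩ := affPoint_comp_isogeny hρ hψ hE (div_ne_zero hy hz)
  have hv' (k : Fin 3) : f (v k) = f (v 2) * ![f (v 0) / f (v 2), f (v 1) / f (v 2), 1] k := by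
    fin_cases k <;> simp [mul_div_cancel₀, hz]
  have hw' (k : Fin 3) : f (w k) = f (w 2) *
    ![(f (v 1) / f (v 2)) ^ 2 / (4 * (f (v 0) / f (v 2)) ^ 2),
      f (v 1) / f (v 2) * (4 * lamA B - (f (v 0) / f (v 2)) ^ 2) /
        (8 * (f (v 0) / f (v 2)) ^ 2), 1] k := by
    fin_cases k
    · simp
      field_simp
      linear_combination h₀'
    · simp
      field_simp
      linear_combination h₁'
    · simp
  have hvec : Spec.map (CommRingCat.ofHom f.toRingHom) ≫ ringPoint v hv i hi = affPoint _ _ hE := by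
    rw [SpecMap_ringPoint]
    refine ringPoint_eq_of_mul_eq_mul _ _ _ _ fun k l ↦ ?_
    simp only [Function.comp_apply]
    rw [hv' k, hv' l]
    ring
  rw [← Category.assoc, hvec, hh, SpecMap_ringPoint]
  refine ringPoint_eq_of_mul_eq_mul _ _ _ _ fun k l ↦ ?_
  simp only [Function.comp_apply]
  rw [hw' k, hw' l]
  ring

include hψ hψK in
/-- The isogeny at points of `E₁` with values in a domain that are generically in `Y₁(2)`. -/
lemma ringPoint_comp_isogeny {D : Type} [CommRing D] [IsDomain D] [Algebra K D] {v w : Fin 3 → D}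
    (hv : (E₁.baseChange D).toProjective.Equation v)
    (hw : (E₀.baseChange D).toProjective.Equation w) {i k : Fin 3} (hi : IsUnit (v i))
    (hk : IsUnit (w k)) (hv₁ : v 1 ≠ 0) (hv₂ : v 2 ≠ 0)
    (h₀ : w 0 * (4 * v 0 ^ 2) = v 1 ^ 2 * w 2)
    (h₁ : w 1 * (8 * v 0 ^ 2 * v 2) = v 1 * (4 * lamA D * v 2 ^ 2 - v 0 ^ 2) * w 2) :
    ringPoint v hv i hi ≫ ψ = ringPoint w hw k hk :=
  ringPoint_comp_isogeny_of_injective hρ hψ hψK (IsScalarTower.toAlgHom K D (FractionRing D))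
    (IsFractionRing.injective D _) hv hw hi hk hv₁ hv₂ h₀ h₁

/-- A vector satisfying the formulas for the isogeny at a vector on the cone over `E₁` lies on the
cone over `E₀`. -/
lemma E₀_equation_of_mul_eq {D : Type} [CommRing D] [IsDomain D] [Algebra K D] {v w : Fin 3 → D}
    (hv : (E₁.baseChange D).toProjective.Equation v) (hv₁ : v 1 ≠ 0) (hv₂ : v 2 ≠ 0)
    (h₀ : w 0 * (4 * v 0 ^ 2) = v 1 ^ 2 * w 2)
    (h₁ : w 1 * (8 * v 0 ^ 2 * v 2) = v 1 * (4 * lamA D * v 2 ^ 2 - v 0 ^ 2) * w 2) :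
    (E₀.baseChange D).toProjective.Equation w := by
  rw [E₁_equation_vec_iff] at hv
  have hv₀ : v 0 ≠ 0 := by
    intro h
    rw [h] at hv
    have : v 1 ^ 2 * v 2 = 0 := by linear_combination hv
    simp [hv₁, hv₂] at this
  have h64 : (64 : D) ≠ 0 := (isUnit_ofNat D 64).ne_zero
  refine E₀_equation_vec_iff.mpr (mul_left_cancel₀
    (mul_ne_zero h64 (mul_ne_zero (pow_ne_zero 6 hv₀) (pow_ne_zero 2 hv₂))) ?_)
  have hl : 64 * (v 0 ^ 6 * v 2 ^ 2) * (w 1 ^ 2 * w 2) =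
      v 0 ^ 2 * w 2 * (w 1 * (8 * v 0 ^ 2 * v 2)) ^ 2 := by ring
  have hr : 64 * (v 0 ^ 6 * v 2 ^ 2) *
      (w 0 ^ 3 + 2 * w 0 ^ 2 * w 2 + (1 - lamA D) * w 0 * w 2 ^ 2) =
      v 2 ^ 2 * ((w 0 * (4 * v 0 ^ 2)) ^ 3 + 8 * v 0 ^ 2 * w 2 * (w 0 * (4 * v 0 ^ 2)) ^ 2 +
        16 * v 0 ^ 4 * (1 - lamA D) * w 2 ^ 2 * (w 0 * (4 * v 0 ^ 2))) := by ring
  rw [hl, hr, h₀, h₁]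
  linear_combination (-v 1 ^ 2 * w 2 ^ 3 * (v 1 ^ 2 * v 2 +
    v 0 * (v 0 ^ 2 - 4 * v 0 * v 2 + 4 * lamA D * v 2 ^ 2) + 8 * v 0 ^ 2 * v 2)) * hv

lemma coord_E₁_one_ne_zero : coord E₁ 1 ≠ 0 := fun h ↦ by
  have h' : coneHom ![affX E₁, affY E₁, 1] (equation_affine E₁) (coord E₁ 1) = affY E₁ :=
    coneHom_coord ..
  rw [h, map_zero] at h'
  exact affY_E₁_ne_zero h'.symm

lemma equation_coord (W : WeierstrassCurve K) :
    (W.baseChange (HomogCoordRing W)).toProjective.Equation (coord W) := by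
  refine equation_of_aeval (Eq.trans ?_ (Ideal.Quotient.eq_zero_iff_mem.mpr
    (Ideal.mem_span_singleton_self W.toProjective.polynomial)))
  exact congrArg
    (fun φ : MvPolynomial (Fin 3) K →ₐ[K] HomogCoordRing W ↦ φ W.toProjective.polynomial)
    (MvPolynomial.algHom_ext (g := Ideal.Quotient.mkₐ K _) fun k ↦ by
      rw [MvPolynomial.aeval_X]; rfl)

include hψ hψK in
/-- The isogeny at points over a field. The vector `w` of forms on `E₁` describes the isogeny where
these forms do not vanish simultaneously. -/
lemma ringPoint_comp_isogeny_field {L : Type} [Field L] [Algebra K L] {v : Fin 3 → L}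
    (hv : (E₁.baseChange L).toProjective.Equation v) {i : Fin 3} (hi : IsUnit (v i))
    (w : Fin 3 → HomogCoordRing E₁)
    (h₀ : w 0 * (4 * coord E₁ 0 ^ 2) = coord E₁ 1 ^ 2 * w 2)
    (h₁ : w 1 * (8 * coord E₁ 0 ^ 2 * coord E₁ 2) =
      coord E₁ 1 * (4 * lamA _ * coord E₁ 2 ^ 2 - coord E₁ 0 ^ 2) * w 2) {w' : Fin 3 → L}
    (hw' : (E₀.baseChange L).toProjective.Equation w') {k : Fin 3} (hk : IsUnit (w' k))
    (c : L) (hc : c ≠ 0) (hww' : ∀ k, coneHom v hv (w k) = c * w' k) :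
    ringPoint v hv i hi ≫ ψ = ringPoint w' hw' k hk := by
  -- The point specializes the generic point of the cone over `E₁`, through the local ring at the
  -- kernel of the evaluation at `v`.
  let f := coneHom v hv
  let p : Ideal (HomogCoordRing E₁) := RingHom.ker f
  have : p.IsPrime := RingHom.ker_isPrime _
  let D := Localization.AtPrime p
  have : IsDomain D := IsLocalization.isDomain_localization p.primeCompl_le_nonZeroDivisors
  let ι : HomogCoordRing E₁ →ₐ[K] D := IsScalarTower.toAlgHom K _ D
  have hι : Function.Injective ι := IsLocalization.injective D p.primeCompl_le_nonZeroDivisors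
  have hunit {x : HomogCoordRing E₁} (hx : f x ≠ 0) : IsUnit (ι x) :=
    IsLocalization.map_units D (⟨x, hx⟩ : p.primeCompl)
  let g₀ : D →+* L := IsLocalization.lift (M := p.primeCompl) (g := f.toRingHom)
    fun x ↦ IsUnit.mk0 _ x.2
  have hg₀ (x) : g₀ (ι x) = f x := IsLocalization.lift_eq _ x
  let g : D →ₐ[K] L := { g₀ with
    commutes' := fun c ↦ by
      have := hg₀ (algebraMap K _ c)
      rwa [AlgHom.commutes, AlgHom.commutes] at this }
  have hg (x) : g (ι x) = f x := hg₀ x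
  have hι₁ : ι (coord E₁ 1) ≠ 0 := (map_ne_zero_iff ι hι).mpr coord_E₁_one_ne_zero
  have hι₂ : ι (coord E₁ 2) ≠ 0 := (map_ne_zero_iff ι hι).mpr (coord_two_ne_zero E₁)
  have heq := equation_comp (B := D) ι (equation_coord E₁)
  have e4 : ι 4 = 4 := map_ofNat ι 4
  have e8 : ι 8 = 8 := map_ofNat ι 8
  have h₀' := congrArg ι h₀
  have h₁' := congrArg ι h₁
  simp only [map_mul, map_pow, e4, e8, map_sub, AlgHom.commutes] at h₀' h₁'
  have hfi : f (coord E₁ i) ≠ 0 := (coneHom_coord v hv i).symm ▸ hi.ne_zero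
  have hfk : f (w k) ≠ 0 := (hww' k).symm ▸ mul_ne_zero hc hk.ne_zero
  have key := ringPoint_comp_isogeny hρ hψ hψK heq
    (E₀_equation_of_mul_eq (w := ι ∘ w) heq hι₁ hι₂ h₀' h₁') (hunit hfi) (hunit hfk) hι₁ hι₂ h₀' h₁'
  have key' := congrArg (Spec.map (CommRingCat.ofHom g.toRingHom) ≫ ·) key
  simp only [← Category.assoc, SpecMap_ringPoint] at key'
  refine Eq.trans (congrArg (· ≫ ψ) ?_) (key'.trans ?_)
  · refine ringPoint_eq_of_mul_eq_mul _ _ _ _ fun k l ↦ ?_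
    simp only [Function.comp_apply, hg, f, coneHom_coord]
    ring
  · refine ringPoint_eq_of_mul_eq_mul _ _ _ _ fun k l ↦ ?_
    simp only [Function.comp_apply, hg, f, hww']
    ring

end IsogenyMorphism

section IsogenyPoints

/-- The curves `E₁` and `E₀` over any extension field are two-isogenous. -/
lemma isTwoIsogenous (L : Type) [Field L] [Algebra K L] :
    IsTwoIsogenous (E₁.baseChange L).toAffine (E₀.baseChange L).toAffine (-4) (4 * lamA L) where
  left := {
    a₁ := map_zero (algebraMap K L)
    a₂ := (map_neg (algebraMap K L) 4).trans (congrArg _ (map_ofNat _ 4))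
    a₃ := map_zero (algebraMap K L)
    a₄ := (map_mul (algebraMap K L) 4 lam).trans (congrArg (· * _) (map_ofNat _ 4))
    a₆ := map_zero (algebraMap K L) }
  right := {
    a₁ := map_zero (algebraMap K L)
    a₂ := by
      have h2 : (2 : L) ≠ 0 := (isUnit_ofNat L 2).ne_zero
      refine (map_ofNat (algebraMap K L) 2).trans ?_
      field_simp
      ring
    a₃ := map_zero (algebraMap K L)
    a₄ := by
      have h16 : (16 : L) ≠ 0 := (isUnit_ofNat L 16).ne_zero
      refine ((map_sub (algebraMap K L) 1 lam).trans (congrArg (· - _) (map_one _))).trans ?_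
      field_simp
      ring
    a₆ := map_zero (algebraMap K L) }
  two_ne_zero := (isUnit_ofNat L 2).ne_zero
  b_ne_zero := mul_ne_zero (isUnit_ofNat L 4).ne_zero
    ((map_ne_zero (algebraMap K L)).mpr lam_ne_zero)
  disc_ne_zero := by
    have h : (-4) ^ 2 - 4 * (4 * lamA L) = 16 * algebraMap K L (1 - lam) := by
      rw [map_sub, map_one]
      ring
    rw [h]
    exact mul_ne_zero (isUnit_ofNat L 16).ne_zero
      ((map_ne_zero (algebraMap K L)).mpr (sub_ne_zero.mpr lam_ne_one.symm))

variable {ρ : K} (hρ : ρ ^ 2 = -2)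
  {ψ : (weierstrassScheme E₁).left ⟶ (weierstrassScheme E₀).left}
  (hψ : toE₁ hρ ≫ ψ = quotientMap.left ≫ toE₀ hρ)
  (hψK : ψ ≫ (weierstrassScheme E₀).hom = (weierstrassScheme E₁).hom)

include hψ hψK

/-- The isogeny acts on points by its formulas, including the points at which the formulas in `d`
and `e` are not defined. In homogeneous coordinates the formulas are the triple of forms
`(2 Y² Z, Y (4 λ Z² - X²), 8 X² Z)`. Modulo the equation of the curve, which reads `Y² Z = X q` with
`q = X² - 4 X Z + 4 λ Z²`, there are proportional triples that do not vanish at `(0, 0)` and at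
infinity: they are obtained by multiplication with `q / Y` and with `X / Z`. -/
lemma pointHom_comp_isogeny {L : Type} [Field L] [DecidableEq L] [Algebra K L]
    (P : (E₁.baseChange L).toAffine.Point) :
    pointHom P ≫ ψ = pointHom ((isTwoIsogenous L).map P) := by
  have h2 : (2 : L) ≠ 0 := (isUnit_ofNat L 2).ne_zero
  have h4 : (4 : L) ≠ 0 := (isUnit_ofNat L 4).ne_zero
  have h8 : (8 : L) ≠ 0 := (isUnit_ofNat L 8).ne_zero
  have hlam : lamA L ≠ 0 := (map_ne_zero (algebraMap K L)).mpr lam_ne_zero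
  obtain ⟨X, hX⟩ : ∃ X, X = coord E₁ 0 := ⟨_, rfl⟩
  obtain ⟨Y, hY⟩ : ∃ Y, Y = coord E₁ 1 := ⟨_, rfl⟩
  obtain ⟨Z, hZ⟩ : ∃ Z, Z = coord E₁ 2 := ⟨_, rfl⟩
  have heq := E₁_equation_vec_iff.mp (equation_coord E₁)
  have hc {v : Fin 3 → L} (hv : (E₁.baseChange L).toProjective.Equation v) :
      coneHom v hv X = v 0 ∧ coneHom v hv Y = v 1 ∧ coneHom v hv Z = v 2 ∧
        coneHom v hv 2 = 2 ∧ coneHom v hv 4 = 4 ∧ coneHom v hv 8 = 8 := by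
    subst hX hY hZ
    exact ⟨coneHom_coord .., coneHom_coord .., coneHom_coord .., map_ofNat _ 2, map_ofNat _ 4,
      map_ofNat _ 8⟩
  rw [← hX, ← hY, ← hZ] at heq
  rcases P with _ | ⟨x, y, h⟩
  · change _ = pointHom .zero
    rw [pointHom_zero, pointHom_zero]
    obtain ⟨c0, c1, c2, k2, k4, k8⟩ := hc (WeierstrassCurve.Projective.equation_zero (R := L))
    refine ringPoint_comp_isogeny_field hρ hψ hψK _ _
      ![2 * Y ^ 2 * X, Y * (8 * lamA _ * X * Z - Y ^ 2 - 4 * X ^ 2), 8 * X ^ 3] ?_ ?_ _ _ (-1)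
      (by simp) fun k ↦ ?_
    · simp only [← hX, ← hY, Matrix.cons_val]
      ring
    · simp only [← hX, ← hY, ← hZ, Matrix.cons_val]
      linear_combination (-8 * X ^ 2 * Y) * heq
    · fin_cases k <;> simp [c0, c1, c2, k2, k4, k8]
  · have hxy := E₁_equation_iff.mp ((WeierstrassCurve.Projective.equation_some x y).mpr h.1)
    obtain ⟨c0, c1, c2, k2, k4, k8⟩ := hc ((WeierstrassCurve.Projective.equation_some x y).mpr h.1)
    by_cases hx : x = 0
    · subst hx
      obtain rfl := (isTwoIsogenous L).eq_zero_of_nonsingular_zero h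
      rw [(isTwoIsogenous L).map_some_zero, pointHom_some]
      change _ = pointHom .zero
      rw [pointHom_zero]
      refine ringPoint_comp_isogeny_field hρ hψ hψK _ _
        ![2 * (X ^ 2 - 4 * X * Z + 4 * lamA _ * Z ^ 2) * Y * Z,
          (X ^ 2 - 4 * X * Z + 4 * lamA _ * Z ^ 2) * (4 * lamA _ * Z ^ 2 - X ^ 2),
          8 * X * Y * Z ^ 2] ?_ ?_ _ _ (16 * lamA L ^ 2)
        (mul_ne_zero (isUnit_ofNat L 16).ne_zero (pow_ne_zero 2 hlam)) fun k ↦ ?_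
      · simp only [← hX, ← hY, Matrix.cons_val]
        linear_combination (-8 * X * Y * Z) * heq
      · simp only [← hX, ← hY, ← hZ, Matrix.cons_val]
        linear_combination (-8 * X * Z * (4 * lamA _ * Z ^ 2 - X ^ 2)) * heq
      · fin_cases k
        · simp [c0, c1, c2, k2, k4, k8]
        · simp [c0, c1, c2, k2, k4, k8]
          ring
        · simp [c0, c1, c2, k2, k4, k8]
    · rw [(isTwoIsogenous L).map_some h hx, pointHom_some, pointHom_some]
      refine ringPoint_comp_isogeny_field hρ hψ hψK _ _
        ![2 * Y ^ 2 * Z, Y * (4 * lamA _ * Z ^ 2 - X ^ 2), 8 * X ^ 2 * Z] ?_ ?_ _ _ (8 * x ^ 2)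
        (mul_ne_zero h8 (pow_ne_zero 2 hx)) fun k ↦ ?_
      · simp only [← hX, ← hY, Matrix.cons_val]
        ring
      · simp only [← hX, ← hY, ← hZ, Matrix.cons_val]
      · fin_cases k
        · simp [c0, c1, c2, k2, k4, k8]
          field_simp
          ring
        · simp [c0, c1, c2, k2, k4, k8]
          field_simp
        · simp [c0, c1, c2, k2, k4, k8]

omit hψ hψK in
instance isDomain_ringY₁ : IsDomain RingY₁ := by
  obtain ⟨r, hr⟩ := IsAlgClosed.exists_pow_nat_eq (-2 : ℂ) two_pos
  refine (isDomain_and_transcendental (ρ := RatFunc.C r) ?_).1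
  rw [← map_pow, hr, map_neg, map_ofNat (RatFunc.C (K := ℂ))]

omit hψ hψK in
instance : Nonempty Y₁.left := inferInstanceAs (Nonempty (PrimeSpectrum RingY₁))

omit hψ hψK in
instance : Nonempty Y₀.left := inferInstanceAs (Nonempty (PrimeSpectrum RingY₀))

omit hψ hψK in
instance : IsDominant (quotientMap.left) := isDominant_SpecMap _ Subtype.val_injective

/-- The isogeny is proper, and it is dominant since the quotient map is. -/
lemma surjective_isogeny : Surjective ψ := by
  have := isDominant_of_isOpenImmersion (toE₀ hρ)
  have : IsDominant ψ := by
    have : IsDominant (toE₁ hρ ≫ ψ) := hψ ▸ inferInstance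
    exact .of_comp (toE₁ hρ) ψ
  have : IsProper (ψ ≫ (weierstrassScheme E₀).hom) := hψK ▸ inferInstance
  have : IsProper ψ := .of_comp ψ (weierstrassScheme E₀).hom
  exact surjective_of_isDominant_of_isClosed_range ψ ψ.isClosedMap.isClosed_range

end IsogenyPoints

/-! ### Birational maps to curves -/

section Birational

variable {F : Type} [Field F]

/-- An integral scheme is birational to its nonempty open subschemes. -/
lemma nonempty_birationalMap {X Y : SchOver F} [IsIntegral X.left] [Nonempty Y.left]
    (j : Y.left ⟶ X.left) [IsOpenImmersion j] (h : j ≫ X.hom = Y.hom) :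
    Nonempty (BirationalMap X Y) := by
  have := isDominant_of_isOpenImmersion j
  obtain ⟨f, hf⟩ := Scheme.Hom.birationalOver j X.hom Y.hom h
  exact ⟨⟨f.symm, Scheme.PartialIso.IsOver.symm hf⟩⟩

namespace BirationalMap

variable {X Y X' Y' : SchOver F} (β : BirationalMap X Y) (β' : BirationalMap X' Y')

lemma incl_comp_hom : β.incl ≫ X.hom = β.toHom ≫ Y.hom :=
  (Eq.symm β.isOver).trans (Category.assoc _ _ _).symm

instance [IsIntegral X.left] : Nonempty β.source := by
  obtain ⟨x, hx⟩ := β.toPartialIso.dense_source.nonempty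
  exact ⟨⟨x, hx⟩⟩

instance : IsDominant β.toHom := by
  have := Opens.isDominant_ι β.toPartialIso.dense_target
  infer_instance

/-- Through an open immersion of its target in a smooth projective curve, a birational map from a
smooth projective curve extends to an isomorphism. -/
lemma exists_iso {E : SchOver F} (hX : IsSmoothProjectiveCurve X) (hE : IsSmoothProjectiveCurve E)
    (j : Y.left ⟶ E.left) [IsOpenImmersion j] (hj : j ≫ E.hom = Y.hom) :
    ∃ φ : X ≅ E, β.incl ≫ φ.hom.left = β.toHom ≫ j := by
  have := hX.isIntegral
  have := hE.isIntegral
  have := hX.smooth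
  have := hE.smooth
  have := hX.isProper
  have := hE.isProper
  obtain ⟨φ, hφ, hφ'⟩ := exists_iso_extension X.hom E.hom β.incl (β.toHom ≫ j) (by
    rw [Category.assoc, hj, incl_comp_hom])
  exact ⟨Over.isoMk φ hφ', hφ⟩

variable {β β'} in
/-- A morphism induced by a dominant morphism is determined by it. -/
lemma Induces.eq [IsIntegral X.left] [IsIntegral X'.left] [IsSeparated X'.hom] {q : Y ⟶ Y'}
    [IsDominant q.left] {π π' : X ⟶ X'} (h : β.Induces β' q π) (h' : β.Induces β' q π') :
    π' = π := by
  let f := β.toHom ≫ q.left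
  -- The open subscheme of the source of `β` that is mapped to the target of `β'`.
  let T := Limits.pullback f β'.toHom
  have : Nonempty T := by
    have hd : DenseRange f := Scheme.Hom.denseRange f
    obtain ⟨_, ⟨x', rfl⟩, x, hx⟩ := hd.inter_open_nonempty _ β'.toHom.opensRange.2
      ⟨_, Set.mem_range_self (Classical.arbitrary _)⟩
    obtain ⟨z, -⟩ := Scheme.Pullback.exists_preimage_pullback x x' hx
    exact ⟨z⟩
  have hT : (Limits.pullback.fst f β'.toHom ≫ β.toHom ≫ q.left) =
      Limits.pullback.snd f β'.toHom ≫ β'.toHom := Limits.pullback.condition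
  refine Over.OverMorphism.ext (hom_ext_of_isOpenImmersion (sY := X'.hom)
    (Limits.pullback.fst f β'.toHom ≫ β.incl) ?_ ?_)
  · rw [Over.w, Over.w]
  · rw [Category.assoc, Category.assoc]
    exact (h' _ _ _ hT).trans (h _ _ _ hT).symm

/-- In terms of isomorphisms with other curves containing the targets of the birational maps, an
extension `ψ` of `q` induces a morphism. -/
lemma induces_of_comp_eq {E E' : SchOver F} {q : Y ⟶ Y'} {j : Y.left ⟶ E.left}
    {j' : Y'.left ⟶ E'.left} {φ : X ≅ E} {φ' : X' ≅ E'} (hφ : β.incl ≫ φ.hom.left = β.toHom ≫ j)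
    (hφ' : β'.incl ≫ φ'.hom.left = β'.toHom ≫ j') {ψ : E ⟶ E'} (hψ : j ≫ ψ.left = q.left ≫ j') :
    β.Induces β' q (φ.hom ≫ ψ ≫ φ'.inv) := by
  intro T x x' h
  have h₁ : φ'.inv.left ≫ φ'.hom.left = 𝟙 _ := by
    rw [← Over.comp_left, Iso.inv_hom_id, Over.id_left]
  have h₂ : φ'.hom.left ≫ φ'.inv.left = 𝟙 _ := by
    rw [← Over.comp_left, Iso.hom_inv_id, Over.id_left]
  calc x ≫ β.incl ≫ (φ.hom ≫ ψ ≫ φ'.inv).left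
      = x ≫ (β.incl ≫ φ.hom.left) ≫ ψ.left ≫ φ'.inv.left := by simp
    _ = (x ≫ β.toHom ≫ q.left) ≫ j' ≫ φ'.inv.left := by
      rw [hφ]
      simp only [Category.assoc]
      rw [reassoc_of% hψ]
    _ = x' ≫ (β'.incl ≫ φ'.hom.left) ≫ φ'.inv.left := by rw [h, hφ']; simp only [Category.assoc]
    _ = x' ≫ β'.incl := by rw [Category.assoc, h₂, Category.comp_id]

end BirationalMap

end Birational

/-! ### Values of functions at points -/

section Values

/-- A point `y` over a field of an affine scheme which is mapped to a given point of the affine part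
of a Weierstrass curve is given by evaluating functions. -/
lemma exists_algHom_of_comp_affPoint {F A L : Type} [Field F] {W : WeierstrassCurve F} [CommRing A]
    [Algebra F A] [Field L] [Algebra F L] {s t : A}
    (h : (W.baseChange A).toProjective.Equation ![s, t, 1]) (y : Spec (.of L) ⟶ Spec (.of A))
    {x' y' : L} (h' : (W.baseChange L).toAffine.Nonsingular x' y')
    (he : y ≫ affPoint s t h = pointHom (.some x' y' h')) :
    ∃ θ : A →ₐ[F] L, (∀ a, valueAt y a = θ a) ∧ θ s = x' ∧ θ t = y' := by
  have hy : Spec.map (Spec.preimage y) = y := Spec.map_preimage y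
  rw [pointHom_some] at he
  have hK := congrArg (· ≫ (weierstrassScheme W).hom) he
  simp only [Category.assoc, affPoint_comp_hom] at hK
  rw [← hy, ← Spec.map_comp] at hK
  have hK' := congrArg CommRingCat.Hom.hom (Spec.map_injective hK)
  let θ : A →ₐ[F] L := { (Spec.preimage y).hom with
    commutes' := fun c ↦ DFunLike.congr_fun hK' c }
  have hθ : Spec.map (CommRingCat.ofHom θ.toRingHom) = y := hy
  rw [← hθ, SpecMap_affPoint] at he
  exact ⟨θ, fun _ ↦ rfl, affPoint_injective he⟩

end Values

section Models

lemma E₁_Δ_ne_zero : E₁.Δ ≠ 0 := by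
  have h : HasTwoTorsion (L := K) E₁ (-4) (4 * lam) := ⟨rfl, rfl, rfl, rfl, rfl⟩
  rw [h.Δ, show (16 : K) * (4 * lam) ^ 2 * ((-4) ^ 2 - 4 * (4 * lam)) =
    4096 * (lam ^ 2 * (1 - lam)) by ring]
  exact mul_ne_zero (by norm_num) (mul_ne_zero (pow_ne_zero 2 lam_ne_zero)
    (sub_ne_zero.mpr lam_ne_one.symm))

lemma E₀_Δ_ne_zero : E₀.Δ ≠ 0 := by
  have h : HasTwoTorsion (L := K) E₀ 2 (1 - lam) := ⟨rfl, rfl, rfl, rfl, rfl⟩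
  rw [h.Δ, show (16 : K) * (1 - lam) ^ 2 * (2 ^ 2 - 4 * (1 - lam)) =
    64 * (lam * (1 - lam) ^ 2) by ring]
  exact mul_ne_zero (by norm_num) (mul_ne_zero lam_ne_zero
    (pow_ne_zero 2 (sub_ne_zero.mpr lam_ne_one.symm)))

variable {ρ : K} (hρ : ρ ^ 2 = -2)

include hρ

/-- The functions `a` and `b` on `Y₀(2)` at a point with given `u` and `v`. -/
lemma valueAt_a₀_b₀ {L : Type} [Field L] [Algebra K L] (y : Spec (.of L) ⟶ Y₀.left) {u v : L}
    (huv : (E₀.baseChange L).toAffine.Nonsingular u v) (hu : u ≠ 0)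
    (h : y ≫ toE₀ hρ = pointHom (.some u v huv)) :
    valueAt (R := RingY₀) y a₀ = (4 * u ^ 2 - 4 * u + 1 - lamA L) / (6 * u) ∧
      valueAt (R := RingY₀) y b₀ =
        algebraMap K L ρ * (8 * u ^ 2 + 16 * u + lamA L - 1) * v / (54 * u ^ 2) := by
  have h6 : (6 : L) ≠ 0 := (isUnit_ofNat L 6).ne_zero
  have h54 : (54 : L) ≠ 0 := (isUnit_ofNat L 54).ne_zero
  obtain ⟨θ, hθ, rfl, rfl⟩ := exists_algHom_of_comp_affPoint (equation_uv hρ) y huv h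
  rw [hθ, hθ]
  have ha : 6 * uFun * a₀ = 4 * uFun ^ 2 - 4 * uFun + 1 - lamA RingY₀ := Subtype.ext a₁_mul
  have hb : 54 * uFun ^ 2 * b₀ = algebraMap K RingY₀ ρ *
    (8 * uFun ^ 2 + 16 * uFun + lamA RingY₀ - 1) * vFun ρ := Subtype.ext (b₁_mul hρ)
  have e (n : ℕ) [n.AtLeastTwo] : θ (OfNat.ofNat n) = OfNat.ofNat n := map_ofNat θ n
  constructor
  · have h := congrArg θ ha
    simp only [map_mul, map_sub, map_add, map_pow, map_one, e, AlgHom.commutes] at h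
    rw [eq_div_iff (mul_ne_zero h6 hu), ← h, mul_comm]
  · have h := congrArg θ hb
    simp only [map_mul, map_sub, map_add, map_pow, map_one, e, AlgHom.commutes] at h
    rw [eq_div_iff (mul_ne_zero h54 (pow_ne_zero 2 hu)), ← h, mul_comm]

/-- The functions `a`, `b` and `z₁` on `Y₁(2)` at a point with given `d` and `e`. -/
lemma valueAt_a₁_b₁_z₁ {L : Type} [Field L] [Algebra K L] (y : Spec (.of L) ⟶ Y₁.left)
    {d e u v : L} (hde : (E₁.baseChange L).toAffine.Nonsingular d e) (he : e ≠ 0)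
    (hu : u = e ^ 2 / (4 * d ^ 2)) (hv : v = e * (4 * lamA L - d ^ 2) / (8 * d ^ 2))
    (h : y ≫ toE₁ hρ = pointHom (.some d e hde)) :
    valueAt (R := RingY₁) y a₁ = (4 * u ^ 2 - 4 * u + 1 - lamA L) / (6 * u) ∧
      valueAt (R := RingY₁) y b₁ =
        algebraMap K L ρ * (8 * u ^ 2 + 16 * u + lamA L - 1) * v / (54 * u ^ 2) ∧
      valueAt (R := RingY₁) y z₁ =
        algebraMap K L ρ * (d ^ 2 - 6 * d + 8 * lamA L) / (6 * e) := by
  have h6 : (6 : L) ≠ 0 := (isUnit_ofNat L 6).ne_zero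
  have h54 : (54 : L) ≠ 0 := (isUnit_ofNat L 54).ne_zero
  obtain ⟨θ, hθ, rfl, rfl⟩ := exists_algHom_of_comp_affPoint (equation_de hρ) y hde h
  have e (n : ℕ) [n.AtLeastTwo] : θ (OfNat.ofNat n) = OfNat.ofNat n := map_ofNat θ n
  obtain ⟨hθu, hθv⟩ := hom_uFun_vFun hρ θ
  obtain rfl := hu.trans hθu.symm
  obtain rfl := hv.trans hθv.symm
  have hu₀ : θ uFun ≠ 0 := ((isUnit_uFun.map RingY₀.val).map θ).ne_zero
  rw [hθ, hθ, hθ]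
  refine ⟨?_, ?_, ?_⟩
  · have h := congrArg θ a₁_mul
    simp only [map_mul, map_sub, map_add, map_pow, map_one, e, AlgHom.commutes] at h
    rw [eq_div_iff (mul_ne_zero h6 hu₀), ← h, mul_comm]
  · have h := congrArg θ (b₁_mul hρ)
    simp only [map_mul, map_sub, map_add, map_pow, map_one, e, AlgHom.commutes] at h
    rw [eq_div_iff (mul_ne_zero h54 (pow_ne_zero 2 hu₀)), ← h, mul_comm]
  · have h := congrArg θ (six_mul_eFun_mul_z₁ (ρ := ρ))
    simp only [map_mul, map_sub, map_add, map_pow, e, AlgHom.commutes] at h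
    rw [eq_div_iff (mul_ne_zero h6 he), ← h, mul_comm]

/-- The isogeny: the extension to `E₁` of the quotient map `Y₁(2) → Y₀(2)`. -/
lemma exists_isogeny : ∃ ψ : weierstrassScheme E₁ ⟶ weierstrassScheme E₀,
    toE₁ hρ ≫ ψ.left = quotientMap.left ≫ toE₀ hρ := by
  have := smooth_weierstrassScheme E₁_Δ_ne_zero
  obtain ⟨ψ, hψ, hψK⟩ := exists_extension (weierstrassScheme E₁).hom (weierstrassScheme E₀).hom
    (toE₁ hρ) (quotientMap.left ≫ toE₀ hρ) (by
      rw [Category.assoc, toE₀_comp_hom, toE₁_comp_hom]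
      exact Over.w quotientMap)
  exact ⟨Over.homMk ψ hψK, hψ⟩

end Models

end TwoCycles

end

theorem mainTheorem4 (r : ℂ) (hr : r ^ 2 = -2) :
    -- `E₀` and `E₁` are smooth projective curves, birational over `ℂ(λ)` to `Y₀(2)` and `Y₁(2)`
    TwoCycles.IsSmoothProjectiveCurve (TwoCycles.weierstrassScheme TwoCycles.E₀) ∧
    TwoCycles.IsSmoothProjectiveCurve (TwoCycles.weierstrassScheme TwoCycles.E₁) ∧
    Nonempty (TwoCycles.BirationalMap (TwoCycles.weierstrassScheme TwoCycles.E₀) TwoCycles.Y₀) ∧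
    Nonempty (TwoCycles.BirationalMap (TwoCycles.weierstrassScheme TwoCycles.E₁) TwoCycles.Y₁) ∧
    -- there is an isogeny `ψ : E₁ → E₀` with kernel generated by `(0, 0)`, given by a formula
    ∃ ψ : TwoCycles.weierstrassScheme TwoCycles.E₁ ⟶ TwoCycles.weierstrassScheme TwoCycles.E₀,
      TwoCycles.IsIsogeny ψ ∧
      (∀ (L : Type) [Field L] [DecidableEq L] [Algebra TwoCycles.K L],
        ∃ h : (TwoCycles.E₁.baseChange L).toAffine.Point →+
            (TwoCycles.E₀.baseChange L).toAffine.Point,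
          TwoCycles.ActsOnPoints ψ h ∧
          (∃ h00 : (TwoCycles.E₁.baseChange L).toAffine.Nonsingular 0 0,
            addOrderOf (WeierstrassCurve.Affine.Point.some 0 0 h00) = 2 ∧
            h.ker = AddSubgroup.zmultiples (WeierstrassCurve.Affine.Point.some 0 0 h00)) ∧
          ∀ (d e : L) (hde : (TwoCycles.E₁.baseChange L).toAffine.Nonsingular d e), d ≠ 0 →
            ∃ huv : (TwoCycles.E₀.baseChange L).toAffine.Nonsingular
                (e ^ 2 / (4 * d ^ 2))
                (e * (4 * algebraMap TwoCycles.K L TwoCycles.lam - d ^ 2) / (8 * d ^ 2)),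
              h (.some d e hde) = .some _ _ huv) ∧
      -- for all smooth projective models `X₁` of `Y₁(2)` and `X₀` of `Y₀(2)`
      ∀ (X₁ X₀ : TwoCycles.SchOver TwoCycles.K),
        TwoCycles.IsSmoothProjectiveCurve X₁ → TwoCycles.IsSmoothProjectiveCurve X₀ →
        ∀ (β₁ : TwoCycles.BirationalMap X₁ TwoCycles.Y₁)
          (β₀ : TwoCycles.BirationalMap X₀ TwoCycles.Y₀),
        -- the natural map `π : X₁ → X₀` exists, is unique, and corresponds to `ψ`
        ∃ π : X₁ ⟶ X₀, β₁.Induces β₀ TwoCycles.quotientMap π ∧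
          (∀ π' : X₁ ⟶ X₀, β₁.Induces β₀ TwoCycles.quotientMap π' → π' = π) ∧
          ∃ (φ₁ : X₁ ≅ TwoCycles.weierstrassScheme TwoCycles.E₁)
            (φ₀ : X₀ ≅ TwoCycles.weierstrassScheme TwoCycles.E₀),
            π ≫ φ₀.hom = φ₁.hom ≫ ψ ∧
            -- the functions `a`, `b` in terms of `(u, v) ∈ E₀`
            (∀ (L : Type) [Field L] [Algebra TwoCycles.K L] (x : Spec (.of L) ⟶ β₀.source)
              (u v l s : L) (huv : (TwoCycles.E₀.baseChange L).toAffine.Nonsingular u v),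
              l = algebraMap TwoCycles.K L TwoCycles.lam →
              s = algebraMap TwoCycles.K L (RatFunc.C r) →
              u ≠ 0 →
              x ≫ β₀.incl ≫ φ₀.hom.left = TwoCycles.pointHom (.some u v huv) →
              TwoCycles.valueAt (x ≫ β₀.toHom) TwoCycles.a₀ =
                (4 * u ^ 2 - 4 * u + 1 - l) / (6 * u) ∧
              TwoCycles.valueAt (x ≫ β₀.toHom) TwoCycles.b₀ =
                s * (8 * u ^ 2 + 16 * u + l - 1) * v / (54 * u ^ 2)) ∧
            -- the functions `a`, `b`, `z₁` in terms of `(d, e) ∈ E₁`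
            (∀ (L : Type) [Field L] [Algebra TwoCycles.K L] (x : Spec (.of L) ⟶ β₁.source)
              (d e u v l s : L) (hde : (TwoCycles.E₁.baseChange L).toAffine.Nonsingular d e),
              l = algebraMap TwoCycles.K L TwoCycles.lam →
              s = algebraMap TwoCycles.K L (RatFunc.C r) →
              e ≠ 0 →
              u = e ^ 2 / (4 * d ^ 2) →
              v = e * (4 * l - d ^ 2) / (8 * d ^ 2) →
              x ≫ β₁.incl ≫ φ₁.hom.left = TwoCycles.pointHom (.some d e hde) →
              TwoCycles.valueAt (x ≫ β₁.toHom) TwoCycles.a₁ =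
                (4 * u ^ 2 - 4 * u + 1 - l) / (6 * u) ∧
              TwoCycles.valueAt (x ≫ β₁.toHom) TwoCycles.b₁ =
                s * (8 * u ^ 2 + 16 * u + l - 1) * v / (54 * u ^ 2) ∧
              TwoCycles.valueAt (x ≫ β₁.toHom) TwoCycles.z₁ =
                s * (d ^ 2 - 6 * d + 8 * l) / (6 * e)) := by
  have hρ : (RatFunc.C r : TwoCycles.K) ^ 2 = -2 := by
    rw [← map_pow, hr, map_neg, map_ofNat (RatFunc.C (K := ℂ))]
  have hE₀ := TwoCycles.isSmoothProjectiveCurve_weierstrassScheme TwoCycles.E₀_Δ_ne_zero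
  have hE₁ := TwoCycles.isSmoothProjectiveCurve_weierstrassScheme TwoCycles.E₁_Δ_ne_zero
  obtain ⟨ψ, hψ⟩ := TwoCycles.exists_isogeny hρ
  have hact (L : Type) [Field L] [DecidableEq L] [Algebra TwoCycles.K L] :
      TwoCycles.ActsOnPoints ψ (TwoCycles.isTwoIsogenous L).hom :=
    TwoCycles.pointHom_comp_isogeny hρ hψ (Over.w ψ)
  refine ⟨hE₀, hE₁, TwoCycles.nonempty_birationalMap _ (TwoCycles.toE₀_comp_hom hρ),
    TwoCycles.nonempty_birationalMap _ (TwoCycles.toE₁_comp_hom hρ), ψ,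
    ⟨TwoCycles.surjective_isogeny hρ hψ (Over.w ψ), fun L _ _ _ ↦ ⟨_, hact L⟩⟩,
    fun L _ _ _ ↦ ⟨(TwoCycles.isTwoIsogenous L).hom, hact L,
      ⟨(TwoCycles.isTwoIsogenous L).nonsingular_zero,
        (TwoCycles.isTwoIsogenous L).addOrderOf_torsion,
        (TwoCycles.isTwoIsogenous L).ker_hom⟩,
      fun d e hde hd ↦ ⟨_, (TwoCycles.isTwoIsogenous L).map_some hde hd⟩⟩,
    fun X₁ X₀ hX₁ hX₀ β₁ β₀ ↦ ?_⟩
  have := hX₁.isIntegral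
  have := hX₀.isIntegral
  have := hX₀.isProper
  obtain ⟨φ₁, hφ₁⟩ := β₁.exists_iso hX₁ hE₁ _ (TwoCycles.toE₁_comp_hom hρ)
  obtain ⟨φ₀, hφ₀⟩ := β₀.exists_iso hX₀ hE₀ _ (TwoCycles.toE₀_comp_hom hρ)
  have hind := TwoCycles.BirationalMap.induces_of_comp_eq β₁ β₀ hφ₁ hφ₀ hψ
  refine ⟨φ₁.hom ≫ ψ ≫ φ₀.inv, hind, fun π' h ↦ hind.eq h, φ₁, φ₀, by simp, ?_, ?_⟩
  · rintro L _ _ x u v _ _ huv rfl rfl hu h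
    rw [hφ₀] at h
    exact TwoCycles.valueAt_a₀_b₀ hρ (x ≫ β₀.toHom) huv hu ((Category.assoc _ _ _).trans h)
  · rintro L _ _ x d e u v _ _ hde rfl rfl he hu hv h
    rw [hφ₁] at h
    exact TwoCycles.valueAt_a₁_b₁_z₁ hρ (x ≫ β₁.toHom) hde he hu hv ((Category.assoc _ _ _).trans h)
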